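/- **Setting.** For a proper l.s.c. convex function $r$ on a finite-dimensional Euclidean space, $\operatorname{Prox}_r(x)=\arg\min_u\{r(u)+\tfrac12\|u-x\|^2\}$. For a Lipschitz mapping $S$, $\overline\nabla S(x)$ is the set of limits of $S'(x^k)$ over $x^k\to x$ at which $S$ is differentiable, and $JS(x)=\operatorname{conv}\overline\nabla S(x)$; $\operatorname{rge}W$ is the range of $W$, and $\partial$ is the limiting subdifferential. For $u\in\partial r(x)$ let $\Gamma_r(x,u)(v)=\min\{\langle v,d-v\rangle : W\in J\operatorname{Prox}_r(x+u),\ v=Wd\}$ if $v\in\bigcup_{W\in J\operatorname{Prox}_r(x+u)}\operatorname{rge}W$, and $\Gamma_r(x,u)(v)=\infty$ otherwise. We say that $r$ satisfies *Assumption 2* at $x$ for $u\in\partial r(x)$ if $r$ is proper, l.s.c., convex and there is $\overline W\in\overline\nabla\operatorname{Prox}_r(x+u)$ such that (a) $\bigcup_{W\in J\operatorname{Prox}_r(x+u)}\operatorname{rge}W=\operatorname{rge}\overline W$, and (b) every $y$ in this set can be written as $y=\overline W\bar z$ with $\langle y,\bar z-y\rangle=\min\{\langle y,z-y\rangle : W\in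 J\operatorname{Prox}_r(x+u),\ y=Wz\}$. Let $1\le p\le q$, let $\mathbb R^{p\times q}$ carry the trace inner product, and let $\|\cdot\|_*$ be the nuclear norm (the sum of the singular values). Given a singular value decomposition $A=R\,[\operatorname{Diag}(\sigma_1,\dots,\sigma_p)\ \,0]\,S^T$ with $R,S$ orthogonal and $\sigma_1\ge\dots\ge\sigma_p\ge0$, write $S=[S_1\ S_2]$ with $S_1\in\mathbb R^{q\times p}$, $h(t)=\max\{t-1,0\}$, $\alpha_1=\{i:\sigma_i>1\}$, $\alpha_2=\{i:\sigma_i=1\}$, $\alpha_3=\{i:\sigma_i<1\}$. Let $\widehat\Omega^\alpha,\Omega^\gamma\in\mathbb R^{p\times p}$ be the symmetric matrices with $\widehat\Omega^\alpha_{ij}=1$ for $i,j\in\alpha_1\cup\alpha_2$, $\widehat\Omega^\alpha_{ij}=\frac{\sigma_i-1}{\sigma_i-\sigma_j}$ for $i\in\alpha_1,j\in\alpha_3$, and $\Omega^\gamma_{ij}=\frac{h(\sigma_i)+h(\sigma_j)}{\sigma_i+\sigma_j}$ for $i\in\alpha_1$ and any $j$, all other entries being $0$; let $\Omega^\beta\in\mathbb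 R^{p\times(q-p)}$ have entries $\Omega^\beta_{ij}=\frac{\sigma_i-1}{\sigma_i}$ for $i\in\alpha_1$ and $0$ otherwise. With $\circ$ the entrywise product, define $$\mathcal W(D)=R\Big[\big(\widehat\Omega^\alpha\circ\tfrac{D_1+D_1^T}2+\Omega^\gamma\circ\tfrac{D_1-D_1^T}2\big)S_1^T+(\Omega^\beta\circ D_2)S_2^T\Big],\qquad D_1=R^TDS_1,\ D_2=R^TDS_2,$$ and, with $\widetilde Y=R^TYS$, $$\Phi(Y)=2\!\!\sum_{\substack{i<j,\ i\in\alpha_1\\ j\in\alpha_1\cup\alpha_2}}\!\!\Big(\tfrac{\sigma_i+\sigma_j}{h(\sigma_i)+h(\sigma_j)}-1\Big)\Big(\tfrac{\widetilde Y_{ij}-\widetilde Y_{ji}}2\Big)^2+2\!\!\sum_{i\in\alpha_1,\,j\in\alpha_3}\!\Big[\tfrac{1-\sigma_j}{\sigma_i-1}\Big(\tfrac{\widetilde Y_{ij}+\widetilde Y_{ji}}2\Big)^2+\tfrac{1+\sigma_j}{\sigma_i-1}\Big(\tfrac{\widetilde Y_{ij}-\widetilde Y_{ji}}2\Big)^2\Big]+\sum_{i\in\alpha_1}\tfrac1{\sigma_i-1}\sum_{j=p+1}^q\widetilde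 Y_{ij}^2 .$$ **Claim 1.** Let $X\in\mathbb R^{p\times q}$ and $U\in\partial\|X\|_*$. Then $\|\cdot\|_*$ satisfies Assumption 2 at $X$ for $U$. Moreover, for every singular value decomposition of $A=X+U$ as above: $\overline W=\mathcal W$ belongs to $\overline\nabla\operatorname{Prox}_{\|\cdot\|_*}(X+U)$ and has properties (a) and (b); $\bigcup_{W\in J\operatorname{Prox}_{\|\cdot\|_*}(X+U)}\operatorname{rge}W=\{\mathcal W(D): D\in\mathbb R^{p\times q}\}$; and $\Gamma_{\|\cdot\|_*}(X,U)(Y)=\Phi(Y)$, the minimum being attained, for $Y$ in this set, while $\Gamma_{\|\cdot\|_*}(X,U)(Y)=\infty$ for all other $Y$. **Claim 2.** Let $f_0:\mathbb R^n\to\mathbb R$ and $F:\mathbb R^n\to\mathbb R^{p\times q}$ be $C^2$, put $L(x,u)=f_0(x)+\langle F(x),u\rangle$, and let $(\bar x,\bar u)$ satisfy $\nabla_xL(\bar x,\bar u)=0$, $\bar u\in\partial\|F(\bar x)\|_*$. For every singular value decomposition of $A=F(\bar x)+\bar u$ as above, the following are equivalent: (i) strong variational sufficiency holds at $\bar x$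 relative to $\bar u$: for some $\sigma>0$ and $\kappa>0$ the function $G_\sigma(x,s)=f_0(x)+\|F(x)+s\|_*+\frac\sigma2\|s\|^2$ is variationally strongly convex at $(\bar x,0)$ for $(0,\bar u)$ with modulus $\kappa$, that is, there are convex neighbourhoods $\mathcal X$ of $(\bar x,0)$ and $\mathcal Y$ of $(0,\bar u)$, an l.s.c. convex function $\hat r\le G_\sigma$ on $\mathcal X$ that is strongly convex on $\mathcal X$ with modulus $\kappa$, and $\varepsilon>0$ such that $[\mathcal X_\varepsilon\times\mathcal Y]\cap\operatorname{gph}\partial G_\sigma=[\mathcal X\times\mathcal Y]\cap\operatorname{gph}\partial\hat r$ with $\mathcal X_\varepsilon=\{z\in\mathcal X: G_\sigma(z)<G_\sigma(\bar x,0)+\varepsilon\}$, and $G_\sigma(z)=\hat r(z)$ at the common elements $(z,w)$ of these graphs; (ii) the SSOSC: $\langle\nabla^2_{xx}L(\bar x,\bar u)d,d\rangle+\Gamma_{\|\cdot\|_*}(F(\bar x),\bar u)(F'(\bar x)d)>0$ for all $d\ne0$; (iii) the explicit SSOSC: $\langle\nabla^2_{xx}L(\bar x,\bar u)d,d\rangle+\Phi(F'(\bar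 x)d)>0$ for all $d\neq0$ with $F'(\bar x)d\in\{\mathcal W(D):D\in\mathbb R^{p\times q}\}$. -/

import Mathlib

open Set Filter Topology
open scoped InnerProductSpace Matrix

noncomputable section

namespace VarSuff

/-! ### Variational analysis of extended-real-valued functions -/

section General

variable {E : Type*} [NormedAddCommGroup E] [InnerProductSpace ℝ E]

/-- The function never takes the value `-∞` and is not identically `+∞`. -/
def IsProper (r : E → EReal) : Prop :=
  (∀ x, r x ≠ ⊥) ∧ ∃ x, r x ≠ ⊤

/-- Strong convexity with modulus `κ` on the set `X` of a function with values in `(-∞, ∞]`;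
for `κ = 0` this is convexity on `X`. -/
def StrongConvexE (X : Set E) (κ : ℝ) (r : E → EReal) : Prop :=
  Convex ℝ X ∧ ∀ x ∈ X, ∀ y ∈ X, ∀ a b : ℝ, 0 < a → 0 < b → a + b = 1 →
    r (a • x + b • y) + ((κ / 2 * (a * b) * ‖x - y‖ ^ 2 : ℝ) : EReal)
      ≤ (a : EReal) * r x + (b : EReal) * r y

/-- Convexity on the whole space of a function with values in `(-∞, ∞]`. -/
def ConvexE (r : E → EReal) : Prop := StrongConvexE univ 0 r

/-- The Fréchet regular subdifferential: `r x' ≥ r x + ⟪y, x' - x⟫ + o(‖x' - x‖)`, at points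
where `r` is finite. -/
def regSubdiff (r : E → EReal) (x : E) : Set E :=
  {y | r x ≠ ⊤ ∧ r x ≠ ⊥ ∧ ∀ ε : ℝ, 0 < ε → ∀ᶠ x' in 𝓝 x,
    r x + ((⟪y, x' - x⟫_ℝ - ε * ‖x' - x‖ : ℝ) : EReal) ≤ r x'}

/-- The Mordukhovich limiting subdifferential. -/
def limSubdiff (r : E → EReal) (x : E) : Set E :=
  {y | r x ≠ ⊤ ∧ r x ≠ ⊥ ∧ ∃ (xs ys : ℕ → E),
    Tendsto xs atTop (𝓝 x) ∧ Tendsto (fun k => r (xs k)) atTop (𝓝 (r x)) ∧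
    (∀ k, ys k ∈ regSubdiff r (xs k)) ∧ Tendsto ys atTop (𝓝 y)}

/-- `u` minimizes `r(u) + ‖u - x‖² / 2`. -/
def IsProxPoint (r : E → EReal) (x u : E) : Prop :=
  ∀ v : E, r u + ((1 / 2 * ‖u - x‖ ^ 2 : ℝ) : EReal) ≤ r v + ((1 / 2 * ‖v - x‖ ^ 2 : ℝ) : EReal)

/-- The proximal mapping with parameter `1`. For a proper l.s.c. convex function on a
finite-dimensional space the minimizer exists and is unique, so nothing is really chosen. -/
def prox (r : E → EReal) (x : E) : E :=
  Classical.epsilon (IsProxPoint r x)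

/-- The limiting (Bouligand) Jacobian of `S` at `x`. -/
def limJacobian (S : E → E) (x : E) : Set (E →L[ℝ] E) :=
  {V | ∃ xs : ℕ → E, (∀ k, DifferentiableAt ℝ S (xs k)) ∧ Tendsto xs atTop (𝓝 x) ∧
    Tendsto (fun k => fderiv ℝ S (xs k)) atTop (𝓝 V)}

/-- The Clarke generalized Jacobian. -/
def clarkeJacobian (S : E → E) (x : E) : Set (E →L[ℝ] E) :=
  convexHull ℝ (limJacobian S x)

/-- The union of the ranges of all `W` in the generalized Jacobian of `prox r` at `x + u`. -/
def rangeUnion (r : E → EReal) (x u : E) : Set E :=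
  ⋃ W ∈ clarkeJacobian (prox r) (x + u), range W

/-- The values `⟪v, d - v⟫` over all `d` and all `W` in the generalized Jacobian of `prox r` at
`x + u` with `v = W d`. -/
def sovfValues (r : E → EReal) (x u v : E) : Set ℝ :=
  {t | ∃ W ∈ clarkeJacobian (prox r) (x + u), ∃ d : E, v = W d ∧ t = ⟪v, d - v⟫_ℝ}

open Classical in
/-- The second-order variational function `Γ_r(x, u)`. -/
def sovf (r : E → EReal) (x u v : E) : EReal :=
  if v ∈ rangeUnion r x u then sInf ((fun t : ℝ => (t : EReal)) '' sovfValues r x u v) else ⊤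

/-- `Wbar` is an element of the limiting Jacobian of `prox r` at `x + u` whose range is the union
of all the ranges and which realizes the minimum of `⟪y, z - y⟫`. -/
def IsDominatingJacobian (r : E → EReal) (x u : E) (Wbar : E →L[ℝ] E) : Prop :=
  Wbar ∈ limJacobian (prox r) (x + u) ∧
  rangeUnion r x u = range Wbar ∧
  ∀ y ∈ rangeUnion r x u, ∃ zbar : E, y = Wbar zbar ∧
    IsLeast (sovfValues r x u y) ⟪y, zbar - y⟫_ℝ

/-- The second-order assumption on an l.s.c. proper convex function `r` at `x` for `u`. -/
def SecondOrderAssumption (r : E → EReal) (x u : E) : Prop :=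
  LowerSemicontinuous r ∧ IsProper r ∧ ConvexE r ∧ r x ≠ ⊤ ∧ u ∈ limSubdiff r x ∧
  ∃ Wbar : E →L[ℝ] E, IsDominatingJacobian r x u Wbar

/-- `r` is variationally strongly convex at `x₀` for `u₀` with modulus `κ`. -/
def VarStronglyConvex (r : E → EReal) (x₀ u₀ : E) (κ : ℝ) : Prop :=
  LowerSemicontinuous r ∧ r x₀ ≠ ⊤ ∧ u₀ ∈ limSubdiff r x₀ ∧
  ∃ X ∈ 𝓝 x₀, ∃ Y ∈ 𝓝 u₀, Convex ℝ X ∧ Convex ℝ Y ∧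
  ∃ rhat : E → EReal, (∀ x, rhat x ≠ ⊥) ∧ LowerSemicontinuous rhat ∧ ConvexE rhat ∧
    (∀ x ∈ X, rhat x ≤ r x) ∧ StrongConvexE X κ rhat ∧
  ∃ ε : ℝ, 0 < ε ∧
    (∀ x ∈ X, ∀ u ∈ Y,
      (r x < r x₀ + (ε : EReal) ∧ u ∈ limSubdiff r x) ↔ u ∈ limSubdiff rhat x) ∧
    (∀ x ∈ X, ∀ u ∈ Y, u ∈ limSubdiff rhat x → r x = rhat x)

end General

/-! ### Composite problems `min f₀(x) + g(F(x))` -/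

section Composite

variable {E H : Type*} [NormedAddCommGroup E] [InnerProductSpace ℝ E] [CompleteSpace E]
  [NormedAddCommGroup H] [InnerProductSpace ℝ H]

/-- `L(x, u) = f₀(x) + ⟪F(x), u⟫`. -/
def lagr (f₀ : E → ℝ) (F : E → H) (u : H) (x : E) : ℝ := f₀ x + ⟪F x, u⟫_ℝ

/-- The KKT system. -/
def IsKKT (f₀ : E → ℝ) (F : E → H) (g : H → EReal) (x : E) (u : H) : Prop :=
  gradient (lagr f₀ F u) x = 0 ∧ u ∈ limSubdiff g (F x)

/-- The quadratic form `⟨∇²ₓₓ L(x, u) d, d⟩`. -/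
def hessLagr (f₀ : E → ℝ) (F : E → H) (x : E) (u : H) (d : E) : ℝ :=
  ⟪fderiv ℝ (gradient (lagr f₀ F u)) x d, d⟫_ℝ

/-- The strong second-order sufficient condition. -/
def SSOSC (f₀ : E → ℝ) (F : E → H) (g : H → EReal) (x : E) (u : H) : Prop :=
  ∀ d : E, d ≠ 0 →
    0 < ((hessLagr f₀ F x u d : ℝ) : EReal) + sovf g (F x) u (fderiv ℝ F x d)

/-- `G_σ(x, s) = f₀(x) + g(F(x) + s) + σ ‖s‖² / 2` on the Euclidean product space. -/
def perturbed (f₀ : E → ℝ) (F : E → H) (g : H → EReal) (σ : ℝ) (z : WithLp 2 (E × H)) : EReal :=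
  g (F z.fst + z.snd) + ((f₀ z.fst + σ / 2 * ‖z.snd‖ ^ 2 : ℝ) : EReal)

/-- Strong variational sufficiency for local optimality at `x` relative to `u`. -/
def StrongVarSufficiency (f₀ : E → ℝ) (F : E → H) (g : H → EReal) (x : E) (u : H) : Prop :=
  ∃ σ : ℝ, 0 < σ ∧ ∃ κ : ℝ, 0 < κ ∧
    VarStronglyConvex (perturbed f₀ F g σ) (WithLp.toLp 2 (x, 0)) (WithLp.toLp 2 (0, u)) κ

end Composite

/-! ### The nuclear norm -/

/-- Real `p × q` matrices as a Euclidean space (trace inner product, Frobenius norm). -/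
abbrev MatSpace (p q : ℕ) : Type := EuclideanSpace ℝ (Fin p × Fin q)

/-- The matrix with the given entries. -/
def mat {p q : ℕ} (X : MatSpace p q) : Matrix (Fin p) (Fin q) ℝ := Matrix.of fun i j => X (i, j)

/-- The nuclear norm: the sum of all singular values. -/
def nuclearNorm {p q : ℕ} (X : MatSpace p q) : ℝ :=
  (Matrix.toEuclideanLin (mat X)).singularValues.sum fun _ s => s

/-- The nuclear norm as an extended-real-valued function. -/
def nuc (p q : ℕ) (X : MatSpace p q) : EReal := ((nuclearNorm X : ℝ) : EReal)

/-- `A = R [Diag(σ) 0] Sᵀ` with orthogonal `R`, `S` and `σ₁ ≥ ⋯ ≥ σ_p ≥ 0`. -/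
def IsSVD {p q : ℕ} (A : Matrix (Fin p) (Fin q) ℝ) (R : Matrix (Fin p) (Fin p) ℝ) (σ : Fin p → ℝ)
    (S : Matrix (Fin q) (Fin q) ℝ) : Prop :=
  R ∈ Matrix.orthogonalGroup (Fin p) ℝ ∧ S ∈ Matrix.orthogonalGroup (Fin q) ℝ ∧
  Antitone σ ∧ (∀ i, 0 ≤ σ i) ∧
  A = R * (Matrix.of fun (i : Fin p) (j : Fin q) => if (i : ℕ) = (j : ℕ) then σ i else 0) * Sᵀ

/-- `shrink t = max{t - 1, 0}`. -/
def shrink (t : ℝ) : ℝ := max (t - 1) 0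

section Formulas

variable {p q : ℕ}

/-- The indices with `σ_i > 1`. -/
def α₁ (σ : Fin p → ℝ) : Finset (Fin p) := Finset.univ.filter fun i => 1 < σ i

/-- The indices with `σ_i = 1`. -/
def α₂ (σ : Fin p → ℝ) : Finset (Fin p) := Finset.univ.filter fun i => σ i = 1

/-- The indices with `σ_i < 1`. -/
def α₃ (σ : Fin p → ℝ) : Finset (Fin p) := Finset.univ.filter fun i => σ i < 1

/-- The position of `j ∈ {1, …, p}` among the `q ≥ p` columns. -/
def colL (hpq : p ≤ q) (j : Fin p) : Fin q := Fin.castLE hpq j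

/-- The position `p + j` of `j ∈ {1, …, q - p}` among the `q` columns. -/
def colR (hpq : p ≤ q) (j : Fin (q - p)) : Fin q :=
  ⟨p + (j : ℕ), by have := j.isLt; omega⟩

/-- The symmetric matrix `Ω^α`, with all entries in the block `α₂ × α₂` equal to one. -/
def Ωα (σ : Fin p → ℝ) : Matrix (Fin p) (Fin p) ℝ := Matrix.of fun i j =>
  if i ∈ α₁ σ ∧ j ∈ α₃ σ then (σ i - 1) / (σ i - σ j)
  else if i ∈ α₃ σ ∧ j ∈ α₁ σ then (σ j - 1) / (σ j - σ i)
  else if i ∈ α₁ σ ∪ α₂ σ ∧ j ∈ α₁ σ ∪ α₂ σ then 1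
  else 0

/-- The symmetric matrix `Ω^γ`. -/
def Ωγ (σ : Fin p → ℝ) : Matrix (Fin p) (Fin p) ℝ := Matrix.of fun i j =>
  if i ∈ α₁ σ ∨ j ∈ α₁ σ then (shrink (σ i) + shrink (σ j)) / (σ i + σ j) else 0

/-- The matrix `Ω^β`. -/
def Ωβ (σ : Fin p → ℝ) : Matrix (Fin p) (Fin (q - p)) ℝ := Matrix.of fun i _ =>
  if i ∈ α₁ σ then (σ i - 1) / σ i else 0

/-- The matrix `R [(Ω^α ∘ D₁ˢ + Ω^γ ∘ D₁ᵃ) S₁ᵀ + (Ω^β ∘ D₂) S₂ᵀ]`, where `S = [S₁ S₂]`,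
`D₁ = Rᵀ D S₁`, `D₂ = Rᵀ D S₂` and `D₁ˢ`, `D₁ᵃ` are the symmetric and the skew-symmetric part
of `D₁`. -/
def explicitJacobian (hpq : p ≤ q) (R : Matrix (Fin p) (Fin p) ℝ) (σ : Fin p → ℝ)
    (S : Matrix (Fin q) (Fin q) ℝ) (D : Matrix (Fin p) (Fin q) ℝ) : Matrix (Fin p) (Fin q) ℝ :=
  let S₁ : Matrix (Fin q) (Fin p) ℝ := S.submatrix id (colL hpq)
  let S₂ : Matrix (Fin q) (Fin (q - p)) ℝ := S.submatrix id (colR hpq)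
  let D₁ : Matrix (Fin p) (Fin p) ℝ := Rᵀ * D * S₁
  let D₂ : Matrix (Fin p) (Fin (q - p)) ℝ := Rᵀ * D * S₂
  R * ((Ωα σ ⊙ ((1 / 2 : ℝ) • (D₁ + D₁ᵀ)) + Ωγ σ ⊙ ((1 / 2 : ℝ) • (D₁ - D₁ᵀ))) * S₁ᵀ
    + (Ωβ σ ⊙ D₂) * S₂ᵀ)

/-- The set of all matrices `R [(Ω^α ∘ D₁ˢ + Ω^γ ∘ D₁ᵃ) S₁ᵀ + (Ω^β ∘ D₂) S₂ᵀ]`. -/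
def explicitRange (hpq : p ≤ q) (R : Matrix (Fin p) (Fin p) ℝ) (σ : Fin p → ℝ)
    (S : Matrix (Fin q) (Fin q) ℝ) : Set (MatSpace p q) :=
  {Y | ∃ D : Matrix (Fin p) (Fin q) ℝ, mat Y = explicitJacobian hpq R σ S D}

/-- The closed formula for the second-order variational function, with `Ỹ = Rᵀ Y S`. -/
def explicitGamma (hpq : p ≤ q) (R : Matrix (Fin p) (Fin p) ℝ) (σ : Fin p → ℝ)
    (S : Matrix (Fin q) (Fin q) ℝ) (Y : MatSpace p q) : ℝ :=
  let Yt : Matrix (Fin p) (Fin q) ℝ := Rᵀ * mat Y * S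
  2 * (∑ i ∈ α₁ σ, ∑ j ∈ (α₁ σ ∪ α₂ σ).filter (fun j => i < j),
      ((σ i + σ j) / (shrink (σ i) + shrink (σ j)) - 1)
        * ((Yt i (colL hpq j) - Yt j (colL hpq i)) / 2) ^ 2)
    + 2 * (∑ i ∈ α₁ σ, ∑ j ∈ α₃ σ,
      ((1 - σ j) / (σ i - 1) * ((Yt i (colL hpq j) + Yt j (colL hpq i)) / 2) ^ 2
        + (1 + σ j) / (σ i - 1) * ((Yt i (colL hpq j) - Yt j (colL hpq i)) / 2) ^ 2))
    + ∑ i ∈ α₁ σ, 1 / (σ i - 1) * ∑ j : Fin (q - p), Yt i (colR hpq j) ^ 2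

/-- The explicit form of the strong second-order sufficient condition. -/
def ExplicitSSOSC {n : ℕ} (hpq : p ≤ q) (f₀ : EuclideanSpace ℝ (Fin n) → ℝ)
    (F : EuclideanSpace ℝ (Fin n) → MatSpace p q) (x : EuclideanSpace ℝ (Fin n))
    (u : MatSpace p q) (R : Matrix (Fin p) (Fin p) ℝ) (σ : Fin p → ℝ)
    (S : Matrix (Fin q) (Fin q) ℝ) : Prop :=
  ∀ d : EuclideanSpace ℝ (Fin n), d ≠ 0 → fderiv ℝ F x d ∈ explicitRange hpq R σ S →
    0 < hessLagr f₀ F x u d + explicitGamma hpq R σ S (fderiv ℝ F x d)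

end Formulas

end VarSuff

end

open VarSuff

/-! The nuclear norm g is the support function of the spectral unit ball (`Contr`): V is a
subgradient at P exactly when V is a contraction with ⟨P, V⟩ = g(P) (`subG_nuclearNorm_iff`). Hence
prox soft-thresholds singular values, and P = prox(B), V = B - P parametrize the graph of ∂g.

Everything rests on one inequality, `SecondOrderLower`, with W the explicit Jacobian. For graph
points (P, V) near (X, U), g(P') is bounded below by pairing P' with a contraction near V, the
endpoint of a curve e^{tK}(V + tN)e^{-tM} with skew K, M. In the singular frame of X + U, the
generators K, M and the step N depend linearly on a direction v in such a way that at V = U the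
velocity is v - Wv and the acceleration paired with X is -⟨Wv, v - Wv⟩ (`frame_polar`,
`frame_second_order`). Taylor's formula and compactness of the unit sphere make this uniform
(`secondOrderLower_frame`).

Claim 1. Adding the inequality at two graph points and passing to derivatives of prox gives 2⟨W'D,
D'⟩ - ⟨WD', D'⟩ ≤ ⟨W'D, D⟩ for every limiting Jacobian W' (`fderiv_prox_bound`). This is linear in
W', so it holds on the Clarke Jacobian, and for symmetric W it implies that rge W' ⊆ rge W and that
W realizes the minimum (`isDominatingJacobian_of_bound`). W is itself a limiting Jacobian: it is the
derivative when no singular value equals 1 (`hasFDerivAt_prox_frame`), and values equal to 1 can be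
pushed slightly upwards. Φ is ⟨WD, D - WD⟩ written out in the frame.

Claim 2. ∂G_σ is explicit (`mem_limSubdiff_perturbed_iff`). For necessity, strong monotonicity is
differentiated along its graph at points where prox is differentiable. For sufficiency, the
expansion of g, Taylor's formula for the Lagrangian and a large σ give uniform quadratic growth at
nearby graph points (`exists_quadratic_growth_perturbed`); the supremum of the resulting quadratic
minorants is the strongly convex function required (`varStronglyConvex_of_growth`). -/

noncomputable section

namespace VarSuff

/-! ### Subgradients of convex functions and the proximal mapping. -/

section ConvexSubgradients

variable {E : Type*} [NormedAddCommGroup E] [InnerProductSpace ℝ E]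

/-- The subgradient inequality for real-valued functions. -/
def SubG (g : E → ℝ) (P V : E) : Prop := ∀ Q, g P + ⟪V, Q - P⟫_ℝ ≤ g Q

/-- Convexity transfers the inequality at a point x + t(x' - x) near x to x' itself, after division
by t. -/
lemma regSubdiff_global {r : E → EReal} (hr : ConvexE r) (hb : ∀ x, r x ≠ ⊥) {x y : E}
    (hy : y ∈ regSubdiff r x) (x' : E) : r x + ((⟪y, x' - x⟫_ℝ : ℝ) : EReal) ≤ r x' := by
  obtain ⟨h1, h2, h3⟩ := hy
  by_cases ht : r x' = ⊤
  · rw [ht]; exact le_top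
  obtain ⟨a, ha⟩ : ∃ a : ℝ, r x = a := ⟨_, (EReal.coe_toReal h1 h2).symm⟩
  obtain ⟨b, hb'⟩ : ∃ b : ℝ, r x' = b := ⟨_, (EReal.coe_toReal ht (hb x')).symm⟩
  rw [ha, hb', ← EReal.coe_add, EReal.coe_le_coe_iff]
  refine le_of_forall_pos_le_add fun ε hε => ?_
  -- Scaled so that the first-order error costs at most ε at x'; the + 1 covers x' = x.
  have hε' : 0 < ε / (‖x' - x‖ + 1) := by positivity
  have hc : Tendsto (fun t : ℝ => x + t • (x' - x)) (𝓝[>] 0) (𝓝 x) := by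
    have : Continuous (fun t : ℝ => x + t • (x' - x)) := by fun_prop
    simpa using (this.tendsto 0).mono_left nhdsWithin_le_nhds
  have h5 : ∀ᶠ t : ℝ in 𝓝[>] 0, t ∈ Ioo (0 : ℝ) 1 := Ioo_mem_nhdsGT one_pos
  obtain ⟨t, h4, ht0, ht1⟩ := ((hc.eventually (h3 _ hε')).and h5).exists
  have h6 := hr.2 x (mem_univ _) x' (mem_univ _) (1 - t) t (by linarith) ht0 (by ring)
  have h7 : (1 - t) • x + t • x' = x + t • (x' - x) := by module
  rw [h7, ha, hb'] at h6
  rw [ha] at h4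
  have h8 : ((a : EReal) + ((⟪y, x + t • (x' - x) - x⟫_ℝ
      - ε / (‖x' - x‖ + 1) * ‖x + t • (x' - x) - x‖ : ℝ) : EReal)) ≤
      ((1 - t : ℝ) : EReal) * a + (t : EReal) * b := by
    refine h4.trans (le_trans ?_ h6)
    simp
  rw [← EReal.coe_mul, ← EReal.coe_mul, ← EReal.coe_add, ← EReal.coe_add,
    EReal.coe_le_coe_iff, add_sub_cancel_left, inner_smul_right, norm_smul, Real.norm_of_nonneg
    ht0.le] at h8
  have h9 : ε / (‖x' - x‖ + 1) * ‖x' - x‖ ≤ ε := by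
    rw [div_mul_eq_mul_div, div_le_iff₀ (by positivity)]
    nlinarith [norm_nonneg (x' - x)]
  have h10 : t * (a + ⟪y, x' - x⟫_ℝ) ≤ t * (b + ε / (‖x' - x‖ + 1) * ‖x' - x‖) := by nlinarith
  have := le_of_mul_le_mul_left h10 ht0
  linarith

/-- The global inequality, unlike the local one, is closed under limits; finiteness of `r x` makes
addition in `EReal` continuous there. -/
lemma limSubdiff_global {r : E → EReal} (hr : ConvexE r) (hb : ∀ x, r x ≠ ⊥) {x y : E}
    (hy : y ∈ limSubdiff r x) (x' : E) : r x + ((⟪y, x' - x⟫_ℝ : ℝ) : EReal) ≤ r x' := by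
  obtain ⟨h1, h2, xs, ys, hxs, hrx, hys, hyl⟩ := hy
  have key : ∀ k, r (xs k) + ((⟪ys k, x' - xs k⟫_ℝ : ℝ) : EReal) ≤ r x' :=
    fun k => regSubdiff_global hr hb (hys k) x'
  have hi : Tendsto (fun k => ((⟪ys k, x' - xs k⟫_ℝ : ℝ) : EReal)) atTop
      (𝓝 ((⟪y, x' - x⟫_ℝ : ℝ) : EReal)) :=
    (continuous_coe_real_ereal.tendsto _).comp (hyl.inner (tendsto_const_nhds.sub hxs))
  have : Tendsto (fun k => r (xs k) + ((⟪ys k, x' - xs k⟫_ℝ : ℝ) : EReal)) atTop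
      (𝓝 (r x + ((⟪y, x' - x⟫_ℝ : ℝ) : EReal))) := by
    have hc := EReal.continuousAt_add (p := (r x, ((⟪y, x' - x⟫_ℝ : ℝ) : EReal)))
      (Or.inl h1) (Or.inl h2)
    exact hc.tendsto.comp (hrx.prodMk_nhds hi)
  exact le_of_tendsto' this key

/-- The subgradient inequality of a convex function improves on a set of strong convexity. -/
lemma limSubdiff_strong {r : E → EReal} (hr : ConvexE r) (hb : ∀ x, r x ≠ ⊥) {X : Set E} {κ : ℝ}
    (hX : StrongConvexE X κ r) {x x' y : E} (hx : x ∈ X) (hx' : x' ∈ X)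
    (hy : y ∈ limSubdiff r x) (hfin : r x' ≠ ⊤) :
    (r x).toReal + ⟪y, x' - x⟫_ℝ + κ / 2 * ‖x' - x‖ ^ 2 ≤ (r x').toReal := by
  have h1 := hy.1
  have h2 := hy.2.1
  obtain ⟨a, ha⟩ : ∃ a : ℝ, r x = a := ⟨_, (EReal.coe_toReal h1 h2).symm⟩
  obtain ⟨b, hb'⟩ : ∃ b : ℝ, r x' = b := ⟨_, (EReal.coe_toReal hfin (hb x')).symm⟩
  rw [ha, hb', EReal.toReal_coe, EReal.toReal_coe]
  -- Strong convexity on the segment, divided by t, gives the bound with κ(1 - t); then t tends to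
  -- 0.
  have hc : Tendsto (fun t : ℝ => a + ⟪y, x' - x⟫_ℝ + κ / 2 * (1 - t) * ‖x' - x‖ ^ 2) (𝓝[>] 0)
      (𝓝 (a + ⟪y, x' - x⟫_ℝ + κ / 2 * ‖x' - x‖ ^ 2)) := by
    have : Continuous (fun t : ℝ => a + ⟪y, x' - x⟫_ℝ + κ / 2 * (1 - t) * ‖x' - x‖ ^ 2) := by
      fun_prop
    simpa using (this.tendsto 0).mono_left nhdsWithin_le_nhds
  refine le_of_tendsto hc ?_
  filter_upwards [Ioo_mem_nhdsGT (one_pos : (0 : ℝ) < 1)] with t ⟨ht0, ht1⟩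
  have h6 := hX.2 x hx x' hx' (1 - t) t (by linarith) ht0 (by ring)
  have h7 : (1 - t) • x + t • x' = x + t • (x' - x) := by module
  have h8 := limSubdiff_global hr hb hy (x + t • (x' - x))
  rw [h7, ha, hb'] at h6
  rw [ha, add_sub_cancel_left, inner_smul_right] at h8
  have h9 := (add_le_add_left h8 ((κ / 2 * ((1 - t) * t) * ‖x - x'‖ ^ 2 : ℝ) : EReal)).trans h6
  rw [← EReal.coe_mul, ← EReal.coe_mul, ← EReal.coe_add, ← EReal.coe_add, ← EReal.coe_add,
    EReal.coe_le_coe_iff, norm_sub_rev] at h9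
  have h10 : t * (a + ⟪y, x' - x⟫_ℝ + κ / 2 * (1 - t) * ‖x' - x‖ ^ 2) ≤ t * b := by nlinarith
  exact le_of_mul_le_mul_left h10 ht0

lemma limSubdiff_strong_monotone {r : E → EReal} (hr : ConvexE r) (hb : ∀ x, r x ≠ ⊥) {X : Set E}
    {κ : ℝ} (hX : StrongConvexE X κ r) {x x' y y' : E} (hx : x ∈ X) (hx' : x' ∈ X)
    (hy : y ∈ limSubdiff r x) (hy' : y' ∈ limSubdiff r x') :
    κ * ‖x' - x‖ ^ 2 ≤ ⟪y' - y, x' - x⟫_ℝ := by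
  have h1 := limSubdiff_strong hr hb hX hx hx' hy hy'.1
  have h2 := limSubdiff_strong hr hb hX hx' hx hy' hy.1
  rw [norm_sub_rev x x', ← neg_sub x' x, inner_neg_right] at h2
  rw [inner_sub_left]
  linarith

lemma mem_limSubdiff_of_reg {r : E → EReal} {x y : E} (h : y ∈ regSubdiff r x) :
    y ∈ limSubdiff r x :=
  ⟨h.1, h.2.1, fun _ => x, fun _ => y, tendsto_const_nhds, tendsto_const_nhds, fun _ => h,
    tendsto_const_nhds⟩

lemma mem_regSubdiff_of_global {r : E → EReal} {x y : E} (h1 : r x ≠ ⊤) (h2 : r x ≠ ⊥)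
    (h : ∀ᶠ x' in 𝓝 x, r x + ((⟪y, x' - x⟫_ℝ : ℝ) : EReal) ≤ r x') : y ∈ regSubdiff r x := by
  refine ⟨h1, h2, fun ε hε => h.mono fun x' hx' => le_trans (add_le_add_right ?_ _) hx'⟩
  rw [EReal.coe_le_coe_iff]
  have : 0 ≤ ε * ‖x' - x‖ := by positivity
  linarith

lemma mem_regSubdiff_real {g : E → ℝ} {x y : E} :
    y ∈ regSubdiff (fun x => (g x : EReal)) x ↔
      ∀ ε : ℝ, 0 < ε → ∀ᶠ x' in 𝓝 x, g x + (⟪y, x' - x⟫_ℝ - ε * ‖x' - x‖) ≤ g x' := by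
  simp only [regSubdiff, mem_ofPred_eq, ne_eq, EReal.coe_ne_top, not_false_eq_true,
    EReal.coe_ne_bot, true_and, ← EReal.coe_add, EReal.coe_le_coe_iff]

lemma convexE_real {g : E → ℝ} (hg : ConvexOn ℝ univ g) : ConvexE (fun x => (g x : EReal)) := by
  refine ⟨convex_univ, fun x _ y _ a b ha hb hab => ?_⟩
  have := hg.2 (mem_univ x) (mem_univ y) ha.le hb.le hab
  rw [← EReal.coe_mul, ← EReal.coe_mul, ← EReal.coe_add, ← EReal.coe_add, EReal.coe_le_coe_iff]
  simpa using this

lemma mem_limSubdiff_real_iff {g : E → ℝ} (hg : ConvexOn ℝ univ g) {P V : E} :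
    V ∈ limSubdiff (fun x => (g x : EReal)) P ↔ SubG g P V := by
  constructor
  · intro h Q
    have := limSubdiff_global (convexE_real hg) (fun _ => EReal.coe_ne_bot _) h Q
    rwa [← EReal.coe_add, EReal.coe_le_coe_iff] at this
  · intro h
    refine mem_limSubdiff_of_reg (mem_regSubdiff_of_global (EReal.coe_ne_top _)
      (EReal.coe_ne_bot _) (Eventually.of_forall fun Q => ?_))
    rw [← EReal.coe_add, EReal.coe_le_coe_iff]
    exact h Q

lemma SubG.monotone {g : E → ℝ} {P V P' V' : E} (h : SubG g P V) (h' : SubG g P' V') :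
    0 ≤ ⟪V' - V, P' - P⟫_ℝ := by
  have h1 := h P'
  have h2 := h' P
  rw [← neg_sub P' P, inner_neg_right] at h2
  rw [inner_sub_left]
  linarith

lemma isProxPoint_real_iff {g : E → ℝ} {x u : E} :
    IsProxPoint (fun x => (g x : EReal)) x u ↔
      ∀ v, g u + 1 / 2 * ‖u - x‖ ^ 2 ≤ g v + 1 / 2 * ‖v - x‖ ^ 2 := by
  simp only [IsProxPoint, ← EReal.coe_add, EReal.coe_le_coe_iff]

/-- The proximal objective is 1-strongly convex: expanding ‖Q - B‖² around P turns the subgradient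
inequality into growth around P, which also makes the minimizer unique. -/
lemma SubG.quadratic_growth {g : E → ℝ} {B P : E} (h : SubG g P (B - P)) (Q : E) :
    g P + 1 / 2 * ‖P - B‖ ^ 2 + 1 / 2 * ‖Q - P‖ ^ 2 ≤ g Q + 1 / 2 * ‖Q - B‖ ^ 2 := by
  have h1 := h Q
  have h2 : ‖Q - B‖ ^ 2 = ‖Q - P‖ ^ 2 - 2 * ⟪B - P, Q - P⟫_ℝ + ‖P - B‖ ^ 2 := by
    have h3 : Q - B = (Q - P) - (B - P) := by abel
    rw [h3, norm_sub_sq_real, norm_sub_rev P B, real_inner_comm]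
  rw [h2]; linarith

lemma SubG.prox_eq {g : E → ℝ} {B P : E} (h : SubG g P (B - P)) :
    prox (fun x => (g x : EReal)) B = P := by
  have hP : IsProxPoint (fun x => (g x : EReal)) B P := by
    rw [isProxPoint_real_iff]
    intro v
    have := h.quadratic_growth v
    nlinarith [sq_nonneg ‖v - P‖]
  have h1 : IsProxPoint (fun x => (g x : EReal)) B (prox (fun x => (g x : EReal)) B) :=
    Classical.epsilon_spec (p := IsProxPoint (fun x => (g x : EReal)) B) ⟨P, hP⟩
  rw [isProxPoint_real_iff] at h1
  have h2 := h.quadratic_growth (prox (fun x => (g x : EReal)) B)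
  have h3 := h1 P
  have h4 : ‖prox (fun x => (g x : EReal)) B - P‖ ^ 2 ≤ 0 := by linarith
  have h5 : ‖prox (fun x => (g x : EReal)) B - P‖ = 0 := by
    have := sq_nonneg ‖prox (fun x => (g x : EReal)) B - P‖
    exact pow_eq_zero_iff (two_ne_zero) |>.1 (le_antisymm h4 this)
  exact sub_eq_zero.1 (norm_eq_zero.1 h5)

/-- Every point is of the form `P + V` with a subgradient `V` at `P`. -/
def ProxSolvable (g : E → ℝ) : Prop := ∀ B, ∃ P, SubG g P (B - P)

lemma ProxSolvable.subG_prox {g : E → ℝ} (hg : ProxSolvable g) (B : E) :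
    SubG g (prox (fun x => (g x : EReal)) B) (B - prox (fun x => (g x : EReal)) B) := by
  obtain ⟨P, hP⟩ := hg B
  rw [hP.prox_eq]
  exact hP

/-- Firm nonexpansiveness: monotonicity of the graph gives ‖P - P'‖² ≤ ⟨B - B', P - P'⟩. -/
lemma ProxSolvable.lipschitz {g : E → ℝ} (hg : ProxSolvable g) :
    LipschitzWith 1 (prox (fun x => (g x : EReal))) := by
  refine LipschitzWith.of_dist_le_mul fun B B' => ?_
  rw [NNReal.coe_one, one_mul, dist_eq_norm, dist_eq_norm]
  set P := prox (fun x => (g x : EReal)) B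
  set P' := prox (fun x => (g x : EReal)) B'
  have h := (hg.subG_prox B').monotone (hg.subG_prox B)
  have h1 : B - P - (B' - P') = (B - B') - (P - P') := by abel
  change 0 ≤ ⟪B - P - (B' - P'), P - P'⟫_ℝ at h
  rw [h1, inner_sub_left, real_inner_self_eq_norm_sq] at h
  have h2 := real_inner_le_norm (B - B') (P - P')
  by_contra hlt
  push Not at hlt
  nlinarith [norm_nonneg (B - B')]

end ConvexSubgradients

/-! ### The trace inner product and contractions for the spectral norm. -/

section Frobenius

variable {m n l : Type*} [Fintype m] [Fintype n] [Fintype l]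

/-- The trace inner product of matrices. -/
def frob (M N : Matrix m n ℝ) : ℝ := ∑ i, ∑ j, M i j * N i j

lemma frob_comm (M N : Matrix m n ℝ) : frob M N = frob N M := by
  simp only [frob, mul_comm]

lemma frob_eq_trace (M N : Matrix m n ℝ) : frob M N = (Mᵀ * N).trace := by
  rw [frob, Finset.sum_comm]
  rfl

lemma frob_add_left (M M' N : Matrix m n ℝ) : frob (M + M') N = frob M N + frob M' N := by
  simp only [frob, Matrix.add_apply, add_mul, Finset.sum_add_distrib]

lemma frob_add_right (M N N' : Matrix m n ℝ) : frob M (N + N') = frob M N + frob M N' := by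
  simp only [frob, Matrix.add_apply, mul_add, Finset.sum_add_distrib]

lemma frob_neg_left (M N : Matrix m n ℝ) : frob (-M) N = -frob M N := by
  simp only [frob, Matrix.neg_apply, neg_mul, Finset.sum_neg_distrib]

lemma frob_neg_right (M N : Matrix m n ℝ) : frob M (-N) = -frob M N := by
  simp only [frob, Matrix.neg_apply, mul_neg, Finset.sum_neg_distrib]

lemma frob_sub_left (M M' N : Matrix m n ℝ) : frob (M - M') N = frob M N - frob M' N := by
  rw [sub_eq_add_neg, frob_add_left, frob_neg_left, sub_eq_add_neg]

lemma frob_sub_right (M N N' : Matrix m n ℝ) : frob M (N - N') = frob M N - frob M N' := by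
  rw [sub_eq_add_neg, frob_add_right, frob_neg_right, sub_eq_add_neg]

lemma frob_smul_left (c : ℝ) (M N : Matrix m n ℝ) : frob (c • M) N = c * frob M N := by
  simp only [frob, Matrix.smul_apply, smul_eq_mul, mul_assoc, Finset.mul_sum]

lemma frob_smul_right (c : ℝ) (M N : Matrix m n ℝ) : frob M (c • N) = c * frob M N := by
  rw [frob_comm, frob_smul_left, frob_comm]

lemma frob_mul_left (A : Matrix m l ℝ) (B : Matrix l n ℝ) (C : Matrix m n ℝ) :
    frob (A * B) C = frob B (Aᵀ * C) := by
  rw [frob_eq_trace, frob_eq_trace, Matrix.transpose_mul, Matrix.mul_assoc]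

lemma frob_mul_right (A : Matrix m l ℝ) (B : Matrix l n ℝ) (C : Matrix m n ℝ) :
    frob (A * B) C = frob A (C * Bᵀ) := by
  rw [frob_eq_trace, frob_eq_trace, Matrix.transpose_mul, Matrix.mul_assoc, Matrix.trace_mul_comm,
    Matrix.mul_assoc]

lemma frob_vecMulVec (y : m → ℝ) (x : n → ℝ) (V : Matrix m n ℝ) :
    frob (Matrix.vecMulVec y x) V = y ⬝ᵥ (V *ᵥ x) := by
  simp only [frob, Matrix.vecMulVec_apply, dotProduct, Matrix.mulVec, Finset.mul_sum]
  exact Finset.sum_congr rfl fun i _ => Finset.sum_congr rfl fun j _ => by ring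

lemma dotProduct_sq_le (x y : n → ℝ) : (x ⬝ᵥ y) ^ 2 ≤ (x ⬝ᵥ x) * (y ⬝ᵥ y) := by
  have := Finset.sum_mul_sq_le_sq_mul_sq Finset.univ x y
  simpa only [dotProduct, sq] using this

lemma dotProduct_self_nonneg' (x : n → ℝ) : 0 ≤ x ⬝ᵥ x :=
  Finset.sum_nonneg fun _ _ => mul_self_nonneg _

lemma mulVec_dotProduct (A : Matrix m n ℝ) (x : n → ℝ) (y : m → ℝ) :
    (A *ᵥ x) ⬝ᵥ y = x ⬝ᵥ (Aᵀ *ᵥ y) := by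
  rw [dotProduct_comm, Matrix.dotProduct_mulVec, Matrix.mulVec_transpose, dotProduct_comm]

/-- Matrices of spectral norm at most one. -/
def Contr (V : Matrix m n ℝ) : Prop := ∀ x : n → ℝ, (V *ᵥ x) ⬝ᵥ (V *ᵥ x) ≤ x ⬝ᵥ x

lemma Contr.mul {V : Matrix m n ℝ} {W : Matrix n l ℝ} (hV : Contr V) (hW : Contr W) :
    Contr (V * W) := fun x => by
  rw [← Matrix.mulVec_mulVec]
  exact (hV _).trans (hW x)

lemma contr_of_transpose_mul_self [DecidableEq n] {O : Matrix m n ℝ} (h : Oᵀ * O = 1) :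
    Contr O := fun x => by
  rw [mulVec_dotProduct, Matrix.mulVec_mulVec, h, Matrix.one_mulVec]

/-- ‖Vᵀy‖² = ⟨y, VVᵀy⟩ ≤ ‖y‖ ‖V(Vᵀy)‖ ≤ ‖y‖ ‖Vᵀy‖. -/
lemma Contr.transpose {V : Matrix m n ℝ} (hV : Contr V) : Contr Vᵀ := fun y => by
  have h1 := hV (Vᵀ *ᵥ y)
  have h2 := dotProduct_sq_le y (V *ᵥ (Vᵀ *ᵥ y))
  have h3 : y ⬝ᵥ (V *ᵥ (Vᵀ *ᵥ y)) = (Vᵀ *ᵥ y) ⬝ᵥ (Vᵀ *ᵥ y) := by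
    rw [mulVec_dotProduct, Matrix.transpose_transpose]
  rw [h3] at h2
  set a := (Vᵀ *ᵥ y) ⬝ᵥ (Vᵀ *ᵥ y)
  have ha : 0 ≤ a := dotProduct_self_nonneg' _
  have hy : 0 ≤ y ⬝ᵥ y := dotProduct_self_nonneg' _
  by_contra hlt
  push Not at hlt
  nlinarith [mul_le_mul_of_nonneg_left h1 hy]

lemma Contr.entry_le [DecidableEq n] {V : Matrix m n ℝ} (hV : Contr V) (i : m) (j : n) :
    V i j ≤ 1 := by
  have h := hV (Pi.single j 1)
  rw [Matrix.mulVec_single_one, dotProduct_single, Pi.single_eq_same, mul_one] at h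
  have h1 : V i j * V i j ≤ V.col j ⬝ᵥ V.col j :=
    Finset.single_le_sum (f := fun i => V.col j i * V.col j i)
      (fun _ _ => mul_self_nonneg _) (Finset.mem_univ i)
  nlinarith

end Frobenius

/-! ### Duality for the nuclear norm and singular value thresholding. -/

section NuclearNorm

variable {p q : ℕ}

/-- The element of `MatSpace` with a given matrix of entries. -/
def ofMat (M : Matrix (Fin p) (Fin q) ℝ) : MatSpace p q := WithLp.toLp 2 fun ij => M ij.1 ij.2

@[simp] lemma mat_ofMat (M : Matrix (Fin p) (Fin q) ℝ) : mat (ofMat M) = M := rfl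

@[simp] lemma ofMat_mat (X : MatSpace p q) : ofMat (mat X) = X := rfl

lemma mat_injective : Function.Injective (mat : MatSpace p q → Matrix (Fin p) (Fin q) ℝ) :=
  Function.LeftInverse.injective ofMat_mat

lemma mat_add (X Y : MatSpace p q) : mat (X + Y) = mat X + mat Y := rfl
lemma mat_sub (X Y : MatSpace p q) : mat (X - Y) = mat X - mat Y := rfl
lemma mat_smul (c : ℝ) (X : MatSpace p q) : mat (c • X) = c • mat X := rfl

lemma inner_eq_frob (X Y : MatSpace p q) : ⟪X, Y⟫_ℝ = frob (mat X) (mat Y) := by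
  rw [frob_comm, PiLp.inner_apply, frob, Fintype.sum_prod_type]
  rfl

/-- The rectangular matrix with the entries of `σ` on its diagonal. -/
def diagRect (q : ℕ) (σ : Fin p → ℝ) : Matrix (Fin p) (Fin q) ℝ :=
  Matrix.of fun i j => if (i : ℕ) = (j : ℕ) then σ i else 0

lemma diagRect_colL (hpq : p ≤ q) (σ : Fin p → ℝ) (i k : Fin p) :
    diagRect q σ i (colL hpq k) = if i = k then σ i else 0 := by
  simp [diagRect, colL, Fin.ext_iff]

lemma diagRect_of_le (σ : Fin p → ℝ) (i : Fin p) {j : Fin q} (hj : p ≤ j) :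
    diagRect q σ i j = 0 := by
  have : (i : ℕ) ≠ j := by omega
  simp [diagRect, this]

lemma frob_diagRect (hpq : p ≤ q) (σ : Fin p → ℝ) (M : Matrix (Fin p) (Fin q) ℝ) :
    frob (diagRect q σ) M = ∑ i, σ i * M i (colL hpq i) := by
  refine Finset.sum_congr rfl fun i _ => ?_
  rw [Finset.sum_eq_single (colL hpq i)]
  · simp [diagRect, colL]
  · intro j _ hj
    have : (i : ℕ) ≠ j := fun h => hj (Fin.ext h.symm)
    simp [diagRect, this]
  · simp

lemma contr_diagRect {τ : Fin p → ℝ} (hpq : p ≤ q) (h0 : ∀ i, |τ i| ≤ 1) :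
    Contr (diagRect q τ) := fun x => by
  have h1 : ∀ i, (diagRect q τ *ᵥ x) i = τ i * x (colL hpq i) := fun i => by
    rw [Matrix.mulVec, dotProduct, Finset.sum_eq_single (colL hpq i)]
    · simp [diagRect, colL]
    · intro j _ hj
      have : (i : ℕ) ≠ j := fun h => hj (Fin.ext h.symm)
      simp [diagRect, this]
    · simp
  have hinj : Function.Injective (colL hpq) := Fin.castLE_injective hpq
  calc (diagRect q τ *ᵥ x) ⬝ᵥ (diagRect q τ *ᵥ x)
      = ∑ i, (τ i * x (colL hpq i)) ^ 2 := by
        simp only [dotProduct, h1, sq]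
    _ ≤ ∑ i, x (colL hpq i) ^ 2 := by
        refine Finset.sum_le_sum fun i _ => ?_
        rw [mul_pow]
        have : τ i ^ 2 ≤ 1 := by
          rw [← sq_abs]; nlinarith [abs_nonneg (τ i), h0 i]
        nlinarith [sq_nonneg (x (colL hpq i))]
    _ = ∑ j ∈ Finset.univ.map ⟨colL hpq, hinj⟩, x j ^ 2 := by simp
    _ ≤ ∑ j, x j ^ 2 :=
        Finset.sum_le_sum_of_subset_of_nonneg (Finset.subset_univ _) fun _ _ _ => sq_nonneg _
    _ = x ⬝ᵥ x := by simp only [dotProduct, sq]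

lemma orth_transpose_mul {n : ℕ} {O : Matrix (Fin n) (Fin n) ℝ}
    (h : O ∈ Matrix.orthogonalGroup (Fin n) ℝ) : Oᵀ * O = 1 :=
  (Matrix.mem_orthogonalGroup_iff' _ _).1 h

lemma orth_mul_transpose {n : ℕ} {O : Matrix (Fin n) (Fin n) ℝ}
    (h : O ∈ Matrix.orthogonalGroup (Fin n) ℝ) : O * Oᵀ = 1 :=
  (Matrix.mem_orthogonalGroup_iff _ _).1 h

lemma contr_orth {n : ℕ} {O : Matrix (Fin n) (Fin n) ℝ}
    (h : O ∈ Matrix.orthogonalGroup (Fin n) ℝ) : Contr O :=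
  contr_of_transpose_mul_self (orth_transpose_mul h)

lemma contr_orth_transpose {n : ℕ} {O : Matrix (Fin n) (Fin n) ℝ}
    (h : O ∈ Matrix.orthogonalGroup (Fin n) ℝ) : Contr Oᵀ :=
  (contr_orth h).transpose

lemma frob_conj {R : Matrix (Fin p) (Fin p) ℝ} {S : Matrix (Fin q) (Fin q) ℝ}
    (M V : Matrix (Fin p) (Fin q) ℝ) : frob (R * M * Sᵀ) V = frob M (Rᵀ * V * S) := by
  rw [frob_mul_right, frob_mul_left, Matrix.transpose_transpose, Matrix.mul_assoc]

lemma frob_svd_le (hpq : p ≤ q) {R : Matrix (Fin p) (Fin p) ℝ} {S : Matrix (Fin q) (Fin q) ℝ}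
    (hR : Contr Rᵀ) (hS : Contr S) {σ : Fin p → ℝ} (hσ : ∀ i, 0 ≤ σ i)
    {V : Matrix (Fin p) (Fin q) ℝ} (hV : Contr V) :
    frob (R * diagRect q σ * Sᵀ) V ≤ ∑ i, σ i := by
  rw [frob_conj, frob_diagRect hpq]
  refine Finset.sum_le_sum fun i _ => ?_
  have := ((hR.mul hV).mul hS).entry_le i (colL hpq i)
  nlinarith [hσ i]

/-- A singular value decomposition whose singular values sum up to the nuclear norm. -/
lemma exists_svd (hpq : p ≤ q) (X : MatSpace p q) : ∃ R σ S, IsSVD (mat X) R σ S ∧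
    nuclearNorm X = ∑ i, σ i := by
  set T := Matrix.toEuclideanLin (mat X) with hT
  have hq : Module.finrank ℝ (EuclideanSpace ℝ (Fin q)) = q := by simp
  have hp : Module.finrank ℝ (EuclideanSpace ℝ (Fin p)) = p := by simp
  -- Right singular vectors: an eigenbasis of T*T. Left ones: the normalized images T s_i at nonzero
  -- singular values, completed arbitrarily to an orthonormal basis.
  set s := T.isSymmetric_adjoint_comp_self.eigenvectorBasis hq with hs
  have hsin : ∀ i j : Fin q, ⟪T (s i), T (s j)⟫_ℝ = if i = j then T.singularValues j ^ 2 else 0 := by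
    intro i j
    rw [← LinearMap.adjoint_inner_right, ← LinearMap.comp_apply, hs,
      LinearMap.IsSymmetric.apply_eigenvectorBasis, T.sq_singularValues_fin hq]
    have := orthonormal_iff_ite.1 (s.orthonormal) i j
    rw [← hs]
    simp [inner_smul_right, this]
  have hrk : Module.finrank ℝ T.range ≤ p := by
    simpa [hp] using Submodule.finrank_le T.range
  have hsv : ∀ j, p ≤ j → T.singularValues j = 0 := fun j hj =>
    T.singularValues_eq_zero_iff_le_finrank_range.2 (hrk.trans hj)
  have hT0 : ∀ j : Fin q, T.singularValues j = 0 → T (s j) = 0 := by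
    intro j hj
    have := hsin j j
    rw [hj] at this
    simpa using this
  obtain ⟨b, hb⟩ := Orthonormal.exists_orthonormalBasis_extension_of_card_eq
    (𝕜 := ℝ) (E := EuclideanSpace ℝ (Fin p)) (ι := Fin p) (by simp)
    (v := fun i : Fin p => (T.singularValues i)⁻¹ • T (s (colL hpq i)))
    (s := {i : Fin p | T.singularValues i ≠ 0}) (by
      rw [orthonormal_iff_ite]
      rintro ⟨i, hi⟩ ⟨j, hj⟩
      have hi' : T.singularValues i ≠ 0 := hi
      have hj' : T.singularValues j ≠ 0 := hj
      have hij := hsin (colL hpq i) (colL hpq j)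
      simp only [Set.domRestrict_apply, inner_smul_left, inner_smul_right, hij, Subtype.mk.injEq]
      by_cases h : i = j
      · subst h
        simp only [if_true, colL, Fin.val_castLE, conj_trivial]
        field_simp
      · have h' : colL hpq i ≠ colL hpq j := fun h' => h (Fin.castLE_injective hpq h')
        simp [h, h'])
  have hTs : ∀ i : Fin p, T (s (colL hpq i)) = T.singularValues i • b i := by
    intro i
    by_cases h : T.singularValues i = 0
    · rw [h, zero_smul, hT0 _ h]
    · rw [hb i h, smul_inv_smul₀ h]
  have horth : ∀ {n : ℕ} (c : OrthonormalBasis (Fin n) ℝ (EuclideanSpace ℝ (Fin n))),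
      (Matrix.of fun k i => c i k) ∈ Matrix.orthogonalGroup (Fin n) ℝ := by
    intro n c
    rw [Matrix.mem_orthogonalGroup_iff']
    ext i j
    have := orthonormal_iff_ite.1 c.orthonormal i j
    rw [PiLp.inner_apply] at this
    rw [Matrix.one_apply, ← this, Matrix.mul_apply]
    refine Finset.sum_congr rfl fun k _ => ?_
    simp [mul_comm]
  refine ⟨Matrix.of fun k i => b i k, fun i => T.singularValues i, Matrix.of fun k j => s j k,
    ⟨horth b, horth s, fun i j hij => T.singularValues_antitone hij,
      fun i => T.singularValues_nonneg i, ?_⟩, ?_⟩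
  · have hSS := (Matrix.mem_orthogonalGroup_iff _ _).1 (horth s)
    set S : Matrix (Fin q) (Fin q) ℝ := Matrix.of fun k j => s j k
    have key : mat X * S = (Matrix.of fun k i => b i k) *
        diagRect q (fun i : Fin p => T.singularValues i) := by
      ext k j
      have h1 : (mat X * S) k j = T (s j) k := by
        rw [hT, Matrix.toLpLin_apply]; rfl
      rw [h1]
      by_cases hj : (j : ℕ) < p
      · obtain ⟨i, rfl⟩ : ∃ i : Fin p, j = colL hpq i := ⟨⟨j, hj⟩, rfl⟩
        rw [hTs, Matrix.mul_apply, Finset.sum_eq_single i]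
        · simp [diagRect_colL, mul_comm]
        · intro l _ hl; simp [diagRect_colL, hl]
        · simp
      · rw [hT0 j (hsv j (not_lt.1 hj)), Matrix.mul_apply, Finset.sum_eq_zero]
        · rfl
        · intro l _; rw [diagRect_of_le _ _ (not_lt.1 hj), mul_zero]
    change mat X = (Matrix.of fun k i => b i k) * diagRect q (fun i : Fin p => T.singularValues i) * Sᵀ
    rw [← key, Matrix.mul_assoc]
    have : S * Sᵀ = 1 := hSS
    rw [this, Matrix.mul_one]
  · rw [nuclearNorm, ← hT, Finsupp.sum_of_support_subset (s := Finset.range p) _ _ _ (by simp),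
      Finset.sum_range]
    intro j hj
    by_contra hjp
    simp only [Finset.mem_range, not_lt] at hjp
    exact (Finsupp.mem_support_iff.1 hj) (hsv j hjp)

/-- Together with `exists_frob_eq_nuclearNorm` this identifies the nuclear norm as the support
function of the spectral unit ball. -/
lemma frob_le_nuclearNorm (hpq : p ≤ q) (X : MatSpace p q) {V : Matrix (Fin p) (Fin q) ℝ}
    (hV : Contr V) : frob (mat X) V ≤ nuclearNorm X := by
  obtain ⟨R, σ, S, ⟨hR, hS, -, h0, hX⟩, hn⟩ := exists_svd hpq X
  rw [hn, hX]
  exact frob_svd_le hpq (contr_orth_transpose hR) (contr_orth hS) h0 hV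

lemma frob_svd_self (hpq : p ≤ q) {R : Matrix (Fin p) (Fin p) ℝ} {S : Matrix (Fin q) (Fin q) ℝ}
    (hR : R ∈ Matrix.orthogonalGroup (Fin p) ℝ) (hS : S ∈ Matrix.orthogonalGroup (Fin q) ℝ)
    (σ τ : Fin p → ℝ) :
    frob (R * diagRect q σ * Sᵀ) (R * diagRect q τ * Sᵀ) = ∑ i, σ i * τ i := by
  have : Rᵀ * (R * diagRect q τ * Sᵀ) * S = (Rᵀ * R) * diagRect q τ * (Sᵀ * S) := by
    simp only [Matrix.mul_assoc]
  rw [frob_conj, this, orth_transpose_mul hR, orth_transpose_mul hS, Matrix.one_mul, Matrix.mul_one,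
    frob_diagRect hpq]
  simp [diagRect_colL]

lemma contr_svd (hpq : p ≤ q) {R : Matrix (Fin p) (Fin p) ℝ} {S : Matrix (Fin q) (Fin q) ℝ}
    (hR : R ∈ Matrix.orthogonalGroup (Fin p) ℝ) (hS : S ∈ Matrix.orthogonalGroup (Fin q) ℝ)
    {τ : Fin p → ℝ} (h : ∀ i, |τ i| ≤ 1) : Contr (R * diagRect q τ * Sᵀ) :=
  ((contr_orth hR).mul (contr_diagRect hpq h)).mul (contr_orth_transpose hS)

lemma exists_frob_eq_nuclearNorm (hpq : p ≤ q) (X : MatSpace p q) :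
    ∃ V, Contr V ∧ frob (mat X) V = nuclearNorm X := by
  obtain ⟨R, σ, S, ⟨hR, hS, -, h0, hX⟩, hn⟩ := exists_svd hpq X
  refine ⟨R * diagRect q (fun _ => 1) * Sᵀ, contr_svd hpq hR hS (by simp), ?_⟩
  have hX' : mat X = R * diagRect q σ * Sᵀ := hX
  rw [hn, hX', frob_svd_self hpq hR hS]
  simp

lemma nuclearNorm_le_of_forall (hpq : p ≤ q) (X : MatSpace p q) {c : ℝ}
    (h : ∀ V, Contr V → frob (mat X) V ≤ c) : nuclearNorm X ≤ c := by
  obtain ⟨V, hV, hVX⟩ := exists_frob_eq_nuclearNorm hpq X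
  exact hVX ▸ h V hV

lemma convexOn_nuclearNorm (hpq : p ≤ q) :
    ConvexOn ℝ univ (nuclearNorm : MatSpace p q → ℝ) := by
  refine ⟨convex_univ, fun X _ Y _ a b ha hb _ => ?_⟩
  refine nuclearNorm_le_of_forall hpq _ fun V hV => ?_
  rw [mat_add, mat_smul, mat_smul, frob_add_left, frob_smul_left, frob_smul_left]
  exact add_le_add (mul_le_mul_of_nonneg_left (frob_le_nuclearNorm hpq X hV) ha)
    (mul_le_mul_of_nonneg_left (frob_le_nuclearNorm hpq Y hV) hb)

/-- By homogeneity, testing with 2P and 0 gives equality in the pairing; testing with rank-one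
matrices gives contractivity. The converse is duality. -/
lemma subG_nuclearNorm_iff (hpq : p ≤ q) {P V : MatSpace p q} :
    SubG nuclearNorm P V ↔ Contr (mat V) ∧ ⟪P, V⟫_ℝ = nuclearNorm P := by
  constructor
  · intro h
    have h2 : nuclearNorm ((2 : ℝ) • P) ≤ 2 * nuclearNorm P := by
      refine nuclearNorm_le_of_forall hpq _ fun W hW => ?_
      rw [mat_smul, frob_smul_left]
      have := frob_le_nuclearNorm hpq P hW
      linarith
    have h0 : nuclearNorm (0 : MatSpace p q) ≤ 0 := by
      refine nuclearNorm_le_of_forall hpq _ fun W hW => ?_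
      have : mat (0 : MatSpace p q) = (0 : ℝ) • mat (0 : MatSpace p q) := by
        rw [← mat_smul, smul_zero]
      rw [this, frob_smul_left, zero_mul]
    have h3 := h ((2 : ℝ) • P)
    have h4 := h 0
    rw [two_smul, add_sub_cancel_right, ← two_smul ℝ] at h3
    rw [zero_sub, inner_neg_right] at h4
    have hPV : ⟪V, P⟫_ℝ = nuclearNorm P := by linarith
    refine ⟨fun x => ?_, by rw [real_inner_comm, hPV]⟩
    set y := mat V *ᵥ x
    -- With y = Vx, the matrix y xᵀ has nuclear norm at most ‖y‖ ‖x‖ and pairs with V to ‖y‖²; hence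
    -- ‖y‖ ≤ ‖x‖.
    have h5 := h (ofMat (Matrix.vecMulVec y x))
    rw [inner_sub_right, hPV, inner_eq_frob, mat_ofMat, frob_comm, frob_vecMulVec] at h5
    have h6 : nuclearNorm (ofMat (Matrix.vecMulVec y x)) ≤ Real.sqrt ((y ⬝ᵥ y) * (x ⬝ᵥ x)) := by
      refine nuclearNorm_le_of_forall hpq _ fun W hW => ?_
      rw [mat_ofMat, frob_vecMulVec]
      refine Real.le_sqrt_of_sq_le ((dotProduct_sq_le _ _).trans ?_)
      exact mul_le_mul_of_nonneg_left (hW x) (dotProduct_self_nonneg' y)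
    have h7 : y ⬝ᵥ y ≤ Real.sqrt ((y ⬝ᵥ y) * (x ⬝ᵥ x)) := by
      change nuclearNorm P + (y ⬝ᵥ y - nuclearNorm P) ≤ _ at h5
      linarith
    have hy := dotProduct_self_nonneg' y
    have h8 := (Real.le_sqrt hy (mul_nonneg hy (dotProduct_self_nonneg' x))).1 h7
    by_contra hlt
    push Not at hlt
    nlinarith [dotProduct_self_nonneg' x]
  · rintro ⟨hV, h⟩ Q
    rw [inner_sub_right, real_inner_comm P V, h, inner_eq_frob, frob_comm]
    have := frob_le_nuclearNorm hpq Q hV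
    linarith

lemma shrink_nonneg (t : ℝ) : 0 ≤ shrink t := le_max_right _ _

lemma sub_shrink (t : ℝ) : t - shrink t = min t 1 := by
  rw [shrink]
  rcases le_total t 1 with h | h
  · rw [max_eq_right (by linarith), min_eq_left h, sub_zero]
  · rw [max_eq_left (by linarith), min_eq_right h]; ring

lemma shrink_mul_min (t : ℝ) : shrink t * min t 1 = shrink t := by
  rw [shrink]
  rcases le_total t 1 with h | h
  · rw [max_eq_right (by linarith), zero_mul]
  · rw [min_eq_right h, mul_one]

lemma diagRect_sub (σ τ : Fin p → ℝ) :
    diagRect q σ - diagRect q τ = diagRect q (fun i => σ i - τ i) := by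
  ext i j
  simp only [diagRect, Matrix.sub_apply, Matrix.of_apply]
  split_ifs <;> simp

/-- Soft thresholding of the singular values. -/
lemma subG_svd (hpq : p ≤ q) {B : MatSpace p q} {R : Matrix (Fin p) (Fin p) ℝ} {σ : Fin p → ℝ}
    {S : Matrix (Fin q) (Fin q) ℝ} (h : IsSVD (mat B) R σ S) :
    SubG nuclearNorm (ofMat (R * diagRect q (fun i => shrink (σ i)) * Sᵀ))
      (B - ofMat (R * diagRect q (fun i => shrink (σ i)) * Sᵀ)) := by
  obtain ⟨hR, hS, -, h0, hB⟩ := h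
  have hB' : mat B = R * diagRect q σ * Sᵀ := hB
  have hV : mat (B - ofMat (R * diagRect q (fun i => shrink (σ i)) * Sᵀ)) =
      R * diagRect q (fun i => min (σ i) 1) * Sᵀ := by
    rw [mat_sub, mat_ofMat, hB', ← Matrix.sub_mul, ← Matrix.mul_sub, diagRect_sub]
    simp only [sub_shrink]
  have hc : Contr (mat (B - ofMat (R * diagRect q (fun i => shrink (σ i)) * Sᵀ))) := by
    rw [hV]
    refine contr_svd hpq hR hS fun i => ?_
    rw [abs_of_nonneg (le_min (h0 i) zero_le_one)]
    exact min_le_right _ _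
  rw [subG_nuclearNorm_iff hpq]
  refine ⟨hc, ?_⟩
  -- The thresholded value is nonzero only where `min (σ i) 1` equals 1, so the pairing is the full
  -- sum.
  have hsum : ⟪ofMat (R * diagRect q (fun i => shrink (σ i)) * Sᵀ),
      B - ofMat (R * diagRect q (fun i => shrink (σ i)) * Sᵀ)⟫_ℝ = ∑ i, shrink (σ i) := by
    rw [inner_eq_frob, hV, mat_ofMat, frob_svd_self hpq hR hS]
    simp only [shrink_mul_min]
  refine le_antisymm ?_ ?_
  · rw [inner_eq_frob]; exact frob_le_nuclearNorm hpq _ hc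
  · rw [hsum]
    refine nuclearNorm_le_of_forall hpq _ fun W hW => ?_
    exact frob_svd_le hpq (contr_orth_transpose hR) (contr_orth hS)
      (fun i => shrink_nonneg (σ i)) hW

lemma proxSolvable_nuclearNorm (hpq : p ≤ q) :
    ProxSolvable (nuclearNorm : MatSpace p q → ℝ) := fun B => by
  obtain ⟨R, σ, S, h, -⟩ := exists_svd hpq B
  exact ⟨_, subG_svd hpq h⟩

lemma continuous_nuclearNorm (hpq : p ≤ q) : Continuous (nuclearNorm : MatSpace p q → ℝ) := by
  exact continuousOn_univ.1 ((convexOn_nuclearNorm hpq).continuousOn isOpen_univ)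

lemma mem_limSubdiff_nuc_iff (hpq : p ≤ q) {X U : MatSpace p q} :
    U ∈ limSubdiff (nuc p q) X ↔ SubG nuclearNorm X U :=
  mem_limSubdiff_real_iff (convexOn_nuclearNorm hpq)

end NuclearNorm

/-! ### Scalar coefficients of the rotation generators and of the Jacobian. -/

section ScalarCoefficients

/-- Coefficient of the skew part in the generators of the rotations. -/
def ceSkew (s t : ℝ) : ℝ := if 1 ≤ s ∨ 1 ≤ t then 1 / (s + t) else 0

/-- Coefficient of the symmetric part in the generators of the rotations. -/
def ceSym (s t : ℝ) : ℝ := if (1 ≤ s ∧ t < 1) ∨ (s < 1 ∧ 1 ≤ t) then 1 / (s - t) else 0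

/-- Entries of the generator of the rotation on the left. -/
def genL (s t x y : ℝ) : ℝ := ceSkew s t * ((x - y) / 2) - ceSym s t * ((x + y) / 2)

/-- Entries of the generator of the rotation on the right. -/
def genR (s t x y : ℝ) : ℝ := -(ceSkew s t * ((x - y) / 2)) - ceSym s t * ((x + y) / 2)

/-- Entries of the part of a direction in the block of small singular values. -/
def entryLow (s t x : ℝ) : ℝ := if s < 1 ∧ t < 1 then x else 0

/-- Entries of the symmetric part of a direction in the block of large singular values. -/
def entryHigh (s t x y : ℝ) : ℝ := if 1 ≤ s ∧ 1 ≤ t then (x + y) / 2 else 0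

/-- Entries of `Ω^α` as functions of two singular values. -/
def coefSym (s t : ℝ) : ℝ :=
  if 1 < s ∧ t < 1 then (s - 1) / (s - t)
  else if s < 1 ∧ 1 < t then (t - 1) / (t - s)
  else if 1 ≤ s ∧ 1 ≤ t then 1
  else 0

/-- Entries of `Ω^γ` as functions of two singular values. -/
def coefSkew (s t : ℝ) : ℝ := if 1 < s ∨ 1 < t then (shrink s + shrink t) / (s + t) else 0

/-- Entries of the explicit Jacobian in the coordinates of the singular vectors. -/
def entryJac (s t x y : ℝ) : ℝ := coefSym s t * ((x + y) / 2) + coefSkew s t * ((x - y) / 2)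

lemma shrink_of_le {t : ℝ} (h : t ≤ 1) : shrink t = 0 := max_eq_right (by linarith)
lemma shrink_of_ge {t : ℝ} (h : 1 ≤ t) : shrink t = t - 1 := max_eq_left (by linarith)

lemma ceSkew_comm (s t : ℝ) : ceSkew s t = ceSkew t s := by
  simp only [ceSkew, or_comm, add_comm]

lemma ceSym_anticomm (s t : ℝ) : ceSym s t = -ceSym t s := by
  unfold ceSym
  by_cases h : (1 ≤ s ∧ t < 1) ∨ (s < 1 ∧ 1 ≤ t)
  · have h' : (1 ≤ t ∧ s < 1) ∨ (t < 1 ∧ 1 ≤ s) := by tauto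
    rw [if_pos h, if_pos h', ← neg_sub t s, one_div, one_div, inv_neg]
  · have h' : ¬ ((1 ≤ t ∧ s < 1) ∨ (t < 1 ∧ 1 ≤ s)) := by tauto
    rw [if_neg h, if_neg h', neg_zero]

lemma genL_skew (s t x y : ℝ) : genL t s y x = -genL s t x y := by
  rw [genL, genL, ceSkew_comm t s, ceSym_anticomm t s]; ring

lemma genR_skew (s t x y : ℝ) : genR t s y x = -genR s t x y := by
  rw [genR, genR, ceSkew_comm t s, ceSym_anticomm t s]; ring

lemma coefSkew_comm (s t : ℝ) : coefSkew s t = coefSkew t s := by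
  simp only [coefSkew, or_comm, add_comm]

lemma coefSym_comm (s t : ℝ) : coefSym s t = coefSym t s := by
  unfold coefSym
  split_ifs <;> first | rfl | (exfalso; grind)

/-- The generators distinguish `1 ≤ s`, whereas most Jacobian coefficients distinguish `1 < s`. One
formula per block serves both, because the numerators concerned vanish at the threshold. -/
lemma high_high {s t : ℝ} (hs : 1 ≤ s) (ht : 1 ≤ t) :
    ceSkew s t = 1 / (s + t) ∧ ceSym s t = 0 ∧ coefSym s t = 1 ∧
      coefSkew s t = (s + t - 2) / (s + t) := by
  refine ⟨if_pos (Or.inl hs), if_neg (by grind), ?_, ?_⟩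
  · unfold coefSym; rw [if_neg (by grind), if_neg (by grind), if_pos ⟨hs, ht⟩]
  · unfold coefSkew
    split_ifs with h
    · rw [shrink_of_ge hs, shrink_of_ge ht]; congr 1; ring
    · have : s + t - 2 = 0 := by grind
      rw [this, zero_div]

lemma high_low {s t : ℝ} (hs : 1 ≤ s) (ht : t < 1) :
    ceSkew s t = 1 / (s + t) ∧ ceSym s t = 1 / (s - t) ∧ coefSym s t = (s - 1) / (s - t) ∧
      coefSkew s t = (s - 1) / (s + t) := by
  refine ⟨if_pos (Or.inl hs), if_pos (Or.inl ⟨hs, ht⟩), ?_, ?_⟩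
  · unfold coefSym
    split_ifs with h1 h2 h3
    · rfl
    · grind
    · grind
    · have : s = 1 := by grind
      rw [this, sub_self, zero_div]
  · unfold coefSkew
    split_ifs with h
    · rw [shrink_of_ge hs, shrink_of_le ht.le]; congr 1; ring
    · have : s = 1 := by grind
      rw [this, sub_self, zero_div]

lemma low_low {s t : ℝ} (hs : s < 1) (ht : t < 1) :
    ceSkew s t = 0 ∧ ceSym s t = 0 ∧ coefSym s t = 0 ∧ coefSkew s t = 0 := by
  refine ⟨if_neg (by grind), if_neg (by grind), ?_, if_neg (by grind)⟩
  unfold coefSym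
  rw [if_neg (by grind), if_neg (by grind), if_neg (by grind)]

/-- `genL` and `genR` solve two linear equations, this one and `entry_prox`: rotating min(Σ, 1) and
shrink(Σ) infinitesimally has to produce v - Wv and Wv. What the rotations do not supply is left to
`entryLow` and `entryHigh`. -/
lemma entry_polar {s t : ℝ} (hs : 0 ≤ s) (ht : 0 ≤ t) (x y : ℝ) :
    genL s t x y * min t 1 - min s 1 * genR s t x y + entryLow s t x = x - entryJac s t x y := by
  unfold genL genR entryJac
  rcases le_or_gt 1 s with h1 | h1 <;> rcases le_or_gt 1 t with h2 | h2
  · obtain ⟨e1, e2, e3, e4⟩ := high_high h1 h2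
    have : s + t ≠ 0 := by positivity
    rw [e1, e2, e3, e4, min_eq_right h1, min_eq_right h2, entryLow, if_neg (by grind)]
    field_simp; ring
  · obtain ⟨e1, e2, e3, e4⟩ := high_low h1 h2
    have h3 : s + t ≠ 0 := by positivity
    have h4 : s - t ≠ 0 := by intro h; linarith
    rw [e1, e2, e3, e4, min_eq_right h1, min_eq_left h2.le, entryLow, if_neg (by grind)]
    field_simp; ring
  · obtain ⟨e1, e2, e3, e4⟩ := high_low h2 h1
    have h3 : t + s ≠ 0 := by positivity
    have h4 : t - s ≠ 0 := by intro h; linarith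
    rw [ceSkew_comm, ceSym_anticomm, coefSym_comm, coefSkew_comm, e1, e2, e3, e4, min_eq_left h1.le,
      min_eq_right h2, entryLow, if_neg (by grind)]
    field_simp; ring
  · obtain ⟨e1, e2, e3, e4⟩ := low_low h1 h2
    rw [e1, e2, e3, e4, entryLow, if_pos ⟨h1, h2⟩]
    ring

lemma entry_prox {s t : ℝ} (hs : 0 ≤ s) (ht : 0 ≤ t) (x y : ℝ) :
    genL s t x y * shrink t - shrink s * genR s t x y + entryHigh s t x y = entryJac s t x y := by
  unfold genL genR entryJac
  rcases le_or_gt 1 s with h1 | h1 <;> rcases le_or_gt 1 t with h2 | h2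
  · obtain ⟨e1, e2, e3, e4⟩ := high_high h1 h2
    have : s + t ≠ 0 := by positivity
    rw [e1, e2, e3, e4, shrink_of_ge h1, shrink_of_ge h2, entryHigh, if_pos ⟨h1, h2⟩]
    field_simp; ring
  · obtain ⟨e1, e2, e3, e4⟩ := high_low h1 h2
    have h3 : s + t ≠ 0 := by positivity
    have h4 : s - t ≠ 0 := by intro h; linarith
    rw [e1, e2, e3, e4, shrink_of_ge h1, shrink_of_le h2.le, entryHigh, if_neg (by grind)]
    field_simp; ring
  · obtain ⟨e1, e2, e3, e4⟩ := high_low h2 h1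
    have h3 : t + s ≠ 0 := by positivity
    have h4 : t - s ≠ 0 := by intro h; linarith
    rw [ceSkew_comm, ceSym_anticomm, coefSym_comm, coefSkew_comm, e1, e2, e3, e4, shrink_of_le h1.le,
      shrink_of_ge h2, entryHigh, if_neg (by grind)]
    field_simp; ring
  · obtain ⟨e1, e2, e3, e4⟩ := low_low h1 h2
    rw [e1, e2, e3, e4, entryHigh, if_neg (by grind), shrink_of_le h1.le, shrink_of_le h2.le]
    ring

lemma entryHigh_mul_low (s t x y z : ℝ) : entryHigh s t x y * entryLow s t z = 0 := by
  unfold entryHigh entryLow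
  split_ifs <;> first | (exfalso; grind) | simp

lemma entryJac_mul_low (s t x y z : ℝ) : entryJac s t x y * entryLow s t z = 0 := by
  unfold entryLow
  split_ifs with h
  · obtain ⟨-, -, e3, e4⟩ := low_low h.1 h.2
    rw [entryJac, e3, e4]; ring
  · rw [mul_zero]

/-- On the high block `entryHigh` is symmetric, and x minus its Jacobian entry is skew because
`coefSym` is 1 there; so the products cancel in pairs. -/
lemma entryHigh_mul_polar (s t x y : ℝ) :
    entryHigh t s y x * (y - entryJac t s y x) = -(entryHigh s t x y * (x - entryJac s t x y)) := by
  unfold entryHigh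
  by_cases h : 1 ≤ s ∧ 1 ≤ t
  · obtain ⟨-, -, e3, e4⟩ := high_high h.1 h.2
    rw [if_pos h, if_pos h.symm, entryJac, entryJac, coefSym_comm t s, coefSkew_comm t s, e3]
    ring
  · rw [if_neg h, if_neg (fun h' => h h'.symm)]; ring

end ScalarCoefficients

/-! ### First- and second-order identities in the singular frame; columns beyond p count as singular
value 0. -/

section Frame

variable {p q : ℕ}

/-- Extension of the singular values by zero to all columns. -/
def extend (q : ℕ) (σ : Fin p → ℝ) (j : Fin q) : ℝ := if h : (j : ℕ) < p then σ ⟨j, h⟩ else 0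

/-- Extension of a matrix by zero rows to a square matrix. -/
def extendRows (v : Matrix (Fin p) (Fin q) ℝ) : Matrix (Fin q) (Fin q) ℝ :=
  Matrix.of fun j l => if h : (j : ℕ) < p then v ⟨j, h⟩ l else 0

@[simp] lemma extend_colL (hpq : p ≤ q) (σ : Fin p → ℝ) (k : Fin p) :
    extend q σ (colL hpq k) = σ k := by simp [extend, colL]

@[simp] lemma extendRows_colL (hpq : p ≤ q) (v : Matrix (Fin p) (Fin q) ℝ) (k : Fin p)
    (l : Fin q) : extendRows v (colL hpq k) l = v k l := by simp [extendRows, colL]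

lemma extend_of_le (σ : Fin p → ℝ) {j : Fin q} (hj : p ≤ j) : extend q σ j = 0 := by
  simp [extend, not_lt.2 hj]

lemma extendRows_of_le (v : Matrix (Fin p) (Fin q) ℝ) {j : Fin q} (hj : p ≤ j) (l : Fin q) :
    extendRows v j l = 0 := by simp [extendRows, not_lt.2 hj]

lemma extend_nonneg {σ : Fin p → ℝ} (h : ∀ i, 0 ≤ σ i) (j : Fin q) : 0 ≤ extend q σ j := by
  unfold extend; split_ifs; exacts [h _, le_rfl]

lemma colL_cases (hpq : p ≤ q) (j : Fin q) : (∃ k : Fin p, j = colL hpq k) ∨ p ≤ j := by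
  rcases lt_or_ge (j : ℕ) p with h | h
  · exact Or.inl ⟨⟨j, h⟩, rfl⟩
  · exact Or.inr h

lemma sum_colL (hpq : p ≤ q) {f : Fin q → ℝ} (h : ∀ j : Fin q, p ≤ j → f j = 0) :
    ∑ j, f j = ∑ k, f (colL hpq k) := by
  have hinj : Function.Injective (colL hpq) := Fin.castLE_injective hpq
  refine Eq.trans (Eq.symm ?_) (Finset.sum_map Finset.univ ⟨colL hpq, hinj⟩ f)
  refine Finset.sum_subset (Finset.subset_univ _) fun j _ hj => ?_
  rcases colL_cases hpq j with ⟨k, rfl⟩ | h'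
  · exact absurd (Finset.mem_map_of_mem _ (Finset.mem_univ k)) hj
  · exact h j h'

variable (hpq : p ≤ q) (σ : Fin p → ℝ) (v : Matrix (Fin p) (Fin q) ℝ)

/-- The generator of the rotation of the left singular vectors. -/
def genLeft : Matrix (Fin p) (Fin p) ℝ :=
  Matrix.of fun i k => genL (σ i) (σ k) (v i (colL hpq k)) (v k (colL hpq i))

/-- The generator of the rotation of the right singular vectors. -/
def genRight : Matrix (Fin q) (Fin q) ℝ :=
  Matrix.of fun j l =>
    genR (extend q σ j) (extend q σ l) (extendRows v j l) (extendRows v l j)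

/-- The block of a direction that belongs to the small singular values. -/
def lowPart : Matrix (Fin p) (Fin q) ℝ :=
  Matrix.of fun i j => entryLow (σ i) (extend q σ j) (v i j)

/-- The symmetric part of the block that belongs to the large singular values. -/
def highPart : Matrix (Fin p) (Fin q) ℝ :=
  Matrix.of fun i j => entryHigh (σ i) (extend q σ j) (v i j) (extendRows v j (colL hpq i))

/-- The explicit Jacobian in the coordinates of the singular vectors. -/
def frameJac : Matrix (Fin p) (Fin q) ℝ :=
  Matrix.of fun i j => entryJac (σ i) (extend q σ j) (v i j) (extendRows v j (colL hpq i))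

lemma genLeft_transpose : (genLeft hpq σ v)ᵀ = -genLeft hpq σ v := by
  ext i k; exact genL_skew _ _ _ _

lemma genRight_transpose : (genRight σ v)ᵀ = -genRight σ v := by
  ext i k; exact genR_skew _ _ _ _

lemma genLeft_mul_diagRect {φ : ℝ → ℝ} (hφ : φ 0 = 0) (i : Fin p) (j : Fin q) :
    (genLeft hpq σ v * diagRect q fun i => φ (σ i)) i j =
      genL (σ i) (extend q σ j) (v i j) (extendRows v j (colL hpq i)) * φ (extend q σ j) := by
  rcases colL_cases hpq j with ⟨k, rfl⟩ | h
  · rw [Matrix.mul_apply, Finset.sum_eq_single k]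
    · simp [diagRect_colL, genLeft]
    · intro l _ hl; simp [diagRect_colL, hl]
    · simp
  · rw [extend_of_le _ h, hφ, mul_zero, Matrix.mul_apply]
    exact Finset.sum_eq_zero fun l _ => by rw [diagRect_of_le _ _ h, mul_zero]

lemma diagRect_mul_apply {n : ℕ} (τ : Fin p → ℝ) (M : Matrix (Fin q) (Fin n) ℝ) (i : Fin p)
    (j : Fin n) : (diagRect q τ * M) i j = τ i * M (colL hpq i) j := by
  rw [Matrix.mul_apply, Finset.sum_eq_single (colL hpq i)]
  · simp [diagRect_colL]
  · intro l _ hl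
    have : (i : ℕ) ≠ l := fun h => hl (Fin.ext h.symm)
    simp [diagRect, this]
  · simp

lemma diagRect_mul_genRight (φ : ℝ → ℝ) (i : Fin p) (j : Fin q) :
    ((diagRect q fun i => φ (σ i)) * genRight σ v) i j =
      φ (σ i) * genR (σ i) (extend q σ j) (v i j) (extendRows v j (colL hpq i)) := by
  rw [diagRect_mul_apply hpq]
  simp [genRight]

variable {σ}

/-- First-order expansion of the projection onto the unit ball of the spectral norm. -/
lemma frame_polar (hσ : ∀ i, 0 ≤ σ i) :
    genLeft hpq σ v * (diagRect q fun i => min (σ i) 1)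
      - (diagRect q fun i => min (σ i) 1) * genRight σ v + lowPart σ v = v - frameJac hpq σ v := by
  ext i j
  have h1 := genLeft_mul_diagRect hpq σ v (φ := fun t => min t 1) (by simp) i j
  have h2 := diagRect_mul_genRight hpq σ v (fun t => min t 1) i j
  rw [Matrix.add_apply, Matrix.sub_apply, h1, h2]
  exact entry_polar (hσ i) (extend_nonneg hσ j) _ _

/-- First-order expansion of the singular value soft thresholding. -/
lemma frame_prox (hσ : ∀ i, 0 ≤ σ i) :
    genLeft hpq σ v * (diagRect q fun i => shrink (σ i))
      - (diagRect q fun i => shrink (σ i)) * genRight σ v + highPart hpq σ v =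
      frameJac hpq σ v := by
  ext i j
  have h1 := genLeft_mul_diagRect hpq σ v (φ := shrink) (shrink_of_le zero_le_one) i j
  have h2 := diagRect_mul_genRight hpq σ v shrink i j
  rw [Matrix.add_apply, Matrix.sub_apply, h1, h2]
  exact entry_prox (hσ i) (extend_nonneg hσ j) _ _

lemma frob_highPart_lowPart (w : Matrix (Fin p) (Fin q) ℝ) :
    frob (highPart hpq σ v) (lowPart σ w) = 0 :=
  Finset.sum_eq_zero fun _ _ => Finset.sum_eq_zero fun _ _ => entryHigh_mul_low _ _ _ _ _

lemma frob_frameJac_lowPart (w : Matrix (Fin p) (Fin q) ℝ) :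
    frob (frameJac hpq σ v) (lowPart σ w) = 0 :=
  Finset.sum_eq_zero fun _ _ => Finset.sum_eq_zero fun _ _ => entryJac_mul_low _ _ _ _ _

lemma sum_eq_zero_of_antisymm {f : Fin p → Fin p → ℝ} (h : ∀ i k, f k i = -f i k) :
    ∑ i, ∑ k, f i k = 0 := by
  have h1 : ∑ i, ∑ k, f i k = -∑ i, ∑ k, f i k := by
    conv_lhs => rw [Finset.sum_comm]
    simp only [← Finset.sum_neg_distrib]
    exact Finset.sum_congr rfl fun i _ => Finset.sum_congr rfl fun k _ => h i k
  linarith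

lemma frob_highPart_polar : frob (highPart hpq σ v) (v - frameJac hpq σ v) = 0 := by
  have h1 : ∀ i, ∑ j, highPart hpq σ v i j * (v - frameJac hpq σ v) i j =
      ∑ k, entryHigh (σ i) (σ k) (v i (colL hpq k)) (v k (colL hpq i)) *
        (v i (colL hpq k) - entryJac (σ i) (σ k) (v i (colL hpq k)) (v k (colL hpq i))) := by
    intro i
    rw [sum_colL hpq]
    · simp [highPart, frameJac]
    · intro j hj
      have : highPart hpq σ v i j = 0 := by
        simp only [highPart, Matrix.of_apply, entryHigh, extend_of_le σ hj]
        rw [if_neg (by norm_num)]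
      rw [this, zero_mul]
  rw [frob, Finset.sum_congr rfl fun i _ => h1 i]
  exact sum_eq_zero_of_antisymm fun i k => entryHigh_mul_polar _ _ _ _

lemma frob_frameJac_comm (v w : Matrix (Fin p) (Fin q) ℝ) :
    frob (frameJac hpq σ v) w = frob v (frameJac hpq σ w) := by
  rw [← sub_eq_zero, frob, frob, ← Finset.sum_sub_distrib]
  have h1 : ∀ i, ∑ j, frameJac hpq σ v i j * w i j - ∑ j, v i j * frameJac hpq σ w i j =
      ∑ k, (entryJac (σ i) (σ k) (v i (colL hpq k)) (v k (colL hpq i)) * w i (colL hpq k) -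
        v i (colL hpq k) * entryJac (σ i) (σ k) (w i (colL hpq k)) (w k (colL hpq i))) := by
    intro i
    rw [← Finset.sum_sub_distrib, sum_colL hpq]
    · simp [frameJac]
    · intro j hj
      simp only [frameJac, Matrix.of_apply, entryJac, extendRows_of_le _ hj]
      ring
  rw [Finset.sum_congr rfl fun i _ => h1 i]
  refine sum_eq_zero_of_antisymm fun i k => ?_
  simp only [entryJac, coefSym_comm (σ k) (σ i), coefSkew_comm (σ k) (σ i)]
  ring

/-- The second-order term of the rotations. -/
lemma frame_second_order (hσ : ∀ i, 0 ≤ σ i) :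
    frob (diagRect q fun i => shrink (σ i))
      (genLeft hpq σ v * (v - frameJac hpq σ v) - (v - frameJac hpq σ v) * genRight σ v
        + (genLeft hpq σ v * lowPart σ v - lowPart σ v * genRight σ v)) =
      -frob (frameJac hpq σ v) (v - frameJac hpq σ v) := by
  -- Skew generators cross the pairing with a sign. By `frame_prox` the rotated diagonal is then the
  -- Jacobian minus the high part, and the orthogonality relations leave only the Jacobian paired
  -- with v - Wv.
  have hL : ∀ Y : Matrix (Fin p) (Fin q) ℝ, frob (diagRect q fun i => shrink (σ i))
      (genLeft hpq σ v * Y) = -frob (genLeft hpq σ v * diagRect q fun i => shrink (σ i)) Y := by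
    intro Y
    rw [frob_mul_left, genLeft_transpose, Matrix.neg_mul, frob_neg_right, neg_neg]
  have hR : ∀ Y : Matrix (Fin p) (Fin q) ℝ, frob (diagRect q fun i => shrink (σ i))
      (Y * genRight σ v) = -frob ((diagRect q fun i => shrink (σ i)) * genRight σ v) Y := by
    intro Y
    rw [frob_mul_right, genRight_transpose, Matrix.mul_neg, frob_neg_right, neg_neg]
  have h := frame_prox hpq v hσ
  have h' : genLeft hpq σ v * (diagRect q fun i => shrink (σ i))
      = frameJac hpq σ v - highPart hpq σ v
        + (diagRect q fun i => shrink (σ i)) * genRight σ v := by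
    rw [← h]; abel
  rw [frob_add_right, frob_sub_right, frob_sub_right, hL, hL, hR, hR, h', frob_add_left,
    frob_add_left, frob_sub_left, frob_sub_left, frob_highPart_polar, frob_highPart_lowPart,
    frob_frameJac_lowPart]
  ring

end Frame

/-! ### Curves of matrices inside the spectral unit ball. -/

section Curves

variable {m n l : Type*} [Fintype m] [Fintype n] [Fintype l]

/-- Entrywise derivative of a curve of matrices. -/
def HasEntryDeriv (X : ℝ → Matrix m n ℝ) (X' : Matrix m n ℝ) (t : ℝ) : Prop :=
  ∀ i j, HasDerivAt (fun s => X s i j) (X' i j) t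

lemma HasEntryDeriv.mul {X : ℝ → Matrix m n ℝ} {Y : ℝ → Matrix n l ℝ} {X' : Matrix m n ℝ}
    {Y' : Matrix n l ℝ} {t : ℝ} (hX : HasEntryDeriv X X' t) (hY : HasEntryDeriv Y Y' t) :
    HasEntryDeriv (fun s => X s * Y s) (X' * Y t + X t * Y') t := fun i j => by
  have h : HasDerivAt (fun s => ∑ k, X s i k * Y s k j)
      (∑ k, (X' i k * Y t k j + X t i k * Y' k j)) t :=
    HasDerivAt.fun_sum fun k _ => (hX i k).mul (hY k j)
  rw [Finset.sum_add_distrib] at h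
  exact h

lemma HasEntryDeriv.frob {X : ℝ → Matrix m n ℝ} {X' : Matrix m n ℝ} {t : ℝ}
    (hX : HasEntryDeriv X X' t) (P : Matrix m n ℝ) :
    HasDerivAt (fun s => frob P (X s)) (frob P X') t :=
  HasDerivAt.fun_sum fun i _ => HasDerivAt.fun_sum fun j _ => (hX i j).const_mul (P i j)

variable [DecidableEq m] [DecidableEq n]

lemma continuous_matrix_exp : Continuous (NormedSpace.exp : Matrix m m ℝ → Matrix m m ℝ) := by
  let _ : NormedRing (Matrix m m ℝ) := Matrix.linftyOpNormedRing
  let _ : NormedAlgebra ℝ (Matrix m m ℝ) := Matrix.linftyOpNormedAlgebra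
  let _ : NormedAlgebra ℚ (Matrix m m ℝ) := NormedAlgebra.restrictScalars ℚ ℝ _
  exact NormedSpace.exp_continuous

lemma hasEntryDeriv_exp (K : Matrix m m ℝ) (t : ℝ) :
    HasEntryDeriv (fun s : ℝ => NormedSpace.exp (s • K)) (NormedSpace.exp (t • K) * K) t := by
  let _ : NormedRing (Matrix m m ℝ) := Matrix.linftyOpNormedRing
  let _ : NormedAlgebra ℝ (Matrix m m ℝ) := Matrix.linftyOpNormedAlgebra
  have h := hasDerivAt_exp_smul_const (𝕂 := ℝ) K t
  intro i j
  let L : Matrix m m ℝ →ₗ[ℝ] ℝ := Matrix.entryLinearMap ℝ ℝ i j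
  exact (L.toContinuousLinearMap.hasFDerivAt.comp_hasDerivAt t h)

lemma hasEntryDeriv_exp' (K : Matrix m m ℝ) (t : ℝ) :
    HasEntryDeriv (fun s : ℝ => NormedSpace.exp (s • K)) (K * NormedSpace.exp (t • K)) t := by
  let _ : NormedRing (Matrix m m ℝ) := Matrix.linftyOpNormedRing
  let _ : NormedAlgebra ℝ (Matrix m m ℝ) := Matrix.linftyOpNormedAlgebra
  have h := hasDerivAt_exp_smul_const' (𝕂 := ℝ) K t
  intro i j
  let L : Matrix m m ℝ →ₗ[ℝ] ℝ := Matrix.entryLinearMap ℝ ℝ i j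
  exact (L.toContinuousLinearMap.hasFDerivAt.comp_hasDerivAt t h)

lemma exp_skew_transpose_mul {K : Matrix m m ℝ} (hK : Kᵀ = -K) (t : ℝ) :
    (NormedSpace.exp (t • K))ᵀ * NormedSpace.exp (t • K) = 1 := by
  rw [← Matrix.exp_transpose, Matrix.transpose_smul, hK, smul_neg, Matrix.exp_neg]
  exact Matrix.nonsing_inv_mul _ ((Matrix.isUnit_iff_isUnit_det _).1 (Matrix.isUnit_exp _))

/-- The curve `e^{tK} X(t) e^{-tM}`. -/
def rotate (K : Matrix m m ℝ) (M : Matrix n n ℝ) (t : ℝ) (X : Matrix m n ℝ) : Matrix m n ℝ :=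
  NormedSpace.exp (t • K) * X * NormedSpace.exp (t • (-M))

lemma rotate_zero (K : Matrix m m ℝ) (M : Matrix n n ℝ) (X : Matrix m n ℝ) :
    rotate K M 0 X = X := by
  simp [rotate, NormedSpace.exp_zero]

/-- Each exponential commutes with its generator, so the derivative is again a rotated matrix and
the rule can be iterated. -/
lemma HasEntryDeriv.rotate (K : Matrix m m ℝ) (M : Matrix n n ℝ) {X : ℝ → Matrix m n ℝ}
    {X' : Matrix m n ℝ} {t : ℝ} (hX : HasEntryDeriv X X' t) :
    HasEntryDeriv (fun s => rotate K M s (X s)) (rotate K M t (K * X t - X t * M + X')) t := by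
  have h := ((hasEntryDeriv_exp K t).mul hX).mul (hasEntryDeriv_exp' (-M) t)
  have e : (NormedSpace.exp (t • K) * K * X t + NormedSpace.exp (t • K) * X') *
      NormedSpace.exp (t • -M) + NormedSpace.exp (t • K) * X t * (-M * NormedSpace.exp (t • -M))
      = VarSuff.rotate K M t (K * X t - X t * M + X') := by
    simp only [VarSuff.rotate, Matrix.mul_add, Matrix.add_mul, Matrix.mul_sub, Matrix.sub_mul,
      Matrix.mul_assoc, Matrix.neg_mul, Matrix.mul_neg]
    abel
  rw [← e]
  exact h

lemma hasEntryDeriv_line (V N : Matrix m n ℝ) (t : ℝ) :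
    HasEntryDeriv (fun s : ℝ => V + s • N) N t := fun i j => by
  have := ((hasDerivAt_id t).mul_const (N i j)).const_add (V i j)
  simpa using this

lemma Contr.rotate {K : Matrix m m ℝ} {M : Matrix n n ℝ} (hK : Kᵀ = -K) (hM : Mᵀ = -M) (t : ℝ)
    {X : Matrix m n ℝ} (hX : Contr X) : Contr (rotate K M t X) := by
  have hM' : (-M)ᵀ = -(-M) := by rw [Matrix.transpose_neg, hM]
  exact ((contr_of_transpose_mul_self (exp_skew_transpose_mul hK t)).mul hX).mul
    (contr_of_transpose_mul_self (exp_skew_transpose_mul hM' t))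

/-- A step which keeps the spectral norm of a matrix below one. -/
lemma Contr.add_sandwich {V Z : Matrix m n ℝ} (hV : Contr V)
    (hZ : ∀ y, 16 * ((Z *ᵥ y) ⬝ᵥ (Z *ᵥ y)) ≤ y ⬝ᵥ y) :
    Contr (V + (1 - V * Vᵀ) * Z * (1 - Vᵀ * V)) := fun x => by
  -- The slack ‖x‖² - ‖Vx‖² is at least ‖w‖² (`h1`, `h7`), and all that the step adds is controlled
  -- by w.
  set w := (1 - Vᵀ * V) *ᵥ x with hw
  set z := Z *ᵥ w with hz
  have hw' : w = x - Vᵀ *ᵥ (V *ᵥ x) := by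
    rw [hw, Matrix.sub_mulVec, Matrix.one_mulVec, Matrix.mulVec_mulVec]
  have hy : (V + (1 - V * Vᵀ) * Z * (1 - Vᵀ * V)) *ᵥ x =
      V *ᵥ x + (z - V *ᵥ (Vᵀ *ᵥ z)) := by
    rw [Matrix.add_mulVec, ← Matrix.mulVec_mulVec, ← Matrix.mulVec_mulVec, ← hw, ← hz,
      Matrix.sub_mulVec, Matrix.one_mulVec, ← Matrix.mulVec_mulVec z V Vᵀ]
  set a := V *ᵥ x with ha
  set b := Vᵀ *ᵥ z with hb
  have e1 : a ⬝ᵥ a = x ⬝ᵥ (Vᵀ *ᵥ a) := mulVec_dotProduct V x a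
  have e2 : V *ᵥ w = a - V *ᵥ (Vᵀ *ᵥ a) := by rw [hw', Matrix.mulVec_sub]
  have e3 : a ⬝ᵥ (V *ᵥ (Vᵀ *ᵥ a)) = (Vᵀ *ᵥ a) ⬝ᵥ (Vᵀ *ᵥ a) := by
    rw [mulVec_dotProduct Vᵀ, Matrix.transpose_transpose]
  have e4 : z ⬝ᵥ (V *ᵥ b) = b ⬝ᵥ b := by
    rw [hb, mulVec_dotProduct Vᵀ, Matrix.transpose_transpose]
  have e5 : a ⬝ᵥ (z - V *ᵥ b) = (V *ᵥ w) ⬝ᵥ z := by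
    have : a ⬝ᵥ (V *ᵥ b) = (V *ᵥ (Vᵀ *ᵥ a)) ⬝ᵥ z := by
      rw [dotProduct_comm, mulVec_dotProduct V b a, hb, mulVec_dotProduct Vᵀ z,
        Matrix.transpose_transpose, dotProduct_comm]
    rw [e2, sub_dotProduct, dotProduct_sub, this]
  have h1 : (Vᵀ *ᵥ a) ⬝ᵥ (Vᵀ *ᵥ a) ≤ a ⬝ᵥ a := hV.transpose a
  have h2 : (V *ᵥ b) ⬝ᵥ (V *ᵥ b) ≤ b ⬝ᵥ b := hV b
  have h3 := hZ w
  have h4 := hV w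
  -- Young's inequality with weights 1/4 and 4: as 16‖z‖² ≤ ‖w‖², the added terms amount to at most
  -- (1/4 + 1/4 + 1/16)‖w‖².
  have h5 : 0 ≤ ((1 / 2 : ℝ) • (V *ᵥ w) - (2 : ℝ) • z) ⬝ᵥ ((1 / 2 : ℝ) • (V *ᵥ w) - (2 : ℝ) • z) :=
    dotProduct_self_nonneg' _
  have h6 : 0 ≤ b ⬝ᵥ b := dotProduct_self_nonneg' _
  have h7 : w ⬝ᵥ w = x ⬝ᵥ x - 2 * (a ⬝ᵥ a) + (Vᵀ *ᵥ a) ⬝ᵥ (Vᵀ *ᵥ a) := by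
    rw [hw', sub_dotProduct, dotProduct_sub, dotProduct_sub, dotProduct_comm (Vᵀ *ᵥ a) x, ← e1]
    ring
  have h8 : (z - V *ᵥ b) ⬝ᵥ (z - V *ᵥ b) = z ⬝ᵥ z - 2 * (b ⬝ᵥ b) + (V *ᵥ b) ⬝ᵥ (V *ᵥ b) := by
    rw [sub_dotProduct, dotProduct_sub, dotProduct_sub, dotProduct_comm (V *ᵥ b) z, e4]
    ring
  have h9 : (V *ᵥ x + (z - V *ᵥ b)) ⬝ᵥ (V *ᵥ x + (z - V *ᵥ b)) =
      a ⬝ᵥ a + 2 * ((V *ᵥ w) ⬝ᵥ z) + (z - V *ᵥ b) ⬝ᵥ (z - V *ᵥ b) := by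
    rw [← ha, add_dotProduct, dotProduct_add, dotProduct_add, dotProduct_comm (z - V *ᵥ b) a, e5]
    ring
  have h10 : ((1 / 2 : ℝ) • (V *ᵥ w) - (2 : ℝ) • z) ⬝ᵥ ((1 / 2 : ℝ) • (V *ᵥ w) - (2 : ℝ) • z) =
      1 / 4 * ((V *ᵥ w) ⬝ᵥ (V *ᵥ w)) - 2 * ((V *ᵥ w) ⬝ᵥ z) + 4 * (z ⬝ᵥ z) := by
    simp only [sub_dotProduct, dotProduct_sub, smul_dotProduct, dotProduct_smul, smul_eq_mul,
      dotProduct_comm z (V *ᵥ w)]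
    ring
  rw [hy, h9, h8]
  rw [h10] at h5
  have hz' : z ⬝ᵥ z = (Z *ᵥ w) ⬝ᵥ (Z *ᵥ w) := rfl
  have hw0 : 0 ≤ w ⬝ᵥ w := dotProduct_self_nonneg' _
  rw [← hz'] at h3
  linarith

lemma mulVec_sq_le_frob (Z : Matrix m n ℝ) (y : n → ℝ) :
    (Z *ᵥ y) ⬝ᵥ (Z *ᵥ y) ≤ frob Z Z * (y ⬝ᵥ y) := by
  rw [frob, Finset.sum_mul]
  refine Finset.sum_le_sum fun i _ => ?_
  have := dotProduct_sq_le (fun j => Z i j) y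
  simpa [sq, dotProduct, Matrix.mulVec] using this

end Curves

/-- Taylor's formula with a one-sided bound on the second derivative, by applying monotonicity
twice. -/
lemma quadratic_lower_bound {φ φ' φ'' : ℝ → ℝ} {t m : ℝ} (ht : 0 ≤ t)
    (h1 : ∀ s, HasDerivAt φ (φ' s) s) (h2 : ∀ s, HasDerivAt φ' (φ'' s) s)
    (h3 : ∀ s ∈ Icc 0 t, m ≤ φ'' s) : φ 0 + t * φ' 0 + 1 / 2 * m * t ^ 2 ≤ φ t := by
  have mono : ∀ {f f' : ℝ → ℝ}, (∀ s, HasDerivAt f (f' s) s) → (∀ s ∈ Icc 0 t, 0 ≤ f' s) →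
      ∀ s ∈ Icc 0 t, f 0 ≤ f s := by
    intro f f' hf hf' s hs
    have : MonotoneOn f (Icc 0 t) := by
      refine monotoneOn_of_deriv_nonneg (convex_Icc 0 t)
        (fun s _ => (hf s).continuousAt.continuousWithinAt)
        (fun s _ => (hf s).differentiableAt.differentiableWithinAt) fun s hs => ?_
      rw [(hf s).deriv]
      exact hf' s (interior_subset hs)
    exact this (left_mem_Icc.2 ht) hs hs.1
  have a1 : ∀ s ∈ Icc 0 t, 0 ≤ φ' s - φ' 0 - m * s := by
    intro s hs
    have := mono (f := fun s => φ' s - φ' 0 - m * s) (f' := fun s => φ'' s - m)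
      (fun s => by
        have := ((h2 s).sub_const (φ' 0)).sub ((hasDerivAt_id s).const_mul m)
        rw [mul_one] at this
        exact this) (fun s hs => sub_nonneg.2 (h3 s hs)) s hs
    simpa using this
  have a2 := mono (f := fun s => φ s - s * φ' 0 - 1 / 2 * m * s ^ 2)
    (f' := fun s => φ' s - φ' 0 - m * s)
    (fun s => by
      have := ((h1 s).sub ((hasDerivAt_id s).mul_const (φ' 0))).sub
        ((hasDerivAt_pow 2 s).const_mul (1 / 2 * m))
      convert! this using 1
      norm_num
      ring) a1 t (right_mem_Icc.2 ht)
  norm_num at a2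
  linarith

/-- A lower second-order expansion of `g`, uniform over the graph of the subdifferential near
`(X, U)`, whose second-order term is governed by the operator `W`. -/
def SecondOrderLower {E : Type*} [NormedAddCommGroup E] [InnerProductSpace ℝ E] (g : E → ℝ)
    (X U : E) (W : E →L[ℝ] E) : Prop :=
  ∀ η : ℝ, 0 < η → ∃ δ : ℝ, 0 < δ ∧ ∀ P V P', SubG g P V → ‖P - X‖ < δ → ‖V - U‖ < δ →
    ‖P' - X‖ < δ → ∀ v, ‖v‖ ≤ δ →
    ⟪P' - P, v - W v⟫_ℝ - 1 / 2 * ⟪W v, v - W v⟫_ℝ - η * (‖v‖ ^ 2 + ‖P' - P‖ * ‖v‖)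
      ≤ g P' - g P - ⟪V, P' - P⟫_ℝ

/-! ### The uniform second-order lower expansion in the singular frame. -/

section FrameExpansion

variable {p q : ℕ}

lemma continuous_mat : Continuous (mat : MatSpace p q → Matrix (Fin p) (Fin q) ℝ) := by
  refine continuous_matrix fun i j => ?_
  exact EuclideanSpace.proj (𝕜 := ℝ) (i, j) |>.continuous

lemma continuous_ofMat : Continuous (ofMat : Matrix (Fin p) (Fin q) ℝ → MatSpace p q) := by
  refine (PiLp.continuous_toLp 2 _).comp (continuous_pi fun ij => ?_)
  exact continuous_id.matrix_elem ij.1 ij.2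

lemma continuous_frob {m n : Type*} [Fintype m] [Fintype n] :
    Continuous fun z : Matrix m n ℝ × Matrix m n ℝ => frob z.1 z.2 := by
  unfold frob
  fun_prop

variable (hpq : p ≤ q) (σ : Fin p → ℝ)

lemma continuous_genLeft : Continuous (genLeft hpq σ) := by
  refine continuous_matrix fun i k => ?_
  unfold genLeft genL
  simp only [Matrix.of_apply]
  fun_prop

lemma continuous_extendRows :
    Continuous (extendRows : Matrix (Fin p) (Fin q) ℝ → Matrix (Fin q) (Fin q) ℝ) := by
  refine continuous_matrix fun j l => ?_
  unfold extendRows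
  simp only [Matrix.of_apply]
  split_ifs <;> fun_prop

lemma continuous_genRight :
    Continuous (genRight σ : Matrix (Fin p) (Fin q) ℝ → Matrix (Fin q) (Fin q) ℝ) := by
  refine continuous_matrix fun j l => ?_
  have h1 := (continuous_extendRows (p := p) (q := q)).matrix_elem j l
  have h2 := (continuous_extendRows (p := p) (q := q)).matrix_elem l j
  unfold genRight genR
  simp only [Matrix.of_apply]
  fun_prop

/-- The part `lowPart`, scaled so that `Contr.add_sandwich` moves along `lowPart`. -/
def lowScaled (v : Matrix (Fin p) (Fin q) ℝ) : Matrix (Fin p) (Fin q) ℝ :=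
  Matrix.of fun i j => entryLow (σ i) (extend q σ j) (v i j) /
    ((1 - min (σ i) 1 * min (σ i) 1) * (1 - min (extend q σ j) 1 * min (extend q σ j) 1))

lemma continuous_lowScaled : Continuous (lowScaled (q := q) σ) := by
  refine continuous_matrix fun i j => ?_
  unfold lowScaled entryLow
  simp only [Matrix.of_apply]
  split_ifs <;> fun_prop

lemma diagRect_mul_transpose (hpq : p ≤ q) (τ : Fin p → ℝ) :
    diagRect q τ * (diagRect q τ)ᵀ = Matrix.diagonal fun i => τ i * τ i := by
  ext i k
  rw [diagRect_mul_apply hpq, Matrix.transpose_apply, diagRect_colL, Matrix.diagonal_apply]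
  by_cases h : i = k
  · simp [h]
  · simp [h, Ne.symm h]

lemma diagRect_transpose_mul (hpq : p ≤ q) (σ : Fin p → ℝ) {φ : ℝ → ℝ} (hφ : φ 0 = 0) :
    (diagRect q fun i => φ (σ i))ᵀ * (diagRect q fun i => φ (σ i)) =
      Matrix.diagonal fun j => φ (extend q σ j) * φ (extend q σ j) := by
  ext j l
  rw [Matrix.mul_apply, Matrix.diagonal_apply]
  simp only [Matrix.transpose_apply]
  rcases colL_cases hpq j with ⟨k, rfl⟩ | h
  · rw [Finset.sum_eq_single k, diagRect_colL, if_pos rfl]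
    · by_cases h' : colL hpq k = l
      · subst h'; simp [diagRect_colL]
      · have : (k : ℕ) ≠ l := fun h'' => h' (Fin.ext h'')
        simp [h', diagRect, this]
    · intro i _ hi; simp [diagRect_colL, hi]
    · simp
  · rw [Finset.sum_eq_zero fun i _ => by rw [diagRect_of_le _ _ h, zero_mul], extend_of_le _ h, hφ]
    simp

lemma entryLow_div {s t : ℝ} (hs : 0 ≤ s) (ht : 0 ≤ t) (x : ℝ) :
    (1 - min s 1 * min s 1) *
      (entryLow s t x / ((1 - min s 1 * min s 1) * (1 - min t 1 * min t 1))) *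
      (1 - min t 1 * min t 1) = entryLow s t x := by
  unfold entryLow
  split_ifs with h
  · rw [min_eq_left h.1.le, min_eq_left h.2.le]
    have h1 : 1 - s * s ≠ 0 := by nlinarith
    have h2 : 1 - t * t ≠ 0 := by nlinarith
    rw [mul_div_assoc', div_mul_eq_mul_div, div_eq_iff (mul_ne_zero h1 h2)]
    ring
  · simp

variable {σ}

/-- At the frame point both outer factors are diagonal with entries 1 - min(σ, 1)², nonzero on the
low block, and the division in `lowScaled` undoes them. At other contractions V the sandwich form is
what keeps the step feasible. -/
lemma sandwich_lowScaled (hpq : p ≤ q) (hσ : ∀ i, 0 ≤ σ i) (v : Matrix (Fin p) (Fin q) ℝ) :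
    (1 - (diagRect q fun i => min (σ i) 1) * (diagRect q fun i => min (σ i) 1)ᵀ) * lowScaled σ v *
      (1 - (diagRect q fun i => min (σ i) 1)ᵀ * (diagRect q fun i => min (σ i) 1)) =
      lowPart σ v := by
  rw [diagRect_mul_transpose hpq, diagRect_transpose_mul hpq σ (φ := fun t => min t 1) (by simp),
    ← Matrix.diagonal_one, ← Matrix.diagonal_one, Matrix.diagonal_sub, Matrix.diagonal_sub]
  ext i j
  rw [Matrix.mul_diagonal, Matrix.diagonal_mul]
  exact entryLow_div (hσ i) (extend_nonneg hσ j) _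

variable (σ)

lemma extendRows_add (v w : Matrix (Fin p) (Fin q) ℝ) :
    extendRows (v + w) = extendRows v + extendRows w := by
  ext j l
  simp only [extendRows, Matrix.of_apply, Matrix.add_apply]
  split_ifs <;> simp

lemma extendRows_smul (c : ℝ) (v : Matrix (Fin p) (Fin q) ℝ) :
    extendRows (c • v) = c • extendRows v := by
  ext j l
  simp only [extendRows, Matrix.of_apply, Matrix.smul_apply]
  split_ifs <;> simp

/-- The explicit Jacobian in the coordinates of the singular vectors, as a linear operator. -/
def frameJacL : MatSpace p q →L[ℝ] MatSpace p q :=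
  LinearMap.toContinuousLinearMap
    { toFun := fun D => ofMat (frameJac hpq σ (mat D))
      map_add' := fun D D' => by
        apply mat_injective
        change frameJac hpq σ (mat D + mat D') = frameJac hpq σ (mat D) + frameJac hpq σ (mat D')
        ext i j
        simp only [frameJac, entryJac, extendRows_add, Matrix.of_apply, Matrix.add_apply]
        ring
      map_smul' := fun c D => by
        apply mat_injective
        change frameJac hpq σ (c • mat D) = c • frameJac hpq σ (mat D)
        ext i j
        simp only [frameJac, entryJac, extendRows_smul, Matrix.of_apply, Matrix.smul_apply,
          smul_eq_mul]
        ring }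

lemma mat_frameJacL (D : MatSpace p q) :
    mat (frameJacL hpq σ D) = frameJac hpq σ (mat D) := rfl

/-- The tangential step at `V` in the direction `u`. -/
def sandwich (V u : Matrix (Fin p) (Fin q) ℝ) : Matrix (Fin p) (Fin q) ℝ :=
  (1 - V * Vᵀ) * lowScaled σ u * (1 - Vᵀ * V)

/-- The velocity at `t` of the rotated line through `V`, before the rotation. -/
def velocity (V u : Matrix (Fin p) (Fin q) ℝ) (t : ℝ) : Matrix (Fin p) (Fin q) ℝ :=
  genLeft hpq σ u * (V + t • sandwich σ V u) - (V + t • sandwich σ V u) * genRight σ u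
    + sandwich σ V u

/-- The acceleration at `t` of the rotated line through `V`, before the rotation. -/
def acceleration (V u : Matrix (Fin p) (Fin q) ℝ) (t : ℝ) : Matrix (Fin p) (Fin q) ℝ :=
  genLeft hpq σ u * velocity hpq σ V u t - velocity hpq σ V u t * genRight σ u
    + (genLeft hpq σ u * sandwich σ V u - sandwich σ V u * genRight σ u)

lemma hasEntryDeriv_curve (V u : Matrix (Fin p) (Fin q) ℝ) (t : ℝ) :
    HasEntryDeriv (fun s => rotate (genLeft hpq σ u) (genRight σ u) s (V + s • sandwich σ V u))
      (rotate (genLeft hpq σ u) (genRight σ u) t (velocity hpq σ V u t)) t :=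
  (hasEntryDeriv_line V (sandwich σ V u) t).rotate _ _

lemma hasEntryDeriv_velocity (V u : Matrix (Fin p) (Fin q) ℝ) (t : ℝ) :
    HasEntryDeriv (fun s => rotate (genLeft hpq σ u) (genRight σ u) s (velocity hpq σ V u s))
      (rotate (genLeft hpq σ u) (genRight σ u) t (acceleration hpq σ V u t)) t := by
  refine HasEntryDeriv.rotate _ _ ?_
  have h := hasEntryDeriv_line (velocity hpq σ V u 0)
    (genLeft hpq σ u * sandwich σ V u - sandwich σ V u * genRight σ u) t
  -- The line V + sN enters linearly, so the velocity is affine in time.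
  have e : ∀ s, velocity hpq σ V u s = velocity hpq σ V u 0 +
      s • (genLeft hpq σ u * sandwich σ V u - sandwich σ V u * genRight σ u) := by
    intro s
    simp only [velocity, Matrix.mul_add, Matrix.add_mul, Matrix.mul_smul, Matrix.smul_mul, smul_sub,
      zero_smul, Matrix.mul_zero, Matrix.zero_mul]
    abel
  simp_rw [← e] at h
  exact h

lemma continuous_sandwich : Continuous fun z : Matrix (Fin p) (Fin q) ℝ × Matrix (Fin p) (Fin q) ℝ =>
    sandwich σ z.1 z.2 := by
  have := continuous_lowScaled (q := q) σ
  unfold sandwich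
  fun_prop

lemma continuous_velocity : Continuous
    fun z : (Matrix (Fin p) (Fin q) ℝ × Matrix (Fin p) (Fin q) ℝ) × ℝ =>
      velocity hpq σ z.1.1 z.1.2 z.2 := by
  have h1 := continuous_sandwich (q := q) σ
  have h1' : Continuous fun z : (Matrix (Fin p) (Fin q) ℝ × Matrix (Fin p) (Fin q) ℝ) × ℝ =>
    sandwich σ z.1.1 z.1.2 := h1.comp continuous_fst
  have h2 := continuous_genLeft hpq σ
  have h3 := continuous_genRight (q := q) σ
  unfold velocity
  fun_prop

/-- Joint continuity in base point, direction and time is what makes the expansion uniform near the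
frame point. -/
lemma continuous_acceleration : Continuous
    fun z : (Matrix (Fin p) (Fin q) ℝ × Matrix (Fin p) (Fin q) ℝ) × ℝ =>
      rotate (genLeft hpq σ z.1.2) (genRight σ z.1.2) z.2 (acceleration hpq σ z.1.1 z.1.2 z.2) := by
  have h1 := continuous_sandwich (q := q) σ
  have h1' : Continuous fun z : (Matrix (Fin p) (Fin q) ℝ × Matrix (Fin p) (Fin q) ℝ) × ℝ =>
    sandwich σ z.1.1 z.1.2 := h1.comp continuous_fst
  have h2 := continuous_genLeft hpq σ
  have h3 := continuous_genRight (q := q) σ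
  have h4 := continuous_velocity hpq σ
  have h5 := continuous_matrix_exp (m := Fin p)
  have h6 := continuous_matrix_exp (m := Fin q)
  unfold acceleration rotate
  fun_prop

end FrameExpansion

section FrameExpansion

variable {p q : ℕ} (hpq : p ≤ q) {σ : Fin p → ℝ}

lemma velocity_zero_frame (hσ : ∀ i, 0 ≤ σ i) (u : Matrix (Fin p) (Fin q) ℝ) :
    velocity hpq σ (diagRect q fun i => min (σ i) 1) u 0 = u - frameJac hpq σ u := by
  rw [velocity, zero_smul, add_zero, sandwich, sandwich_lowScaled hpq hσ, frame_polar hpq u hσ]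

lemma frob_acceleration_zero_frame (hσ : ∀ i, 0 ≤ σ i) (u : Matrix (Fin p) (Fin q) ℝ) :
    frob (diagRect q fun i => shrink (σ i))
      (acceleration hpq σ (diagRect q fun i => min (σ i) 1) u 0) =
      -frob (frameJac hpq σ u) (u - frameJac hpq σ u) := by
  rw [acceleration, velocity_zero_frame hpq hσ, sandwich, sandwich_lowScaled hpq hσ,
    frame_second_order hpq u hσ]

lemma contr_curve {V u : Matrix (Fin p) (Fin q) ℝ} (hV : Contr V) {t : ℝ}
    (ht : 16 * (t ^ 2 * frob (lowScaled σ u) (lowScaled σ u)) ≤ 1) :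
    Contr (rotate (genLeft hpq σ u) (genRight σ u) t (V + t • sandwich σ V u)) := by
  refine Contr.rotate (genLeft_transpose hpq σ u) (genRight_transpose σ u) t ?_
  have e : t • sandwich σ V u = (1 - V * Vᵀ) * (t • lowScaled σ u) * (1 - Vᵀ * V) := by
    simp [sandwich]
  rw [e]
  refine hV.add_sandwich fun y => ?_
  have h1 := mulVec_sq_le_frob (t • lowScaled σ u) y
  rw [frob_smul_left, frob_smul_right] at h1
  have h2 := dotProduct_self_nonneg' y
  nlinarith [mul_le_mul_of_nonneg_right ht h2]

/-- Stationarity of the pairing with a subgradient along the feasible curves. -/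
lemma frob_velocity_eq_zero {P V : MatSpace p q} (h : SubG nuclearNorm P V)
    (u : Matrix (Fin p) (Fin q) ℝ) : frob (mat P) (velocity hpq σ (mat V) u 0) = 0 := by
  obtain ⟨hV, hPV⟩ := (subG_nuclearNorm_iff hpq).1 h
  have hd := (hasEntryDeriv_curve hpq σ (mat V) u 0).frob (mat P)
  rw [rotate_zero] at hd
  -- P attains its norm at V and the curve stays in the unit ball, so t = 0 maximizes the pairing.
  refine IsLocalMax.hasDerivAt_eq_zero ?_ hd
  have hc : ∀ᶠ t : ℝ in 𝓝 0, 16 * (t ^ 2 * frob (lowScaled σ u) (lowScaled σ u)) < 1 := by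
    have : Continuous fun t : ℝ => 16 * (t ^ 2 * frob (lowScaled σ u) (lowScaled σ u)) := by
      fun_prop
    exact (this.tendsto 0).eventually_lt_const (by simp)
  filter_upwards [hc] with t ht
  rw [rotate_zero, zero_smul, add_zero, ← inner_eq_frob, hPV]
  exact frob_le_nuclearNorm hpq P (contr_curve hpq hV ht.le)

/-- g(P') dominates the pairing of P' with the point at time ‖v‖ of the feasible curve from V in the
direction v/‖v‖; Taylor's formula bounds that pairing below. Compactness of the sphere of directions
makes the errors uniform. -/
theorem secondOrderLower_frame (hσ : ∀ i, 0 ≤ σ i) :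
    SecondOrderLower nuclearNorm (ofMat (diagRect q fun i => shrink (σ i)))
      (ofMat (diagRect q fun i => min (σ i) 1)) (frameJacL hpq σ) := by
  intro η hη
  set X := ofMat (diagRect q fun i => shrink (σ i)) with hX
  set U := ofMat (diagRect q fun i => min (σ i) 1) with hU
  set W := frameJacL hpq σ with hW
  have hK : IsCompact (Metric.sphere (0 : MatSpace p q) 1) := isCompact_sphere 0 1
  have hcm := continuous_mat (p := p) (q := q)
  have C1 : ∀ᶠ z : (MatSpace p q × MatSpace p q) × ℝ in 𝓝 ((U, X), 0),
      ∀ u ∈ Metric.sphere (0 : MatSpace p q) 1, -⟪W u, u - W u⟫_ℝ - η <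
        frob (mat z.1.2) (rotate (genLeft hpq σ (mat u)) (genRight σ (mat u)) z.2
          (acceleration hpq σ (mat z.1.1) (mat u) z.2)) := by
    refine hK.eventually_forall_of_forall_eventually fun u _ => ?_
    have c1 : Continuous fun z : ((MatSpace p q × MatSpace p q) × ℝ) × MatSpace p q =>
        -⟪W z.2, z.2 - W z.2⟫_ℝ - η := by fun_prop
    have c2 : Continuous fun z : ((MatSpace p q × MatSpace p q) × ℝ) × MatSpace p q =>
        frob (mat z.1.1.2) (rotate (genLeft hpq σ (mat z.2)) (genRight σ (mat z.2)) z.1.2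
          (acceleration hpq σ (mat z.1.1.1) (mat z.2) z.1.2)) := by
      have c3 : Continuous fun z : ((MatSpace p q × MatSpace p q) × ℝ) × MatSpace p q =>
          ((mat z.1.1.1, mat z.2), z.1.2) := by fun_prop
      have c4 : Continuous fun z : ((MatSpace p q × MatSpace p q) × ℝ) × MatSpace p q =>
          mat z.1.1.2 := by fun_prop
      exact continuous_frob.comp (c4.prodMk ((continuous_acceleration hpq σ).comp c3))
    refine c1.continuousAt.eventually_lt c2.continuousAt ?_
    change _ < frob (mat X) (rotate _ _ 0 (acceleration hpq σ (mat U) (mat u) 0))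
    rw [rotate_zero, hX, hU, mat_ofMat, mat_ofMat, frob_acceleration_zero_frame hpq hσ,
      inner_eq_frob, mat_sub, hW, mat_frameJacL]
    linarith
  have C2 : ∀ᶠ V : MatSpace p q in 𝓝 U, ∀ u ∈ Metric.sphere (0 : MatSpace p q) 1,
      ‖ofMat (velocity hpq σ (mat V) (mat u) 0) - (u - W u)‖ < η := by
    refine hK.eventually_forall_of_forall_eventually fun u _ => ?_
    have c1 : Continuous fun z : MatSpace p q × MatSpace p q =>
        ‖ofMat (velocity hpq σ (mat z.1) (mat z.2) 0) - (z.2 - W z.2)‖ := by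
      have c3 : Continuous fun z : MatSpace p q × MatSpace p q =>
          ((mat z.1, mat z.2), (0 : ℝ)) := by fun_prop
      have c4 := continuous_ofMat.comp ((continuous_velocity hpq σ).comp c3)
      exact (c4.sub (by fun_prop)).norm
    refine c1.continuousAt.eventually_lt continuousAt_const ?_
    change ‖ofMat (velocity hpq σ (mat U) (mat u) 0) - (u - W u)‖ < η
    rw [hU, mat_ofMat, velocity_zero_frame hpq hσ]
    have : ofMat (mat u - frameJac hpq σ (mat u)) = u - W u := rfl
    rw [this, sub_self, norm_zero]
    exact hη
  obtain ⟨c, hc⟩ : ∃ c : ℝ, ∀ u ∈ Metric.sphere (0 : MatSpace p q) 1,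
      frob (lowScaled σ (mat u)) (lowScaled σ (mat u)) ≤ c := by
    have c1 : Continuous fun u : MatSpace p q =>
        frob (lowScaled σ (mat u)) (lowScaled σ (mat u)) := by
      have c3 := (continuous_lowScaled (q := q) σ).comp hcm
      exact continuous_frob.comp (c3.prodMk c3)
    obtain ⟨c, hc⟩ := (hK.bddAbove_image c1.continuousOn)
    exact ⟨c, fun u hu => hc (mem_image_of_mem _ hu)⟩
  have hc' : ∀ᶠ t : ℝ in 𝓝 0, 16 * (t ^ 2 * c) < 1 := by
    have : Continuous fun t : ℝ => 16 * (t ^ 2 * c) := by fun_prop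
    exact (this.tendsto 0).eventually_lt_const (by simp)
  obtain ⟨δ₁, hδ₁, H1⟩ := Metric.eventually_nhds_iff.1 C1
  obtain ⟨δ₂, hδ₂, H2⟩ := Metric.eventually_nhds_iff.1 C2
  obtain ⟨δ₃, hδ₃, H3⟩ := Metric.eventually_nhds_iff.1 hc'
  have hm : 0 < min δ₁ (min δ₂ δ₃) := lt_min hδ₁ (lt_min hδ₂ hδ₃)
  refine ⟨min δ₁ (min δ₂ δ₃) / 2, by positivity, ?_⟩
  intro P V P' hPV hP hV hP' v hv
  have l1 : min δ₁ (min δ₂ δ₃) / 2 < δ₁ := (half_lt_self hm).trans_le (min_le_left _ _)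
  have l2 : min δ₁ (min δ₂ δ₃) / 2 < δ₂ :=
    (half_lt_self hm).trans_le ((min_le_right _ _).trans (min_le_left _ _))
  have l3 : min δ₁ (min δ₂ δ₃) / 2 < δ₃ :=
    (half_lt_self hm).trans_le ((min_le_right _ _).trans (min_le_right _ _))
  generalize min δ₁ (min δ₂ δ₃) / 2 = δ at *
  obtain ⟨hVc, hPVn⟩ := (subG_nuclearNorm_iff hpq).1 hPV
  -- As ⟨P, V⟩ = g(P), the subgradient excess at P' is g(P') - ⟨P', V⟩.
  have hg : nuclearNorm P' - nuclearNorm P - ⟪V, P' - P⟫_ℝ = nuclearNorm P' - ⟪P', V⟫_ℝ := by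
    rw [inner_sub_right, real_inner_comm P V, real_inner_comm P' V, hPVn]; ring
  rw [hg]
  rcases eq_or_ne v 0 with rfl | hv0
  · have := frob_le_nuclearNorm hpq P' hVc
    rw [inner_eq_frob P' V]
    simp only [map_zero, sub_zero, inner_zero_right, norm_zero]
    linarith
  set t := ‖v‖ with ht
  have ht0 : 0 < t := norm_pos_iff.2 hv0
  set u := t⁻¹ • v with hu
  have hus : u ∈ Metric.sphere (0 : MatSpace p q) 1 := by
    rw [mem_sphere_zero_iff_norm, hu, norm_smul, norm_inv, norm_norm, ← ht,
      inv_mul_cancel₀ ht0.ne']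
  have hvu : v = t • u := by rw [hu, smul_inv_smul₀ ht0.ne']
  have hT := quadratic_lower_bound (t := t) (m := -⟪W u, u - W u⟫_ℝ - η) ht0.le
    (fun s => (hasEntryDeriv_curve hpq σ (mat V) (mat u) s).frob (mat P'))
    (fun s => (hasEntryDeriv_velocity hpq σ (mat V) (mat u) s).frob (mat P')) (fun s hs => by
      refine (@H1 ((V, P'), s) ?_ u hus).le
      rw [Prod.dist_eq, Prod.dist_eq, max_lt_iff, max_lt_iff, dist_eq_norm, dist_eq_norm,
        dist_zero_right, Real.norm_of_nonneg hs.1]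
      exact ⟨⟨hV.trans l1, hP'.trans l1⟩, (hs.2.trans hv).trans_lt l1⟩)
  have hfeas : 16 * (t ^ 2 * frob (lowScaled σ (mat u)) (lowScaled σ (mat u))) ≤ 1 := by
    have h1 := @H3 t (by rw [dist_zero_right, Real.norm_of_nonneg ht0.le]; exact hv.trans_lt l3)
    have h2 := hc u hus
    nlinarith [sq_nonneg t]
  have hle := frob_le_nuclearNorm hpq P' (contr_curve hpq hVc hfeas)
  rw [rotate_zero, rotate_zero, zero_smul, add_zero] at hT
  -- Stationarity at P replaces P' by P' - P, so the deviation of the velocity from u - Wu costs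
  -- only η‖P' - P‖.
  have hvel : ⟪P' - P, u - W u⟫_ℝ - ‖P' - P‖ * η ≤
      frob (mat P') (velocity hpq σ (mat V) (mat u) 0) := by
    have h1 := frob_velocity_eq_zero hpq (σ := σ) hPV (mat u)
    have h2 : frob (mat P') (velocity hpq σ (mat V) (mat u) 0) =
        ⟪P' - P, ofMat (velocity hpq σ (mat V) (mat u) 0)⟫_ℝ := by
      rw [inner_eq_frob, mat_sub, frob_sub_left, mat_ofMat, h1, sub_zero]
    have h3 := H2 (show dist V U < δ₂ by rw [dist_eq_norm]; exact hV.trans l2) u hus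
    have h4 := neg_le_of_abs_le
      (abs_real_inner_le_norm (P' - P) (ofMat (velocity hpq σ (mat V) (mat u) 0) - (u - W u)))
    rw [inner_sub_right] at h4
    have h5 := mul_le_mul_of_nonneg_left h3.le (norm_nonneg (P' - P))
    rw [h2]
    linarith
  rw [inner_eq_frob P' V]
  have e1 : ⟪P' - P, v - W v⟫_ℝ = t * ⟪P' - P, u - W u⟫_ℝ := by
    rw [hvu, map_smul, ← smul_sub, inner_smul_right]
  have e2 : ⟪W v, v - W v⟫_ℝ = t ^ 2 * ⟪W u, u - W u⟫_ℝ := by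
    rw [hvu, map_smul, ← smul_sub, inner_smul_right, real_inner_smul_left]; ring
  rw [e1, e2]
  have h6 := mul_le_mul_of_nonneg_left hvel ht0.le
  have h7 : 0 ≤ η * t ^ 2 := by positivity
  linarith

end FrameExpansion

/-! ### Invariance under linear isometries. -/

section Transport

variable {E : Type*} [NormedAddCommGroup E] [InnerProductSpace ℝ E] {g : E → ℝ}
  (T : E ≃ₗᵢ[ℝ] E)

/-- The conjugate of an operator by a linear isometry. -/
def conjIso (W : E →L[ℝ] E) : E →L[ℝ] E :=
  (T : E →L[ℝ] E) ∘L W ∘L (T.symm : E →L[ℝ] E)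

@[simp] lemma conjIso_apply (W : E →L[ℝ] E) (v : E) : conjIso T W v = T (W (T.symm v)) := rfl

variable {T}

lemma SubG.map_iso (hT : ∀ x, g (T x) = g x) {P V : E} (h : SubG g P V) : SubG g (T P) (T V) := fun Q => by
  have := h (T.symm Q)
  rw [← hT (T.symm Q), ← T.inner_map_map, map_sub, T.apply_symm_apply] at this
  rwa [hT]

lemma SubG.map_iso_symm (hT : ∀ x, g (T x) = g x) {P V : E} (h : SubG g P V) : SubG g (T.symm P) (T.symm V) :=
  SubG.map_iso (T := T.symm) (fun x => by rw [← hT (T.symm x), T.apply_symm_apply]) h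

lemma SecondOrderLower.map_iso (hT : ∀ x, g (T x) = g x) {X U : E} {W : E →L[ℝ] E} (h : SecondOrderLower g X U W) :
    SecondOrderLower g (T X) (T U) (conjIso T W) := by
  intro η hη
  obtain ⟨δ, hδ, H⟩ := h η hη
  have hn : ∀ a b : E, ‖T.symm a - b‖ = ‖a - T b‖ := fun a b => by
    rw [← T.norm_map, map_sub, T.apply_symm_apply]
  have hgs : ∀ x, g (T.symm x) = g x := fun x => by rw [← hT (T.symm x), T.apply_symm_apply]
  refine ⟨δ, hδ, fun P V P' hPV hP hV hP' v hv => ?_⟩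
  have := H (T.symm P) (T.symm V) (T.symm P') (hPV.map_iso_symm hT) (by rwa [hn]) (by rwa [hn])
    (by rwa [hn]) (T.symm v) (by rwa [T.symm.norm_map])
  have e1 : T.symm v - W (T.symm v) = T.symm (v - conjIso T W v) := by
    rw [map_sub, conjIso_apply, T.symm_apply_apply]
  have e2 : W (T.symm v) = T.symm (conjIso T W v) := by
    rw [conjIso_apply, T.symm_apply_apply]
  rw [e1, e2, ← map_sub, T.symm.inner_map_map, T.symm.inner_map_map, T.symm.inner_map_map,
    T.symm.norm_map, T.symm.norm_map, hgs, hgs] at this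
  exact this

end Transport

/-! ### The derivative of the proximal mapping away from the threshold. -/

section ProxDerivative

variable {p q : ℕ} (hpq : p ≤ q) {σ : Fin p → ℝ}

lemma HasEntryDeriv.ofMat {X : ℝ → Matrix (Fin p) (Fin q) ℝ} {X' : Matrix (Fin p) (Fin q) ℝ}
    {t : ℝ} (h : HasEntryDeriv X X' t) : HasDerivAt (fun s => ofMat (X s)) (ofMat X') t := by
  have h1 : HasDerivAt (fun s (ij : Fin p × Fin q) => X s ij.1 ij.2) (fun ij => X' ij.1 ij.2) t :=
    hasDerivAt_pi.2 fun ij => h ij.1 ij.2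
  exact (EuclideanSpace.equiv (Fin p × Fin q) ℝ).symm.hasFDerivAt.comp_hasDerivAt t h1

lemma frob_rotate {K : Matrix (Fin p) (Fin p) ℝ} {M : Matrix (Fin q) (Fin q) ℝ}
    (A V : Matrix (Fin p) (Fin q) ℝ) (t : ℝ) :
    frob (rotate K M t A) V = frob A ((NormedSpace.exp (t • K))ᵀ * V *
      (NormedSpace.exp (t • -M))ᵀ) := by
  rw [rotate, frob_mul_right, frob_mul_left, Matrix.mul_assoc]

lemma exp_skew_contr_transpose {m : Type*} [Fintype m] [DecidableEq m] {K : Matrix m m ℝ}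
    (hK : Kᵀ = -K) (t : ℝ) : Contr (NormedSpace.exp (t • K))ᵀ :=
  (contr_of_transpose_mul_self (exp_skew_transpose_mul hK t)).transpose

lemma frob_rotate_rotate {K : Matrix (Fin p) (Fin p) ℝ} {M : Matrix (Fin q) (Fin q) ℝ}
    (hK : Kᵀ = -K) (hM : Mᵀ = -M) (A V : Matrix (Fin p) (Fin q) ℝ) (t : ℝ) :
    frob (rotate K M t A) (rotate K M t V) = frob A V := by
  have hM' : (-M)ᵀ = -(-M) := by rw [Matrix.transpose_neg, hM]
  have h1 := exp_skew_transpose_mul hK t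
  have h2 := mul_eq_one_comm.1 (exp_skew_transpose_mul hM' t)
  rw [frob_rotate, rotate]
  have : (NormedSpace.exp (t • K))ᵀ * (NormedSpace.exp (t • K) * V * NormedSpace.exp (t • -M)) *
      (NormedSpace.exp (t • -M))ᵀ = ((NormedSpace.exp (t • K))ᵀ * NormedSpace.exp (t • K)) * V *
      (NormedSpace.exp (t • -M) * (NormedSpace.exp (t • -M))ᵀ) := by
    simp only [Matrix.mul_assoc]
  rw [this, h1, h2, Matrix.one_mul, Matrix.mul_one]

/-- Test V between the vectors e_i + ε e_k, whose squared norms are 2. In `frob_high_le` this bounds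
off-diagonal entries by the diagonal deficits. -/
lemma Contr.symm_entry_le (hpq : p ≤ q) {V : Matrix (Fin p) (Fin q) ℝ} (hV : Contr V)
    {i k : Fin p} (hik : i ≠ k) {ε : ℝ} (hε : ε ^ 2 = 1) :
    ε * (V i (colL hpq k) + V k (colL hpq i)) ≤
      (1 - V i (colL hpq i)) + (1 - V k (colL hpq k)) := by
  have hik' : colL hpq i ≠ colL hpq k := fun h => hik (Fin.castLE_injective hpq h)
  set x : Fin q → ℝ := Pi.single (colL hpq i) 1 + ε • Pi.single (colL hpq k) 1
  set y : Fin p → ℝ := Pi.single i 1 + ε • Pi.single k 1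
  have hx : x ⬝ᵥ x = 2 := by
    simp [x, dotProduct_add, hik', hik'.symm]
    nlinarith
  have hy : y ⬝ᵥ y = 2 := by
    simp [y, dotProduct_add, hik, hik.symm]
    nlinarith
  have h1 := dotProduct_sq_le y (V *ᵥ x)
  have h2 := hV x
  rw [hy] at h1
  rw [hx] at h2
  have h3 : y ⬝ᵥ (V *ᵥ x) = V i (colL hpq i) + V k (colL hpq k)
      + ε * (V i (colL hpq k) + V k (colL hpq i)) := by
    simp [x, y, add_dotProduct, Matrix.mulVec_add, Matrix.mulVec_smul, Matrix.col]
    linear_combination V k (colL hpq k) * hε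
  have h4 : y ⬝ᵥ (V *ᵥ x) ≤ 2 := by nlinarith
  linarith

lemma entryHigh_symm (s t x y : ℝ) : entryHigh t s y x = entryHigh s t x y := by
  unfold entryHigh
  simp only [and_comm, add_comm]

/-- Small symmetric perturbations of the large singular values do not change the matrix at which
the dual norm is attained. -/
lemma frob_high_le {m c t : ℝ} (hm : ∀ i, 1 ≤ σ i → m ≤ shrink (σ i))
    {v : Matrix (Fin p) (Fin q) ℝ} (hc : ∀ i j, |highPart hpq σ v i j| ≤ c)
    (ht : |t| * c * p ≤ m) {V : Matrix (Fin p) (Fin q) ℝ} (hV : Contr V) :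
    frob ((diagRect q fun i => shrink (σ i)) + t • highPart hpq σ v) V ≤
      frob ((diagRect q fun i => shrink (σ i)) + t • highPart hpq σ v)
        (diagRect q fun i => min (σ i) 1) := by
  -- The deficits d measure how far V is from attaining the pairing: the diagonal part loses at
  -- least m Σ h d, and the high part can gain at most |t| c p Σ h d.
  set d : Fin p → ℝ := fun i => 1 - V i (colL hpq i) with hd
  have hd0 : ∀ i, 0 ≤ d i := fun i => sub_nonneg.2 (hV.entry_le _ _)
  set h : Fin p → ℝ := fun i => if 1 ≤ σ i then 1 else 0 with hh
  have hh0 : ∀ i, 0 ≤ h i := fun i => by simp only [hh]; split_ifs <;> norm_num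
  have hh1 : ∀ i, h i ≤ 1 := fun i => by simp only [hh]; split_ifs <;> norm_num
  rw [← sub_nonneg, ← frob_sub_right, frob_add_left, frob_smul_left]
  have e1 : frob (diagRect q fun i => shrink (σ i)) ((diagRect q fun i => min (σ i) 1) - V) =
      ∑ i, shrink (σ i) * d i := by
    rw [frob_diagRect hpq]
    refine Finset.sum_congr rfl fun i _ => ?_
    rw [Matrix.sub_apply, diagRect_colL, if_pos rfl, mul_sub, shrink_mul_min, hd]
    ring
  set C : Fin p → Fin p → ℝ :=
    fun i k => entryHigh (σ i) (σ k) (v i (colL hpq k)) (v k (colL hpq i)) with hC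
  set G : Fin p → Fin p → ℝ := fun i k => (if i = k then 1 else 0) - V i (colL hpq k) with hG
  have e2 : frob (highPart hpq σ v) ((diagRect q fun i => min (σ i) 1) - V) =
      ∑ i, ∑ k, C i k * G i k := by
    refine Finset.sum_congr rfl fun i _ => ?_
    rw [sum_colL hpq]
    · refine Finset.sum_congr rfl fun k _ => ?_
      simp only [highPart, Matrix.of_apply, extend_colL, extendRows_colL, Matrix.sub_apply,
        diagRect_colL, hC, hG]
      by_cases h1 : 1 ≤ σ i
      · rw [min_eq_right h1]
      · rw [entryHigh, if_neg (fun h => h1 h.1), zero_mul, zero_mul]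
    · intro j hj
      have : highPart hpq σ v i j = 0 := by
        simp only [highPart, Matrix.of_apply, entryHigh, extend_of_le σ hj]
        rw [if_neg (by norm_num)]
      rw [this, zero_mul]
  have hCs : ∀ i k, C k i = C i k := fun i k => entryHigh_symm _ _ _ _
  -- C is symmetric, so only the symmetric part of G counts, and that part is bounded by the
  -- deficits.
  have e3 : ∑ i, ∑ k, C i k * G i k = ∑ i, ∑ k, C i k * ((G i k + G k i) / 2) := by
    rw [← sub_eq_zero, ← Finset.sum_sub_distrib]
    simp only [← Finset.sum_sub_distrib]
    refine sum_eq_zero_of_antisymm fun i k => ?_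
    rw [hCs]; ring
  have hGb : ∀ i k, |(G i k + G k i) / 2| ≤ (d i + d k) / 2 := by
    intro i k
    by_cases hik : i = k
    · subst hik
      simp only [hG, if_true]
      rw [abs_of_nonneg (by have := hd0 i; simp only [hd] at this; linarith)]
    · have h1 := hV.symm_entry_le hpq hik (ε := 1) (by norm_num)
      have h2 := hV.symm_entry_le hpq hik (ε := -1) (by norm_num)
      simp only [hG, if_neg hik, if_neg (Ne.symm hik), hd]
      rw [abs_le]
      constructor <;> linarith
  have hCb : ∀ i k, |C i k| ≤ c * (h i * h k) := by
    intro i k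
    by_cases hik : 1 ≤ σ i ∧ 1 ≤ σ k
    · simp only [hh, if_pos hik.1, if_pos hik.2, mul_one]
      have := hc i (colL hpq k)
      simpa [highPart] using this
    · have h0 : C i k = 0 := by simp only [hC, entryHigh, if_neg hik]
      have h1 : h i * h k = 0 := by
        simp only [hh]
        rcases not_and_or.1 hik with h' | h' <;> simp [h']
      rw [h0, h1, abs_zero, mul_zero]
  -- The sign of c is undetermined only when there are no entries.
  have hc0 : 0 ≤ c ∨ p = 0 := by
    rcases Nat.eq_zero_or_pos p with h' | h'
    · exact Or.inr h'
    · exact Or.inl ((abs_nonneg _).trans (hc ⟨0, h'⟩ ⟨0, h'.trans_le hpq⟩))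
  rw [e1, e2, e3]
  rcases hc0 with hc0 | rfl
  swap
  · simp
  have hsum : -(|t| * c * p * ∑ i, h i * d i) ≤
      t * ∑ i, ∑ k, C i k * ((G i k + G k i) / 2) := by
    have hterm : ∀ i k, -(|t| * c * ((h i * d i + h k * d k) / 2)) ≤
        t * (C i k * ((G i k + G k i) / 2)) := by
      intro i k
      refine neg_le_of_abs_le ?_
      rw [abs_mul, abs_mul, mul_assoc]
      refine mul_le_mul_of_nonneg_left ?_ (abs_nonneg t)
      refine (mul_le_mul (hCb i k) (hGb i k) (abs_nonneg _) (by
        have := mul_nonneg (hh0 i) (hh0 k); positivity)).trans ?_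
      rw [mul_assoc]
      refine mul_le_mul_of_nonneg_left ?_ hc0
      have h1 : h i * h k * d i ≤ h i * d i := by
        have := mul_le_mul_of_nonneg_left (hh1 k) (mul_nonneg (hh0 i) (hd0 i))
        linarith
      have h2 : h i * h k * d k ≤ h k * d k := by
        have := mul_le_mul_of_nonneg_left (hh1 i) (mul_nonneg (hh0 k) (hd0 k))
        linarith
      linarith
    rw [Finset.mul_sum]
    simp only [Finset.mul_sum]
    refine le_trans (le_of_eq ?_)
      (Finset.sum_le_sum fun i _ => Finset.sum_le_sum fun k _ => hterm i k)
    have : ∀ i : Fin p, ∑ k : Fin p, -(|t| * c * ((h i * d i + h k * d k) / 2)) =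
        -(|t| * c / 2) * (p * (h i * d i) + ∑ k, h k * d k) := by
      intro i
      rw [mul_add, Finset.mul_sum]
      have : ∀ k : Fin p, -(|t| * c * ((h i * d i + h k * d k) / 2)) =
          -(|t| * c / 2) * (h i * d i) + -(|t| * c / 2) * (h k * d k) := fun k => by ring
      simp only [this, Finset.sum_add_distrib, Finset.sum_const, Finset.card_univ, Fintype.card_fin,
        nsmul_eq_mul]
      ring
    simp only [this, mul_add, Finset.sum_add_distrib, Finset.sum_const, Finset.card_univ,
      Fintype.card_fin, nsmul_eq_mul, ← Finset.mul_sum]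
    ring
  have hmain : m * ∑ i, h i * d i ≤ ∑ i, shrink (σ i) * d i := by
    rw [Finset.mul_sum]
    refine Finset.sum_le_sum fun i _ => ?_
    rw [← mul_assoc]
    refine mul_le_mul_of_nonneg_right ?_ (hd0 i)
    simp only [hh]
    split_ifs with h1
    · simpa using hm i h1
    · simpa using shrink_nonneg _
  have hS : 0 ≤ ∑ i, h i * d i := Finset.sum_nonneg fun i _ => mul_nonneg (hh0 i) (hd0 i)
  have := mul_le_mul_of_nonneg_right ht hS
  linarith

end ProxDerivative

section ProxDerivative

variable {p q : ℕ} (hpq : p ≤ q) {σ : Fin p → ℝ}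

lemma diagRect_add (σ τ : Fin p → ℝ) :
    diagRect q σ + diagRect q τ = diagRect q (fun i => σ i + τ i) := by
  ext i j
  simp only [diagRect, Matrix.add_apply, Matrix.of_apply]
  split_ifs <;> simp

lemma shrink_add_min (t : ℝ) : shrink t + min t 1 = t := by
  have := sub_shrink t; linarith

lemma frob_diagRect_lowPart (hpq : p ≤ q) (v : Matrix (Fin p) (Fin q) ℝ) :
    frob (diagRect q fun i => shrink (σ i)) (lowPart σ v) = 0 := by
  rw [frob_diagRect hpq]
  refine Finset.sum_eq_zero fun i _ => ?_
  simp only [lowPart, Matrix.of_apply, extend_colL, entryLow]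
  split_ifs with h
  · rw [shrink_of_le h.1.le, zero_mul]
  · rw [mul_zero]

/-- Along the rotated lines the proximal mapping is explicit. -/
lemma subG_curve (hσ : ∀ i, 0 ≤ σ i) (h1 : ∀ i, σ i ≠ 1) (v : Matrix (Fin p) (Fin q) ℝ) :
    ∀ᶠ t : ℝ in 𝓝 0, SubG nuclearNorm
      (ofMat (rotate (genLeft hpq σ v) (genRight σ v) t
        ((diagRect q fun i => shrink (σ i)) + t • highPart hpq σ v)))
      (ofMat (rotate (genLeft hpq σ v) (genRight σ v) t
        ((diagRect q fun i => min (σ i) 1) + t • lowPart σ v))) := by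
  -- The gap m above the threshold is positive because no singular value equals 1.
  obtain ⟨m, hm0, hm⟩ : ∃ m : ℝ, 0 < m ∧ ∀ i, 1 ≤ σ i → m ≤ shrink (σ i) := by
    have h2 : ∀ᶠ m : ℝ in 𝓝[>] 0, ∀ i, 1 ≤ σ i → m ≤ shrink (σ i) := by
      refine eventually_all.2 fun i => ?_
      by_cases hi : 1 ≤ σ i
      · have h3 : 0 < shrink (σ i) := by
          rw [shrink_of_ge hi, sub_pos]
          exact lt_of_le_of_ne hi (Ne.symm (h1 i))
        filter_upwards [Ioo_mem_nhdsGT h3] with m hm _ using hm.2.le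
      · exact Eventually.of_forall fun m h => absurd h hi
    obtain ⟨m, h3, h4⟩ := (h2.and self_mem_nhdsWithin).exists
    exact ⟨m, h4, h3⟩
  obtain ⟨c, hc⟩ : ∃ c : ℝ, ∀ i j, |highPart hpq σ v i j| ≤ c :=
    (eventually_all.2 fun i => eventually_all.2 fun j =>
      eventually_ge_atTop (|highPart hpq σ v i j|)).exists
  have hc1 : ∀ᶠ t : ℝ in 𝓝 0, 16 * (t ^ 2 * frob (lowScaled σ v) (lowScaled σ v)) < 1 := by
    have : Continuous fun t : ℝ => 16 * (t ^ 2 * frob (lowScaled σ v) (lowScaled σ v)) := by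
      fun_prop
    exact (this.tendsto 0).eventually_lt_const (by simp)
  have hc2 : ∀ᶠ t : ℝ in 𝓝 0, |t| * c * p < m := by
    have : Continuous fun t : ℝ => |t| * c * p := by fun_prop
    exact (this.tendsto 0).eventually_lt_const (by simpa using hm0)
  filter_upwards [hc1, hc2] with t ht1 ht2
  have hKs := genLeft_transpose hpq σ v
  have hMs := genRight_transpose (q := q) σ v
  have hMs' : (-genRight σ v)ᵀ = -(-genRight σ v) := by rw [Matrix.transpose_neg, hMs]
  have hV : Contr (diagRect q fun i => min (σ i) 1) := by
    refine contr_diagRect hpq fun i => ?_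
    rw [abs_of_nonneg (le_min (hσ i) zero_le_one)]
    exact min_le_right _ _
  have hcontr := contr_curve hpq (u := v) hV ht1.le
  rw [sandwich, sandwich_lowScaled hpq hσ] at hcontr
  rw [subG_nuclearNorm_iff hpq, mat_ofMat]
  refine ⟨hcontr, ?_⟩
  rw [inner_eq_frob, mat_ofMat, mat_ofMat]
  have hle : ∀ Q : Matrix (Fin p) (Fin q) ℝ, frob Q (rotate (genLeft hpq σ v) (genRight σ v) t
      ((diagRect q fun i => min (σ i) 1) + t • lowPart σ v)) ≤ nuclearNorm (ofMat Q) := fun Q => by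
    have := frob_le_nuclearNorm hpq (ofMat Q) hcontr
    rwa [mat_ofMat] at this
  refine le_antisymm ?_ ?_
  · exact hle _
  -- Rotating the competitor W back reduces optimality to `frob_high_le` in the fixed frame.
  · refine nuclearNorm_le_of_forall hpq _ fun W hW => ?_
    rw [mat_ofMat, frob_rotate_rotate hKs hMs, frob_rotate, frob_add_right _ (diagRect q _),
      frob_smul_right, frob_add_left _ _ (lowPart σ v), frob_smul_left, frob_diagRect_lowPart hpq,
      frob_highPart_lowPart, mul_zero, add_zero, mul_zero, add_zero]
    exact frob_high_le hpq hm hc ht2.le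
      (((exp_skew_contr_transpose hKs t).mul hW).mul (exp_skew_contr_transpose hMs' t))

lemma lipschitz_prox_nuc (hpq : p ≤ q) : LipschitzWith 1 (prox (nuc p q)) :=
  (proxSolvable_nuclearNorm hpq).lipschitz

/-- For a Lipschitz mapping in finite dimension, line derivatives depending linearly on the
direction suffice. The line A + tD is tangent to the curve P_t + V_t, on which the proximal point is
explicitly P_t, and the Lipschitz bound carries the o(t) gap over to the proximal points. -/
theorem hasFDerivAt_prox_frame (hσ : ∀ i, 0 ≤ σ i) (h1 : ∀ i, σ i ≠ 1) :
    HasFDerivAt (prox (nuc p q)) (frameJacL hpq σ) (ofMat (diagRect q σ)) := by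
  have hL := lipschitz_prox_nuc hpq
  refine hL.hasFDerivAt_of_hasLineDerivAt_of_closure (s := univ) (by simp) fun D _ => ?_
  set v := mat D with hv
  set K := genLeft hpq σ v
  set M := genRight σ v
  set A := diagRect q σ with hA
  set Pt : ℝ → Matrix (Fin p) (Fin q) ℝ := fun t =>
    rotate K M t ((diagRect q fun i => shrink (σ i)) + t • highPart hpq σ v) with hPt
  set Vt : ℝ → Matrix (Fin p) (Fin q) ℝ := fun t =>
    rotate K M t ((diagRect q fun i => min (σ i) 1) + t • lowPart σ v) with hVt
  have dP : HasDerivAt (fun t => ofMat (Pt t)) (frameJacL hpq σ D) 0 := by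
    have := ((hasEntryDeriv_line (diagRect q fun i => shrink (σ i))
      (highPart hpq σ v) 0).rotate K M).ofMat
    rw [rotate_zero, zero_smul, add_zero, frame_prox hpq v hσ] at this
    exact this
  have dV : HasDerivAt (fun t => ofMat (Vt t)) (D - frameJacL hpq σ D) 0 := by
    have := ((hasEntryDeriv_line (diagRect q fun i => min (σ i) 1)
      (lowPart σ v) 0).rotate K M).ofMat
    rw [rotate_zero, zero_smul, add_zero, frame_polar hpq v hσ] at this
    exact this
  have hev : ∀ᶠ t : ℝ in 𝓝 0,
      prox (nuc p q) (ofMat (Pt t) + ofMat (Vt t)) = ofMat (Pt t) := by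
    filter_upwards [subG_curve hpq hσ h1 v] with t ht
    refine SubG.prox_eq (g := nuclearNorm) ?_
    rw [add_sub_cancel_left]
    exact ht
  have dcomp : HasDerivAt (fun t => prox (nuc p q) (ofMat (Pt t) + ofMat (Vt t)))
      (frameJacL hpq σ D) 0 := dP.congr_of_eventuallyEq hev
  have hB0 : ofMat (Pt 0) + ofMat (Vt 0) = ofMat A := by
    apply mat_injective
    rw [mat_add, mat_ofMat, mat_ofMat, mat_ofMat, hPt, hVt]
    simp only [rotate_zero, zero_smul, add_zero, diagRect_add, shrink_add_min]
    rfl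
  have dr : HasDerivAt (fun t : ℝ => ofMat A + t • D - (ofMat (Pt t) + ofMat (Vt t))) 0 0 := by
    have h2 : HasDerivAt (fun t : ℝ => ofMat A + t • D) D 0 := by
      simpa using ((hasDerivAt_id (0 : ℝ)).smul_const D).const_add (ofMat A)
    have := h2.sub (dP.add dV)
    rw [add_sub_cancel, sub_self] at this
    exact this
  have de : HasDerivAt (fun t : ℝ => prox (nuc p q) (ofMat A + t • D) -
      prox (nuc p q) (ofMat (Pt t) + ofMat (Vt t))) 0 0 := by
    rw [hasDerivAt_iff_isLittleO] at dr ⊢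
    refine Asymptotics.IsBigO.trans_isLittleO (Asymptotics.isBigO_of_le _ fun t => ?_) dr
    simp only [zero_smul, hB0, smul_zero, add_zero, sub_self, sub_zero]
    have := hL.dist_le_mul (ofMat A + t • D) (ofMat (Pt t) + ofMat (Vt t))
    rwa [NNReal.coe_one, one_mul, dist_eq_norm, dist_eq_norm] at this
  have := de.add dcomp
  rw [zero_add] at this
  refine HasDerivAt.congr_of_eventuallyEq this (Eventually.of_forall fun t => ?_)
  simp

end ProxDerivative

/-! ### Passage to a general frame; the explicit operator is a limiting Jacobian. -/

section Rotation

variable {p q : ℕ}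

/-- Multiplication by orthogonal matrices from both sides, as an isometry of the space of
matrices. -/
def rotIso {R : Matrix (Fin p) (Fin p) ℝ} {S : Matrix (Fin q) (Fin q) ℝ}
    (hR : R ∈ Matrix.orthogonalGroup (Fin p) ℝ) (hS : S ∈ Matrix.orthogonalGroup (Fin q) ℝ) :
    MatSpace p q ≃ₗᵢ[ℝ] MatSpace p q where
  toFun X := ofMat (R * mat X * Sᵀ)
  invFun X := ofMat (Rᵀ * mat X * S)
  map_add' X Y := by
    apply mat_injective
    simp only [mat_ofMat, mat_add, Matrix.mul_add, Matrix.add_mul]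
  map_smul' c X := by
    apply mat_injective
    simp only [mat_ofMat, mat_smul, Matrix.mul_smul, Matrix.smul_mul, RingHom.id_apply]
  left_inv X := by
    apply mat_injective
    have : Rᵀ * (R * mat X * Sᵀ) * S = (Rᵀ * R) * mat X * (Sᵀ * S) := by
      simp only [Matrix.mul_assoc]
    simp only [mat_ofMat]
    rw [this, orth_transpose_mul hR, orth_transpose_mul hS, Matrix.one_mul, Matrix.mul_one]
  right_inv X := by
    apply mat_injective
    have : R * (Rᵀ * mat X * S) * Sᵀ = (R * Rᵀ) * mat X * (S * Sᵀ) := by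
      simp only [Matrix.mul_assoc]
    simp only [mat_ofMat]
    rw [this, orth_mul_transpose hR, orth_mul_transpose hS, Matrix.one_mul, Matrix.mul_one]
  norm_map' X := by
    have : ⟪ofMat (R * mat X * Sᵀ), ofMat (R * mat X * Sᵀ)⟫_ℝ = ⟪X, X⟫_ℝ := by
      have h : Rᵀ * (R * mat X * Sᵀ) * S = (Rᵀ * R) * mat X * (Sᵀ * S) := by
        simp only [Matrix.mul_assoc]
      rw [inner_eq_frob, inner_eq_frob, mat_ofMat, frob_conj, h, orth_transpose_mul hR,
        orth_transpose_mul hS, Matrix.one_mul, Matrix.mul_one]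
    rw [real_inner_self_eq_norm_sq, real_inner_self_eq_norm_sq] at this
    exact (sq_eq_sq₀ (norm_nonneg _) (norm_nonneg _)).1 this

variable {R : Matrix (Fin p) (Fin p) ℝ} {S : Matrix (Fin q) (Fin q) ℝ}
    (hR : R ∈ Matrix.orthogonalGroup (Fin p) ℝ) (hS : S ∈ Matrix.orthogonalGroup (Fin q) ℝ)

lemma mat_rotIso (X : MatSpace p q) : mat (rotIso hR hS X) = R * mat X * Sᵀ := rfl

lemma mat_rotIso_symm (X : MatSpace p q) : mat ((rotIso hR hS).symm X) = Rᵀ * mat X * S := rfl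

lemma nuclearNorm_rotIso (hpq : p ≤ q) (X : MatSpace p q) :
    nuclearNorm (rotIso hR hS X) = nuclearNorm X := by
  refine le_antisymm ?_ ?_ <;> refine nuclearNorm_le_of_forall hpq _ fun V hV => ?_
  · rw [mat_rotIso, frob_conj]
    exact frob_le_nuclearNorm hpq X (((contr_orth_transpose hR).mul hV).mul (contr_orth hS))
  · have h := frob_le_nuclearNorm hpq (rotIso hR hS X)
      (((contr_orth hR).mul hV).mul (contr_orth_transpose hS))
    have h' : Rᵀ * (R * V * Sᵀ) * S = (Rᵀ * R) * V * (Sᵀ * S) := by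
      simp only [Matrix.mul_assoc]
    rwa [mat_rotIso, frob_conj, h', orth_transpose_mul hR, orth_transpose_mul hS, Matrix.one_mul,
      Matrix.mul_one] at h

lemma prox_rotIso (hpq : p ≤ q) (B : MatSpace p q) :
    prox (nuc p q) (rotIso hR hS B) = rotIso hR hS (prox (nuc p q) B) := by
  have h := ((proxSolvable_nuclearNorm hpq).subG_prox B).map_iso
    (T := rotIso hR hS) (nuclearNorm_rotIso hR hS hpq)
  rw [map_sub] at h
  exact h.prox_eq

/-- The explicit Jacobian of a singular value decomposition. -/
def svdJac (hpq : p ≤ q) (σ : Fin p → ℝ) : MatSpace p q →L[ℝ] MatSpace p q :=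
  conjIso (rotIso hR hS) (frameJacL hpq σ)

lemma mat_svdJac (hpq : p ≤ q) (σ : Fin p → ℝ) (D : MatSpace p q) :
    mat (svdJac hR hS hpq σ D) = R * frameJac hpq σ (Rᵀ * mat D * S) * Sᵀ := rfl

lemma hasFDerivAt_prox_svd (hpq : p ≤ q) {σ : Fin p → ℝ} (hσ : ∀ i, 0 ≤ σ i)
    (h1 : ∀ i, σ i ≠ 1) :
    HasFDerivAt (prox (nuc p q)) (svdJac hR hS hpq σ)
      (rotIso hR hS (ofMat (diagRect q σ))) := by
  set T := rotIso hR hS with hT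
  have e : prox (nuc p q) = fun B => T (prox (nuc p q) (T.symm B)) := by
    funext B
    rw [hT, ← prox_rotIso hR hS hpq, LinearIsometryEquiv.apply_symm_apply]
  have h := hasFDerivAt_prox_frame hpq hσ h1
  rw [← T.symm_apply_apply (ofMat (diagRect q σ))] at h
  have h2 := h.comp (T (ofMat (diagRect q σ))) (T.symm : MatSpace p q →L[ℝ] MatSpace p q).hasFDerivAt
  have h3 := (T : MatSpace p q →L[ℝ] MatSpace p q).hasFDerivAt.comp (T (ofMat (diagRect q σ))) h2
  rw [e]
  exact h3

/-- In finite dimension the operators embed as a closed subspace into the functions with the product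
topology, so pointwise convergence suffices. -/
lemma tendsto_clm_of_forall {E : Type*} [NormedAddCommGroup E] [NormedSpace ℝ E]
    [FiniteDimensional ℝ E] {W : ℕ → E →L[ℝ] E} {W₀ : E →L[ℝ] E}
    (h : ∀ D, Tendsto (fun k => W k D) atTop (𝓝 (W₀ D))) : Tendsto W atTop (𝓝 W₀) := by
  let Φ : (E →L[ℝ] E) →ₗ[ℝ] (E → E) :=
    { toFun := fun V => V, map_add' := fun _ _ => rfl, map_smul' := fun _ _ => rfl }
  have hΦ : LinearMap.ker Φ = ⊥ := by
    rw [LinearMap.ker_eq_bot]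
    intro V V' hVV
    exact DFunLike.coe_injective hVV
  rw [(LinearMap.isClosedEmbedding_of_injective hΦ).isEmbedding.tendsto_nhds_iff]
  exact tendsto_pi_nhds.2 h

/-- The perturbation which moves a singular value away from the threshold. -/
def pert (δ s : ℝ) : ℝ := s + if s = 1 then δ else 0

lemma coefSkew_tendsto {s t : ℝ} (hs : 0 ≤ s) (ht : 0 ≤ t) {d : ℕ → ℝ} (hd : ∀ k, 0 < d k)
    (hl : Tendsto d atTop (𝓝 0)) :
    Tendsto (fun k => coefSkew (pert (d k) s) (pert (d k) t)) atTop (𝓝 (coefSkew s t)) := by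
  have hp : ∀ s, Tendsto (fun k => pert (d k) s) atTop (𝓝 s) := by
    intro s
    unfold pert
    split_ifs
    · simpa using hl.const_add s
    · simp
  have hsh : Continuous shrink := by unfold shrink; fun_prop
  have hpos : ∀ k s, 0 ≤ s → 0 ≤ pert (d k) s := by
    intro k s h; unfold pert; split_ifs <;> linarith [hd k]
  have hform : ∀ s t, 0 ≤ s → 0 ≤ t → coefSkew s t =
      if 1 ≤ s ∨ 1 ≤ t then (shrink s + shrink t) / (s + t) else 0 := by
    intro s t h1 h2
    unfold coefSkew
    by_cases h : 1 < s ∨ 1 < t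
    · rw [if_pos h, if_pos (by grind)]
    · rw [if_neg h, shrink_of_le (by grind), shrink_of_le (by grind)]; simp
  simp only [hform s t hs ht, fun k => hform _ _ (hpos k s hs) (hpos k t ht)]
  have hge : ∀ k s, 1 ≤ pert (d k) s ↔ 1 ≤ s := by
    intro k s; unfold pert; split_ifs with h
    · rw [h]; constructor <;> intro <;> linarith [hd k]
    · simp
  simp only [hge]
  split_ifs with h
  · refine Tendsto.div ?_ ((hp s).add (hp t)) (by rcases h with h | h <;> linarith)
    exact ((hsh.tendsto s).comp (hp s)).add ((hsh.tendsto t).comp (hp t))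
  · exact tendsto_const_nhds

/-- An upward perturbation never changes whether `1 ≤ s`, and on each block of that classification
the coefficient is a continuous formula. A downward one would give 0 instead of 1 between two
singular values equal to 1. -/
lemma coefSym_tendsto {s t : ℝ} {d : ℕ → ℝ} (hd : ∀ k, 0 < d k) (hl : Tendsto d atTop (𝓝 0)) :
    Tendsto (fun k => coefSym (pert (d k) s) (pert (d k) t)) atTop (𝓝 (coefSym s t)) := by
  have hp : ∀ s, Tendsto (fun k => pert (d k) s) atTop (𝓝 s) := by
    intro s
    unfold pert
    split_ifs
    · simpa using hl.const_add s
    · simp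
  have hge : ∀ k s, 1 ≤ pert (d k) s ↔ 1 ≤ s := by
    intro k s; unfold pert; split_ifs with h
    · rw [h]; constructor <;> intro <;> linarith [hd k]
    · simp
  have hlt : ∀ k s, pert (d k) s < 1 ↔ s < 1 := fun k s => by
    rw [← not_le, ← not_le, hge]
  rcases le_or_gt 1 s with h1 | h1 <;> rcases le_or_gt 1 t with h2 | h2
  · rw [(high_high h1 h2).2.2.1]
    simp only [fun k => (high_high ((hge k s).2 h1) ((hge k t).2 h2)).2.2.1]
    exact tendsto_const_nhds
  · rw [(high_low h1 h2).2.2.1]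
    simp only [fun k => (high_low ((hge k s).2 h1) ((hlt k t).2 h2)).2.2.1]
    exact ((hp s).sub_const 1).div ((hp s).sub (hp t)) (by intro h; linarith)
  · rw [coefSym_comm, (high_low h2 h1).2.2.1]
    simp only [fun k => (coefSym_comm _ _).trans
      (high_low ((hge k t).2 h2) ((hlt k s).2 h1)).2.2.1]
    exact ((hp t).sub_const 1).div ((hp t).sub (hp s)) (by intro h; linarith)
  · rw [(low_low h1 h2).2.2.1]
    simp only [fun k => (low_low ((hlt k s).2 h1) ((hlt k t).2 h2)).2.2.1]
    exact tendsto_const_nhds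

/-- The singular vectors stay fixed and only the singular values equal to 1 move, to 1 + 1/(k + 1).
The derivative formula does not require the perturbed values to be sorted. -/
theorem svdJac_mem_limJacobian (hpq : p ≤ q) {σ : Fin p → ℝ} (hσ : ∀ i, 0 ≤ σ i) :
    svdJac hR hS hpq σ ∈ limJacobian (prox (nuc p q)) (rotIso hR hS (ofMat (diagRect q σ))) := by
  set d : ℕ → ℝ := fun k => 1 / ((k : ℝ) + 1) with hdef
  have hd : ∀ k, 0 < d k := fun k => by positivity
  have hl : Tendsto d atTop (𝓝 0) := tendsto_one_div_add_atTop_nhds_zero_nat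
  set σk : ℕ → Fin p → ℝ := fun k i => pert (d k) (σ i) with hσk
  have h0 : ∀ k i, 0 ≤ σk k i := by
    intro k i; simp only [hσk, pert]; split_ifs <;> linarith [hd k, hσ i]
  have h1 : ∀ k i, σk k i ≠ 1 := by
    intro k i
    simp only [hσk, pert]
    split_ifs with h
    · rw [h]; linarith [hd k]
    · simpa using h
  have hF := fun k => hasFDerivAt_prox_svd hR hS hpq (h0 k) (h1 k)
  have hext : ∀ k (j : Fin q), extend q (σk k) j = pert (d k) (extend q σ j) := by
    intro k j
    simp only [extend, hσk]
    split_ifs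
    · rfl
    · simp [pert]
  refine ⟨fun k => rotIso hR hS (ofMat (diagRect q (σk k))), fun k => (hF k).differentiableAt,
    ?_, ?_⟩
  · refine ((rotIso hR hS).continuous.tendsto _).comp ((continuous_ofMat.tendsto _).comp ?_)
    refine tendsto_pi_nhds.2 fun i => tendsto_pi_nhds.2 fun j => ?_
    simp only [diagRect, Matrix.of_apply]
    split_ifs
    · simp only [hσk, pert]
      split_ifs
      · simpa using hl.const_add (σ i)
      · simp
    · exact tendsto_const_nhds
  · simp only [fun k => (hF k).fderiv]
    refine tendsto_clm_of_forall fun D => ?_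
    refine ((rotIso hR hS).continuous.tendsto _).comp ((continuous_ofMat.tendsto _).comp ?_)
    refine tendsto_pi_nhds.2 fun i => tendsto_pi_nhds.2 fun j => ?_
    simp only [frameJac, Matrix.of_apply, entryJac, hext]
    exact ((coefSym_tendsto hd hl).mul_const _).add
      ((coefSkew_tendsto (hσ i) (extend_nonneg hσ j) hd hl).mul_const _)

end Rotation

/-! ### Domination of the generalized Jacobian by a single operator. -/

section Domination

variable {E : Type*} [NormedAddCommGroup E] [InnerProductSpace ℝ E] {g : E → ℝ} {X U : E}
  {W : E →L[ℝ] E}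

/-- The two one-sided expansions at two points of the graph of the subdifferential. -/
lemma two_sided_expansion {η δ : ℝ} (H : ∀ P V P', SubG g P V → ‖P - X‖ < δ → ‖V - U‖ < δ →
    ‖P' - X‖ < δ → ∀ v, ‖v‖ ≤ δ →
    ⟪P' - P, v - W v⟫_ℝ - 1 / 2 * ⟪W v, v - W v⟫_ℝ - η * (‖v‖ ^ 2 + ‖P' - P‖ * ‖v‖)
      ≤ g P' - g P - ⟪V, P' - P⟫_ℝ) {P V P' V' v : E} (h : SubG g P V) (h' : SubG g P' V')
    (hP : ‖P - X‖ < δ) (hV : ‖V - U‖ < δ) (hP' : ‖P' - X‖ < δ) (hV' : ‖V' - U‖ < δ)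
    (hv : ‖v‖ ≤ δ) :
    2 * ⟪P' - P, v - W v⟫_ℝ - ⟪W v, v - W v⟫_ℝ - 2 * η * (‖v‖ ^ 2 + ‖P' - P‖ * ‖v‖)
      ≤ ⟪P' - P, V' - V⟫_ℝ := by
  have h1 := H P V P' h hP hV hP' v hv
  -- The opposite step -v at the second point makes the linear terms equal, so that they add up as
  -- the quadratic ones do.
  have h2 := H P' V' P h' hP' hV' hP (-v) (by rwa [norm_neg])
  have e1 : -v - W (-v) = -(v - W v) := by rw [map_neg]; abel
  rw [e1, map_neg, inner_neg_neg, ← neg_sub P' P, inner_neg_neg, norm_neg, norm_neg,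
    inner_neg_right] at h2
  rw [inner_sub_right (P' - P) V' V, real_inner_comm V' (P' - P), real_inner_comm V (P' - P)]
  linarith

/-- The two-sided expansion is applied at the graph points over A_k and A_k + tD with step tD' and
divided by t²; then t → 0, k → ∞ and η → 0, in this order. -/
lemma fderiv_prox_bound [FiniteDimensional ℝ E] (hg : ProxSolvable g) (hXU : SubG g X U)
    (hW : SecondOrderLower g X U W) {W' : E →L[ℝ] E}
    (hW' : W' ∈ limJacobian (prox fun x => (g x : EReal)) (X + U)) (D D' : E) :
    2 * ⟪W' D, D'⟫_ℝ - ⟪W D', D'⟫_ℝ ≤ ⟪W' D, D⟫_ℝ := by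
  set f := prox fun x => (g x : EReal) with hf
  have hfc : Continuous f := hg.lipschitz.continuous
  have hf0 : f (X + U) = X := SubG.prox_eq (by rwa [add_sub_cancel_left])
  obtain ⟨A, hA, hAl, hAW⟩ := hW'
  have key : ∀ η : ℝ, 0 < η → 2 * ⟪W' D, D' - W D'⟫_ℝ - ⟪W D', D' - W D'⟫_ℝ
      - 2 * η * (‖D'‖ ^ 2 + ‖W' D‖ * ‖D'‖) ≤ ⟪W' D, D - W' D⟫_ℝ := by
    intro η hη
    obtain ⟨δ, hδ, H⟩ := hW η hη
    have hopen1 : ∀ᶠ B in 𝓝 (X + U), ‖f B - X‖ < δ := by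
      have : Continuous fun B => ‖f B - X‖ := by fun_prop
      exact (this.tendsto _).eventually_lt_const (by rw [hf0, sub_self, norm_zero]; exact hδ)
    have hopen2 : ∀ᶠ B in 𝓝 (X + U), ‖B - f B - U‖ < δ := by
      have : Continuous fun B => ‖B - f B - U‖ := by fun_prop
      exact (this.tendsto _).eventually_lt_const (by
        rw [hf0, add_sub_cancel_left, sub_self, norm_zero]; exact hδ)
    have hopen := (hopen1.and hopen2).eventually_nhds
    have hpt : ∀ᶠ k in atTop, 2 * ⟪fderiv ℝ f (A k) D, D' - W D'⟫_ℝ - ⟪W D', D' - W D'⟫_ℝ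
        - 2 * η * (‖D'‖ ^ 2 + ‖fderiv ℝ f (A k) D‖ * ‖D'‖) ≤
        ⟪fderiv ℝ f (A k) D, D - fderiv ℝ f (A k) D⟫_ℝ := by
      filter_upwards [hAl.eventually hopen] with k hk
      set B := A k with hB
      obtain ⟨hB1, hB2⟩ := hk.self_of_nhds
      have hline : Tendsto (fun t : ℝ => B + t • D) (𝓝[>] 0) (𝓝 B) := by
        have : Continuous (fun t : ℝ => B + t • D) := by fun_prop
        simpa using (this.tendsto 0).mono_left nhdsWithin_le_nhds
      have hq : Tendsto (fun t : ℝ => t⁻¹ • (f (B + t • D) - f B)) (𝓝[>] 0)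
          (𝓝 (fderiv ℝ f B D)) := by
        have := ((hA k).hasFDerivAt.hasLineDerivAt D).tendsto_slope_zero_right
        simpa using this
      have hsmall : ∀ᶠ t : ℝ in 𝓝[>] 0, ‖t • D'‖ < δ := by
        have : Continuous (fun t : ℝ => ‖t • D'‖) := by fun_prop
        exact ((this.tendsto 0).mono_left nhdsWithin_le_nhds).eventually_lt_const (by simpa using hδ)
      have hc : Continuous fun Y : E => 2 * ⟪Y, D' - W D'⟫_ℝ - ⟪W D', D' - W D'⟫_ℝ
          - 2 * η * (‖D'‖ ^ 2 + ‖Y‖ * ‖D'‖) := by fun_prop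
      have hc' : Continuous fun Y : E => ⟪Y, D - Y⟫_ℝ := by fun_prop
      refine le_of_tendsto_of_tendsto ((hc.tendsto _).comp hq) ((hc'.tendsto _).comp hq) ?_
      filter_upwards [hline.eventually hk, hsmall, self_mem_nhdsWithin] with t ht1 ht2 ht0
      have ht0' : (0 : ℝ) < t := ht0
      have h2 := two_sided_expansion H (hg.subG_prox B) (hg.subG_prox (B + t • D)) hB1 hB2
        ht1.1 ht1.2 ht2.le
      change 2 * ⟪f (B + t • D) - f B, _⟫_ℝ - _ - 2 * η * (_ + ‖f (B + t • D) - f B‖ * _) ≤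
        ⟪f (B + t • D) - f B, B + t • D - f (B + t • D) - (B - f B)⟫_ℝ at h2
      simp only [Function.comp]
      set Y := t⁻¹ • (f (B + t • D) - f B) with hY
      have hYt : f (B + t • D) - f B = t • Y := by rw [hY, smul_inv_smul₀ ht0'.ne']
      have e2 : B + t • D - f (B + t • D) - (B - f B) = t • (D - Y) := by
        rw [smul_sub, ← hYt]; abel
      rw [e2, hYt, map_smul, ← smul_sub, norm_smul, norm_smul, Real.norm_of_nonneg ht0'.le] at h2
      simp only [inner_smul_right, real_inner_smul_left] at h2
      have h3 : t ^ 2 * (2 * ⟪Y, D' - W D'⟫_ℝ - ⟪W D', D' - W D'⟫_ℝ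
          - 2 * η * (‖D'‖ ^ 2 + ‖Y‖ * ‖D'‖)) ≤ t ^ 2 * ⟪Y, D - Y⟫_ℝ := by linarith
      exact le_of_mul_le_mul_left h3 (by positivity)
    have hWD : Tendsto (fun k => fderiv ℝ f (A k) D) atTop (𝓝 (W' D)) :=
      ((ContinuousLinearMap.apply ℝ E D).continuous.tendsto W').comp hAW
    have hc : Continuous fun Y : E => 2 * ⟪Y, D' - W D'⟫_ℝ - ⟪W D', D' - W D'⟫_ℝ
        - 2 * η * (‖D'‖ ^ 2 + ‖Y‖ * ‖D'‖) := by fun_prop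
    have hc' : Continuous fun Y : E => ⟪Y, D - Y⟫_ℝ := by fun_prop
    exact le_of_tendsto_of_tendsto ((hc.tendsto _).comp hWD) ((hc'.tendsto _).comp hWD) hpt
  have key0 : 2 * ⟪W' D, D' - W D'⟫_ℝ - ⟪W D', D' - W D'⟫_ℝ ≤ ⟪W' D, D - W' D⟫_ℝ := by
    have hc : Continuous fun η : ℝ => 2 * ⟪W' D, D' - W D'⟫_ℝ - ⟪W D', D' - W D'⟫_ℝ
        - 2 * η * (‖D'‖ ^ 2 + ‖W' D‖ * ‖D'‖) := by fun_prop
    have h1 := (hc.tendsto 0).mono_left (nhdsWithin_le_nhds (s := Ioi 0))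
    have h2 := le_of_tendsto h1 (by filter_upwards [self_mem_nhdsWithin] with η hη using key η hη)
    simpa using h2
  -- The quadratic terms combine to ‖W'D - WD'‖²; dropping this square leaves a bound linear in W',
  -- which passes to convex combinations.
  have hsq : 0 ≤ ⟪W' D - W D', W' D - W D'⟫_ℝ := real_inner_self_nonneg
  simp only [inner_sub_left, inner_sub_right] at hsq key0 ⊢
  rw [real_inner_comm (W' D) (W D')] at hsq
  linarith

lemma clarkeJacobian_bound {S : E → E} {x : E}
    (h : ∀ W' ∈ limJacobian S x, ∀ D D', 2 * ⟪W' D, D'⟫_ℝ - ⟪W D', D'⟫_ℝ ≤ ⟪W' D, D⟫_ℝ)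
    {W' : E →L[ℝ] E} (hW' : W' ∈ clarkeJacobian S x) (D D' : E) :
    2 * ⟪W' D, D'⟫_ℝ - ⟪W D', D'⟫_ℝ ≤ ⟪W' D, D⟫_ℝ := by
  have hconv : Convex ℝ {V : E →L[ℝ] E | 2 * ⟪V D, D'⟫_ℝ - ⟪W D', D'⟫_ℝ ≤ ⟪V D, D⟫_ℝ} := by
    intro V hV V' hV' a b ha hb hab
    have e : ∀ z, (a • V + b • V') z = a • V z + b • V' z := fun z => rfl
    simp only [mem_ofPred_eq, e, inner_add_left, real_inner_smul_left] at hV hV' ⊢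
    have h1 := mul_le_mul_of_nonneg_left hV ha
    have h2 := mul_le_mul_of_nonneg_left hV' hb
    have h3 : ⟪W D', D'⟫_ℝ = a * ⟪W D', D'⟫_ℝ + b * ⟪W D', D'⟫_ℝ := by rw [← add_mul, hab, one_mul]
    linarith
  exact convexHull_min (fun V hV => h V hV D D') hconv hW'

/-- With D' = z and W'd = Wz the bound reads ⟨Wz, z⟩ ≤ ⟨Wz, d⟩, which is minimality. On ker W it
bounds a linear function of D' from above, so W'z is orthogonal to ker W and, by symmetry of W, lies
in rge W. -/
lemma isDominatingJacobian_of_bound [FiniteDimensional ℝ E] {r : E → EReal} {x u : E}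
    (hmem : W ∈ limJacobian (prox r) (x + u)) (hsymm : ∀ y z, ⟪W y, z⟫_ℝ = ⟪y, W z⟫_ℝ)
    (h : ∀ W' ∈ limJacobian (prox r) (x + u),
      ∀ D D', 2 * ⟪W' D, D'⟫_ℝ - ⟪W D', D'⟫_ℝ ≤ ⟪W' D, D⟫_ℝ) :
    IsDominatingJacobian r x u W ∧ ∀ z, IsLeast (sovfValues r x u (W z)) ⟪W z, z - W z⟫_ℝ := by
  have hcl : W ∈ clarkeJacobian (prox r) (x + u) := subset_convexHull ℝ _ hmem
  have hleast : ∀ z, IsLeast (sovfValues r x u (W z)) ⟪W z, z - W z⟫_ℝ := by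
    intro z
    refine ⟨⟨W, hcl, z, rfl, rfl⟩, ?_⟩
    rintro t ⟨W', hW', d, hd, rfl⟩
    have h1 := clarkeJacobian_bound h hW' d z
    rw [← hd] at h1
    rw [inner_sub_right, inner_sub_right]
    linarith
  have hrange : rangeUnion r x u = range W := by
    refine Subset.antisymm ?_ ?_
    · intro y hy
      obtain ⟨W', hW', z, rfl⟩ : ∃ W' ∈ clarkeJacobian (prox r) (x + u), ∃ z, W' z = y := by
        simpa [rangeUnion] using hy
      set Wl : E →ₗ[ℝ] E := (W : E →ₗ[ℝ] E)
      have hs : Wl.IsSymmetric := fun y z => hsymm y z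
      have hperp : W' z ∈ (LinearMap.range Wl)ᗮᗮ := by
        rw [Submodule.mem_orthogonal]
        intro v hv
        have hv0 : W v = 0 := by
          have : v ∈ LinearMap.ker Wl := by rw [← hs.orthogonal_range]; exact hv
          exact this
        have hb : ∀ t : ℝ, 2 * t * ⟪W' z, v⟫_ℝ ≤ ⟪W' z, z⟫_ℝ := by
          intro t
          have := clarkeJacobian_bound h hW' z (t • v)
          rw [map_smul, hv0, smul_zero, inner_zero_left, inner_smul_right] at this
          linarith
        rw [real_inner_comm]
        by_contra hne
        -- For this t the left side of `hb` exceeds the right side by 1.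
        have h1 := hb ((⟪W' z, z⟫_ℝ + 1) / (2 * ⟪W' z, v⟫_ℝ))
        have h2 : 2 * ((⟪W' z, z⟫_ℝ + 1) / (2 * ⟪W' z, v⟫_ℝ)) * ⟪W' z, v⟫_ℝ = ⟪W' z, z⟫_ℝ + 1 := by
          field_simp
        linarith
      rw [Submodule.orthogonal_orthogonal] at hperp
      exact hperp
    · rintro _ ⟨z, rfl⟩
      exact mem_biUnion hcl (mem_range_self z)
  refine ⟨⟨hmem, hrange, fun y hy => ?_⟩, hleast⟩
  rw [hrange] at hy
  obtain ⟨z, rfl⟩ := hy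
  exact ⟨z, rfl, hleast z⟩

end Domination

/-! ### Closed formulas for the Jacobian and for Γ. -/

section ExplicitFormulas

variable {p q : ℕ} (hpq : p ≤ q) {σ : Fin p → ℝ}

lemma mem_α₁ (i : Fin p) : i ∈ α₁ σ ↔ 1 < σ i := by simp [α₁]
lemma mem_α₁_union (i : Fin p) : i ∈ α₁ σ ∪ α₂ σ ↔ 1 ≤ σ i := by
  simp [α₁, α₂, le_iff_lt_or_eq, eq_comm]
lemma mem_α₃ (i : Fin p) : i ∈ α₃ σ ↔ σ i < 1 := by simp [α₃]

lemma Ωα_apply (i j : Fin p) : Ωα σ i j = coefSym (σ i) (σ j) := by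
  simp only [Ωα, Matrix.of_apply, mem_α₁, mem_α₃, mem_α₁_union, coefSym]

lemma Ωγ_apply (i j : Fin p) : Ωγ σ i j = coefSkew (σ i) (σ j) := by
  simp only [Ωγ, Matrix.of_apply, mem_α₁, coefSkew]

/-- A column beyond p acts as a partner with singular value 0 and mirrored entry 0. -/
lemma Ωβ_apply (i : Fin p) (l : Fin (q - p)) (x : ℝ) :
    Ωβ (q := q) σ i l * x = entryJac (σ i) 0 x 0 := by
  simp only [Ωβ, Matrix.of_apply, mem_α₁, entryJac, coefSym, coefSkew]
  by_cases h : 1 < σ i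
  · rw [if_pos h, if_pos ⟨h, one_pos⟩, if_pos (Or.inl h), shrink_of_le zero_le_one,
      shrink_of_ge h.le]
    simp only [sub_zero, add_zero]
    ring
  · rw [if_neg h, if_neg (fun h' => h h'.1), if_neg (fun h' => by linarith [h'.2]),
      if_neg (fun h' => by linarith [h'.2]), if_neg (by push Not; exact ⟨not_lt.1 h, by norm_num⟩)]
    ring

lemma sum_colL_colR (f : Fin q → ℝ) :
    ∑ j, f j = ∑ k, f (colL hpq k) + ∑ l, f (colR hpq l) := by
  have hb : Function.Bijective (Sum.elim (colL hpq) (colR hpq)) := by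
    constructor
    · rintro (a | a) (b | b) h <;> simp only [Sum.elim_inl, Sum.elim_inr, colL, colR,
        Fin.ext_iff, Fin.val_castLE] at h
      · rw [Fin.ext h]
      · omega
      · omega
      · rw [Fin.ext (by omega : (a : ℕ) = b)]
    · intro j
      rcases lt_or_ge (j : ℕ) p with h | h
      · exact ⟨Sum.inl ⟨j, h⟩, rfl⟩
      · refine ⟨Sum.inr ⟨j - p, by omega⟩, Fin.ext ?_⟩
        simp only [Sum.elim_inr, colR]
        omega
  rw [← hb.sum_comp f, Fintype.sum_sum_type]
  rfl

lemma frameJac_colL (v : Matrix (Fin p) (Fin q) ℝ) (i k : Fin p) :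
    frameJac hpq σ v i (colL hpq k) =
      entryJac (σ i) (σ k) (v i (colL hpq k)) (v k (colL hpq i)) := by
  simp [frameJac]

lemma frameJac_colR (v : Matrix (Fin p) (Fin q) ℝ) (i : Fin p) (l : Fin (q - p)) :
    frameJac hpq σ v i (colR hpq l) = entryJac (σ i) 0 (v i (colR hpq l)) 0 := by
  have h : p ≤ (colR hpq l : ℕ) := Nat.le_add_right _ _
  simp only [frameJac, Matrix.of_apply, extend_of_le σ h, extendRows_of_le v h]

lemma explicitJacobian_eq (R : Matrix (Fin p) (Fin p) ℝ) (S : Matrix (Fin q) (Fin q) ℝ)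
    (D : Matrix (Fin p) (Fin q) ℝ) :
    explicitJacobian hpq R σ S D = R * frameJac hpq σ (Rᵀ * D * S) * Sᵀ := by
  rw [explicitJacobian, Matrix.mul_assoc R]
  congr 1
  ext i j
  rw [Matrix.add_apply, Matrix.mul_apply, Matrix.mul_apply, Matrix.mul_apply,
    sum_colL_colR hpq]
  congr 1
  · refine Finset.sum_congr rfl fun k _ => ?_
    rw [frameJac_colL, entryJac, ← Ωα_apply, ← Ωγ_apply]
    simp only [Matrix.transpose_apply, Matrix.submatrix_apply, id, Matrix.add_apply,
      Matrix.hadamard_apply, Matrix.smul_apply, Matrix.sub_apply, smul_eq_mul, Matrix.mul_apply]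
    ring
  · refine Finset.sum_congr rfl fun l _ => ?_
    rw [frameJac_colR, ← Ωβ_apply (l := l)]
    simp only [Matrix.transpose_apply, Matrix.submatrix_apply, id, Matrix.hadamard_apply,
      Matrix.mul_apply]

/-- The contribution to the second-order variational function of a pair of singular values which
are both at least one. -/
def pairHigh (s t x y : ℝ) : ℝ :=
  if (1 ≤ s ∧ 1 ≤ t) ∧ (1 < s ∨ 1 < t) then
    ((s + t) / (shrink s + shrink t) - 1) * ((x - y) / 2) ^ 2 else 0

/-- The contribution to the second-order variational function of a singular value above one and
a singular value below one. -/
def pairMixed (s t x y : ℝ) : ℝ :=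
  if 1 < s ∧ t < 1 then
    (1 - t) / (s - 1) * ((x + y) / 2) ^ 2 + (1 + t) / (s - 1) * ((x - y) / 2) ^ 2 else 0

lemma pairHigh_symm (s t x y : ℝ) : pairHigh t s y x = pairHigh s t x y := by
  unfold pairHigh
  by_cases h : (1 ≤ s ∧ 1 ≤ t) ∧ (1 < s ∨ 1 < t)
  · rw [if_pos h, if_pos (by tauto), add_comm t s, add_comm (shrink t)]; ring
  · rw [if_neg h, if_neg (by tauto)]

/-- On symmetric and on skew parts the Jacobian multiplies by a scalar c, so y = cx gives y(x - y) =
(1/c - 1)y² when c ≠ 0; for c = (s - 1)/(s ∓ t) the factor is (1 ∓ t)/(s - 1). Where c = 0 the part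
vanishes. -/
lemma entry_pair_sum {s t : ℝ} (hs : 0 ≤ s) (ht : 0 ≤ t) (x y : ℝ) :
    entryJac s t x y * (x - entryJac s t x y) + entryJac t s y x * (y - entryJac t s y x) =
      2 * pairHigh s t (entryJac s t x y) (entryJac t s y x)
      + 2 * pairMixed s t (entryJac s t x y) (entryJac t s y x)
      + 2 * pairMixed t s (entryJac t s y x) (entryJac s t x y) := by
  have key : ∀ {s t : ℝ}, 1 < s → t < 1 → 0 ≤ t → ∀ x y,
      entryJac s t x y * (x - entryJac s t x y) + entryJac t s y x * (y - entryJac t s y x) =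
      2 * ((1 - t) / (s - 1) * ((entryJac s t x y + entryJac t s y x) / 2) ^ 2
        + (1 + t) / (s - 1) * ((entryJac s t x y - entryJac t s y x) / 2) ^ 2) := by
    intro s t h1 h2 h3 x y
    obtain ⟨-, -, e3, e4⟩ := high_low h1.le h2
    have a1 : s - 1 ≠ 0 := by intro h; linarith
    have a2 : s - t ≠ 0 := by intro h; linarith
    have a3 : s + t ≠ 0 := by positivity
    simp only [entryJac, coefSym_comm t s, coefSkew_comm t s, e3, e4]
    field_simp
    ring
  rcases le_or_gt 1 s with h1 | h1 <;> rcases le_or_gt 1 t with h2 | h2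
  · rw [pairMixed, pairMixed, if_neg (by grind), if_neg (by grind)]
    obtain ⟨-, -, e3, e4⟩ := high_high h1 h2
    have a3 : s + t ≠ 0 := by positivity
    unfold pairHigh
    split_ifs with h
    · have a1 : s + t - 2 ≠ 0 := by intro h'; rcases h.2 with h | h <;> linarith
      have a2 : shrink s + shrink t = s + t - 2 := by
        rw [shrink_of_ge h1, shrink_of_ge h2]; ring
      simp only [entryJac, coefSym_comm t s, coefSkew_comm t s, e3, e4, a2]
      field_simp
      ring
    · have hs1 : s = 1 := by grind
      have ht1 : t = 1 := by grind
      have e5 : coefSkew s t = 0 := by rw [e4, hs1, ht1]; norm_num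
      simp only [entryJac, coefSym_comm t s, coefSkew_comm t s, e3, e5]
      ring
  · rcases h1.eq_or_lt with h1' | h1'
    · obtain ⟨-, -, e3, e4⟩ := high_low h1 h2
      have hz : entryJac s t x y = 0 ∧ entryJac t s y x = 0 := by
        have e5 : coefSym s t = 0 := by rw [e3, ← h1', sub_self, zero_div]
        have e6 : coefSkew s t = 0 := by rw [e4, ← h1', sub_self, zero_div]
        simp [entryJac, coefSym_comm t s, coefSkew_comm t s, e5, e6]
      rw [hz.1, hz.2, pairHigh, pairMixed, pairMixed]
      simp
    · rw [key h1' h2 ht, pairHigh, if_neg (by grind), pairMixed, if_pos ⟨h1', h2⟩, pairMixed,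
        if_neg (by grind)]
      ring
  · rcases h2.eq_or_lt with h2' | h2'
    · obtain ⟨-, -, e3, e4⟩ := high_low h2 h1
      have hz : entryJac s t x y = 0 ∧ entryJac t s y x = 0 := by
        have e5 : coefSym t s = 0 := by rw [e3, ← h2', sub_self, zero_div]
        have e6 : coefSkew t s = 0 := by rw [e4, ← h2', sub_self, zero_div]
        simp [entryJac, coefSym_comm s t, coefSkew_comm s t, e5, e6]
      rw [hz.1, hz.2, pairHigh, pairMixed, pairMixed]
      simp
    · rw [add_comm, key h2' h1 hs, pairHigh, if_neg (by grind), pairMixed, if_neg (by grind),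
        pairMixed, if_pos ⟨h2', h1⟩]
      ring
  · obtain ⟨-, -, e3, e4⟩ := low_low h1 h2
    have hz : entryJac s t x y = 0 ∧ entryJac t s y x = 0 := by
      simp only [entryJac, coefSym_comm t s, coefSkew_comm t s, e3, e4]
      norm_num
    rw [hz.1, hz.2, pairHigh, pairMixed, pairMixed]
    simp

lemma entry_outer (s x : ℝ) : entryJac s 0 x 0 * (x - entryJac s 0 x 0) =
    if 1 < s then 1 / (s - 1) * entryJac s 0 x 0 ^ 2 else 0 := by
  split_ifs with h
  · obtain ⟨-, -, e3, e4⟩ := high_low h.le one_pos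
    have a1 : s - 1 ≠ 0 := by intro h'; linarith
    have a2 : s ≠ 0 := by positivity
    simp only [entryJac, e3, e4, sub_zero, add_zero]
    field_simp
    ring
  · have : entryJac s 0 x 0 = 0 := by
      rcases (not_lt.1 h).eq_or_lt with h' | h'
      · obtain ⟨-, -, e3, e4⟩ := high_low h'.ge one_pos
        have e5 : coefSym s 0 = 0 := by rw [e3, h', sub_self, zero_div]
        have e6 : coefSkew s 0 = 0 := by rw [e4, h', sub_self, zero_div]
        simp [entryJac, e5, e6]
      · obtain ⟨-, -, e3, e4⟩ := low_low h' one_pos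
        simp [entryJac, e3, e4]
    rw [this, zero_mul]

lemma sum_sum_swap_add (f : Fin p → Fin p → ℝ) :
    2 * ∑ i, ∑ k, f i k = ∑ i, ∑ k, (f i k + f k i) := by
  simp only [Finset.sum_add_distrib]
  rw [Finset.sum_comm (f := fun i k => f k i)]
  ring

lemma sum_sum_symm {f : Fin p → Fin p → ℝ} (hs : ∀ i k, f k i = f i k) (h0 : ∀ i, f i i = 0) :
    ∑ i, ∑ k, f i k = 2 * ∑ i, ∑ k, if i < k then f i k else 0 := by
  rw [sum_sum_swap_add]
  refine Finset.sum_congr rfl fun i _ => Finset.sum_congr rfl fun k _ => ?_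
  rcases lt_trichotomy i k with h | h | h
  · rw [if_pos h, if_neg h.not_gt, add_zero]
  · rw [h, h0]; simp
  · rw [if_neg h.not_gt, if_pos h, zero_add, hs]

/-- Sums over pairs i < j become sums over all pairs, to match the entrywise expansion of the inner
product in `frob_frameJac_polar`. -/
lemma explicitGamma_eq (hanti : Antitone σ) {R : Matrix (Fin p) (Fin p) ℝ}
    {S : Matrix (Fin q) (Fin q) ℝ} (Y : MatSpace p q) {w : Matrix (Fin p) (Fin q) ℝ}
    (hw : Rᵀ * mat Y * S = w) :
    explicitGamma hpq R σ S Y =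
      ∑ i, ∑ k, (pairHigh (σ i) (σ k) (w i (colL hpq k)) (w k (colL hpq i))
        + pairMixed (σ i) (σ k) (w i (colL hpq k)) (w k (colL hpq i))
        + pairMixed (σ k) (σ i) (w k (colL hpq i)) (w i (colL hpq k)))
      + ∑ i, ∑ l, if 1 < σ i then 1 / (σ i - 1) * w i (colR hpq l) ^ 2 else 0 := by
  unfold explicitGamma
  simp only [hw, Finset.sum_add_distrib]
  congr 1
  · rw [sum_sum_symm (f := fun i k =>
      pairHigh (σ i) (σ k) (w i (colL hpq k)) (w k (colL hpq i)))
      (fun i k => pairHigh_symm _ _ _ _) (fun i => by simp [pairHigh]),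
      Finset.sum_comm (f := fun i k : Fin p =>
        pairMixed (σ k) (σ i) (w k (colL hpq i)) (w i (colL hpq k))), add_assoc, ← two_mul]
    congr 2
    · rw [α₁, Finset.sum_filter]
      refine Finset.sum_congr rfl fun i _ => ?_
      have hset : (Finset.univ.filter (fun i => 1 < σ i) ∪ α₂ σ).filter (fun j => i < j) =
          Finset.univ.filter fun j => i < j ∧ 1 ≤ σ j := by
        ext j
        have := mem_α₁_union (σ := σ) j
        rw [α₁] at this
        simp only [Finset.mem_filter, this, Finset.mem_univ, true_and]
        tauto
      rw [hset, Finset.sum_filter]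
      split_ifs with hi
      · refine Finset.sum_congr rfl fun j _ => ?_
        by_cases hij : i < j
        · by_cases hj : 1 ≤ σ j
          · rw [if_pos ⟨hij, hj⟩, if_pos hij, pairHigh, if_pos ⟨⟨hi.le, hj⟩, Or.inl hi⟩]
          · rw [if_neg (fun h => hj h.2), if_pos hij, pairHigh, if_neg (fun h => hj h.1.2)]
        · rw [if_neg (fun h => hij h.1), if_neg hij]
      · symm
        refine Finset.sum_eq_zero fun j _ => ?_
        split_ifs with hij
        -- For i outside α₁ and i < j the ordering forces both values to be at most 1, so
        -- restricting i to α₁ loses nothing.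
        · have := hanti hij.le
          rw [pairHigh, if_neg]
          rintro ⟨-, h | h⟩ <;> linarith
        · rfl
    · rw [← Finset.sum_add_distrib, α₁, Finset.sum_filter]
      refine Finset.sum_congr rfl fun i _ => ?_
      rw [α₃, ← Finset.sum_add_distrib, Finset.sum_filter]
      split_ifs with hi
      · refine Finset.sum_congr rfl fun j _ => ?_
        simp only [pairMixed, hi, true_and]
      · symm
        exact Finset.sum_eq_zero fun j _ => by rw [pairMixed, if_neg (fun h => hi h.1)]
  · rw [α₁, Finset.sum_filter]
    refine Finset.sum_congr rfl fun i _ => ?_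
    split_ifs with hi
    · rw [Finset.mul_sum]
    · simp

lemma frob_frameJac_polar (hσ : ∀ i, 0 ≤ σ i) (v : Matrix (Fin p) (Fin q) ℝ) :
    frob (frameJac hpq σ v) (v - frameJac hpq σ v) =
      ∑ i, ∑ k, (pairHigh (σ i) (σ k) (frameJac hpq σ v i (colL hpq k))
          (frameJac hpq σ v k (colL hpq i))
        + pairMixed (σ i) (σ k) (frameJac hpq σ v i (colL hpq k)) (frameJac hpq σ v k (colL hpq i))
        + pairMixed (σ k) (σ i) (frameJac hpq σ v k (colL hpq i))
          (frameJac hpq σ v i (colL hpq k)))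
      + ∑ i, ∑ l, if 1 < σ i then 1 / (σ i - 1) * frameJac hpq σ v i (colR hpq l) ^ 2 else 0 := by
  simp only [frob, sum_colL_colR hpq, Finset.sum_add_distrib (s := Finset.univ (α := Fin p)),
    Matrix.sub_apply]
  congr 1
  · have h2 : (2 : ℝ) ≠ 0 := two_ne_zero
    refine mul_left_cancel₀ h2 ?_
    rw [sum_sum_swap_add]
    simp only [← Finset.sum_add_distrib, Finset.mul_sum]
    refine Finset.sum_congr rfl fun i _ => Finset.sum_congr rfl fun k _ => ?_
    simp only [frameJac_colL]
    rw [entry_pair_sum (hσ i) (hσ k)]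
    ring
  · refine Finset.sum_congr rfl fun i _ => Finset.sum_congr rfl fun l _ => ?_
    rw [frameJac_colR, entry_outer]

end ExplicitFormulas

/-! ### Claim 1 for the nuclear norm. -/

section NuclearNormJacobian

variable {p q : ℕ} {R : Matrix (Fin p) (Fin p) ℝ} {σ : Fin p → ℝ} {S : Matrix (Fin q) (Fin q) ℝ}

lemma mat_svdJac_eq (hpq : p ≤ q) (hR : R ∈ Matrix.orthogonalGroup (Fin p) ℝ)
    (hS : S ∈ Matrix.orthogonalGroup (Fin q) ℝ) (D : MatSpace p q) :
    mat (svdJac hR hS hpq σ D) = explicitJacobian hpq R σ S (mat D) := by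
  rw [mat_svdJac, explicitJacobian_eq]

lemma explicitRange_eq (hpq : p ≤ q) (hR : R ∈ Matrix.orthogonalGroup (Fin p) ℝ)
    (hS : S ∈ Matrix.orthogonalGroup (Fin q) ℝ) :
    explicitRange hpq R σ S = range (svdJac hR hS hpq σ) := by
  ext Y
  constructor
  · rintro ⟨D, hD⟩
    refine ⟨ofMat D, mat_injective ?_⟩
    rw [hD, mat_svdJac_eq, mat_ofMat]
  · rintro ⟨D, rfl⟩
    exact ⟨mat D, mat_svdJac_eq hpq hR hS D⟩

lemma svdJac_symm (hpq : p ≤ q) (hR : R ∈ Matrix.orthogonalGroup (Fin p) ℝ)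
    (hS : S ∈ Matrix.orthogonalGroup (Fin q) ℝ) (Y Z : MatSpace p q) :
    ⟪svdJac hR hS hpq σ Y, Z⟫_ℝ = ⟪Y, svdJac hR hS hpq σ Z⟫_ℝ := by
  have h : ∀ Y Z : MatSpace p q, ⟪frameJacL hpq σ Y, Z⟫_ℝ = ⟪Y, frameJacL hpq σ Z⟫_ℝ := by
    intro Y Z
    rw [inner_eq_frob, inner_eq_frob, mat_frameJacL, mat_frameJacL, frob_frameJac_comm]
  rw [svdJac, conjIso_apply, conjIso_apply]
  conv_lhs => rw [← (rotIso hR hS).apply_symm_apply Z]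
  conv_rhs => rw [← (rotIso hR hS).apply_symm_apply Y]
  rw [LinearIsometryEquiv.inner_map_map, LinearIsometryEquiv.inner_map_map, h]

lemma explicitGamma_svdJac (hpq : p ≤ q) (hR : R ∈ Matrix.orthogonalGroup (Fin p) ℝ)
    (hS : S ∈ Matrix.orthogonalGroup (Fin q) ℝ) (hanti : Antitone σ) (hσ : ∀ i, 0 ≤ σ i)
    (D : MatSpace p q) :
    explicitGamma hpq R σ S (svdJac hR hS hpq σ D) =
      ⟪svdJac hR hS hpq σ D, D - svdJac hR hS hpq σ D⟫_ℝ := by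
  set T := rotIso hR hS with hT
  set v := mat (T.symm D) with hv
  have h1 : svdJac hR hS hpq σ D = T (frameJacL hpq σ (T.symm D)) := rfl
  have h2 : Rᵀ * mat (svdJac hR hS hpq σ D) * S = frameJac hpq σ v := by
    rw [← mat_rotIso_symm hR hS, h1, LinearIsometryEquiv.symm_apply_apply, mat_frameJacL]
  have h3 : D - svdJac hR hS hpq σ D = T (T.symm D - frameJacL hpq σ (T.symm D)) := by
    rw [map_sub, LinearIsometryEquiv.apply_symm_apply, h1]
  rw [explicitGamma_eq hpq hanti _ h2, ← frob_frameJac_polar hpq hσ, h3, h1,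
    LinearIsometryEquiv.inner_map_map, inner_eq_frob, mat_frameJacL, mat_sub, mat_frameJacL]

/-- The relation of a subgradient pair of the nuclear norm with the singular value decomposition
of its sum. -/
lemma svd_pair (hpq : p ≤ q) {X U : MatSpace p q} (hXU : SubG nuclearNorm X U)
    (h : IsSVD (mat (X + U)) R σ S) :
    X = rotIso h.1 h.2.1 (ofMat (diagRect q fun i => shrink (σ i))) ∧
      U = rotIso h.1 h.2.1 (ofMat (diagRect q fun i => min (σ i) 1)) ∧
      X + U = rotIso h.1 h.2.1 (ofMat (diagRect q σ)) := by
  obtain ⟨hR, hS, hanti, hσ, hA⟩ := id h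
  have h1 : X + U = rotIso hR hS (ofMat (diagRect q σ)) := mat_injective hA
  -- X is the unique proximal point of X + U, hence the thresholded matrix of whichever
  -- decomposition is given.
  have h2 : X = rotIso hR hS (ofMat (diagRect q fun i => shrink (σ i))) :=
    (SubG.prox_eq (B := X + U) (P := X) (by rwa [add_sub_cancel_left])).symm.trans
      (subG_svd hpq h).prox_eq
  refine ⟨h2, ?_, h1⟩
  have h3 : U = X + U - X := (add_sub_cancel_left X U).symm
  refine h3.trans ((congrArg₂ (· - ·) h1 h2).trans ?_)
  rw [← map_sub]
  congr 1
  apply mat_injective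
  rw [mat_sub, mat_ofMat, mat_ofMat, mat_ofMat, diagRect_sub]
  simp only [sub_shrink]

theorem secondOrderLower_svd (hpq : p ≤ q) {X U : MatSpace p q} (hXU : SubG nuclearNorm X U)
    (h : IsSVD (mat (X + U)) R σ S) :
    SecondOrderLower nuclearNorm X U (svdJac h.1 h.2.1 hpq σ) := by
  have h1 := (secondOrderLower_frame hpq h.2.2.2.1).map_iso (T := rotIso h.1 h.2.1)
    (nuclearNorm_rotIso h.1 h.2.1 hpq)
  rwa [← (svd_pair hpq hXU h).1, ← (svd_pair hpq hXU h).2.1] at h1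

theorem svdJac_mem (hpq : p ≤ q) {X U : MatSpace p q} (hXU : SubG nuclearNorm X U)
    (h : IsSVD (mat (X + U)) R σ S) :
    svdJac h.1 h.2.1 hpq σ ∈ limJacobian (prox (nuc p q)) (X + U) := by
  have h1 := svdJac_mem_limJacobian h.1 h.2.1 hpq h.2.2.2.1
  rwa [← (svd_pair hpq hXU h).2.2] at h1

theorem svdJac_dominating (hpq : p ≤ q) {X U : MatSpace p q} (hXU : SubG nuclearNorm X U)
    (h : IsSVD (mat (X + U)) R σ S) :
    IsDominatingJacobian (nuc p q) X U (svdJac h.1 h.2.1 hpq σ) ∧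
      ∀ D, IsLeast (sovfValues (nuc p q) X U (svdJac h.1 h.2.1 hpq σ D))
        ⟪svdJac h.1 h.2.1 hpq σ D, D - svdJac h.1 h.2.1 hpq σ D⟫_ℝ :=
  isDominatingJacobian_of_bound (svdJac_mem hpq hXU h) (svdJac_symm hpq h.1 h.2.1)
    fun _ hW' => fderiv_prox_bound (proxSolvable_nuclearNorm hpq) hXU
      (secondOrderLower_svd hpq hXU h) hW'

lemma sInf_coe_image_eq {s : Set ℝ} {a : ℝ} (h : IsLeast s a) :
    sInf ((fun t : ℝ => (t : EReal)) '' s) = (a : EReal) := by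
  refine IsLeast.csInf_eq ⟨mem_image_of_mem _ h.1, ?_⟩
  rintro _ ⟨t, ht, rfl⟩
  exact EReal.coe_le_coe_iff.2 (h.2 ht)

theorem sovf_nuclear (hpq : p ≤ q) {X U : MatSpace p q} (hXU : SubG nuclearNorm X U)
    (h : IsSVD (mat (X + U)) R σ S) :
    rangeUnion (nuc p q) X U = explicitRange hpq R σ S ∧
    (∀ Y ∈ explicitRange hpq R σ S,
      IsLeast (sovfValues (nuc p q) X U Y) (explicitGamma hpq R σ S Y) ∧
      sovf (nuc p q) X U Y = ((explicitGamma hpq R σ S Y : ℝ) : EReal)) ∧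
    (∀ Y : MatSpace p q, Y ∉ explicitRange hpq R σ S → sovf (nuc p q) X U Y = ⊤) := by
  obtain ⟨hdom, hleast⟩ := svdJac_dominating hpq hXU h
  have hr : rangeUnion (nuc p q) X U = explicitRange hpq R σ S := by
    rw [explicitRange_eq hpq h.1 h.2.1]; exact hdom.2.1
  refine ⟨hr, fun Y hY => ?_, fun Y hY => ?_⟩
  · have hY' := hY
    rw [explicitRange_eq hpq h.1 h.2.1] at hY'
    obtain ⟨D, rfl⟩ := hY'
    have h1 := hleast D
    rw [← explicitGamma_svdJac hpq h.1 h.2.1 h.2.2.1 h.2.2.2.1] at h1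
    refine ⟨h1, ?_⟩
    rw [sovf, if_pos (hr ▸ hY), sInf_coe_image_eq h1]
  · rw [sovf, if_neg (by rwa [hr])]

lemma secondOrderAssumption_nuc (hpq : p ≤ q) {X U : MatSpace p q}
    (hXU : U ∈ limSubdiff (nuc p q) X) : SecondOrderAssumption (nuc p q) X U := by
  have hs := (mem_limSubdiff_nuc_iff hpq).1 hXU
  obtain ⟨R, σ, S, h, -⟩ := exists_svd hpq (X + U)
  refine ⟨?_, ⟨fun _ => EReal.coe_ne_bot _, X, EReal.coe_ne_top _⟩,
    convexE_real (convexOn_nuclearNorm hpq), EReal.coe_ne_top _, hXU, _,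
    (svdJac_dominating hpq hs h).1⟩
  exact (continuous_coe_real_ereal.comp (continuous_nuclearNorm hpq)).lowerSemicontinuous

end NuclearNormJacobian

/-! ### Second-order estimates for the Lagrangian. -/

section Lagrangian

variable {E H : Type*} [NormedAddCommGroup E] [InnerProductSpace ℝ E] [CompleteSpace E]
  [NormedAddCommGroup H] [InnerProductSpace ℝ H] {f₀ : E → ℝ} {F : E → H}

lemma inner_gradient {f : E → ℝ} (x d : E) : ⟪gradient f x, d⟫_ℝ = fderiv ℝ f x d := by
  rw [gradient, InnerProductSpace.toDual_symm_apply]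

lemma contDiff_lagr (hf : ContDiff ℝ 2 f₀) (hF : ContDiff ℝ 2 F) (u : H) :
    ContDiff ℝ 2 (lagr f₀ F u) :=
  hf.add (hF.inner ℝ contDiff_const)

lemma inner_gradient_lagr (hf : ContDiff ℝ 2 f₀) (hF : ContDiff ℝ 2 F) (u : H) (x d : E) :
    ⟪gradient (lagr f₀ F u) x, d⟫_ℝ = fderiv ℝ f₀ x d + ⟪fderiv ℝ F x d, u⟫_ℝ := by
  have h1 := (hf.differentiable two_ne_zero x).hasFDerivAt
  have h2 := (hF.differentiable two_ne_zero x).hasFDerivAt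
  have h3 := h1.add (h2.inner ℝ (hasFDerivAt_const u x))
  rw [inner_gradient]
  have h4 : HasFDerivAt (lagr f₀ F u) _ x := h3
  rw [h4.fderiv]
  simp [fderivInnerCLM_apply]

lemma inner_gradient_lagr_sub (hf : ContDiff ℝ 2 f₀) (hF : ContDiff ℝ 2 F) (u v : H) (x d : E) :
    ⟪gradient (lagr f₀ F u) x, d⟫_ℝ =
      ⟪gradient (lagr f₀ F v) x, d⟫_ℝ + ⟪fderiv ℝ F x d, u - v⟫_ℝ := by
  rw [inner_gradient_lagr hf hF, inner_gradient_lagr hf hF, inner_sub_right]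
  ring

lemma contDiff_gradient_lagr (hf : ContDiff ℝ 2 f₀) (hF : ContDiff ℝ 2 F) (u : H) :
    ContDiff ℝ 1 (gradient (lagr f₀ F u)) := by
  have h1 : ContDiff ℝ 1 (fderiv ℝ (lagr f₀ F u)) :=
    (contDiff_lagr hf hF u).fderiv_right (by norm_num)
  exact (InnerProductSpace.toDual ℝ E).symm.contDiff.comp h1

/-- The increments of the gradients of the Lagrangian are governed by its Hessian at a base point,
uniformly over nearby multipliers. -/
lemma gradient_lagr_increment (hf : ContDiff ℝ 2 f₀) (hF : ContDiff ℝ 2 F) (x₀ : E) (u₀ : H)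
    {ε : ℝ} (hε : 0 < ε) : ∃ δ > 0, ∀ x x' u, ‖x - x₀‖ < δ → ‖x' - x₀‖ < δ → ‖u - u₀‖ < δ → ∀ d,
      |⟪gradient (lagr f₀ F u) x', d⟫_ℝ - ⟪gradient (lagr f₀ F u) x, d⟫_ℝ
        - ⟪fderiv ℝ (gradient (lagr f₀ F u₀)) x₀ (x' - x), d⟫_ℝ| ≤ ε * ‖x' - x‖ * ‖d‖ := by
  have hs : HasStrictFDerivAt (gradient (lagr f₀ F u₀))
      (fderiv ℝ (gradient (lagr f₀ F u₀)) x₀) x₀ :=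
    (contDiff_gradient_lagr hf hF u₀).contDiffAt.hasStrictFDerivAt one_ne_zero
  have h1 := hs.isLittleO.def (c := ε / 2) (by positivity)
  rw [Metric.eventually_nhds_iff] at h1
  obtain ⟨δ₁, hδ₁, h1⟩ := h1
  have hF1 : ContDiff ℝ 1 (fderiv ℝ F) := hF.fderiv_right (by norm_num)
  obtain ⟨K, t, ht, hK⟩ := (hF1.contDiffAt (x := x₀)).exists_lipschitzOnWith
  obtain ⟨δ₂, hδ₂, h2⟩ := Metric.mem_nhds_iff.1 ht
  -- Half of ε pays for strict differentiability at u₀. The radius ε/2/(K + 1) lets the other half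
  -- pay for the change of multiplier, which enters through (F'(x') - F'(x))d paired with u - u₀.
  refine ⟨min (min δ₁ δ₂) (ε / 2 / (K + 1)), by positivity, fun x x' u hx hx' hu d => ?_⟩
  rw [lt_min_iff, lt_min_iff] at hx hx' hu
  have e1 := @h1 (x', x) (by
    rw [Prod.dist_eq, max_lt_iff, dist_eq_norm, dist_eq_norm]
    exact ⟨hx'.1.1, hx.1.1⟩)
  have e2 := hK.dist_le_mul x' (h2 (by rw [Metric.mem_ball, dist_eq_norm]; exact hx'.1.2)) x
    (h2 (by rw [Metric.mem_ball, dist_eq_norm]; exact hx.1.2))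
  rw [dist_eq_norm, dist_eq_norm] at e2
  have e3 : ⟪gradient (lagr f₀ F u) x', d⟫_ℝ - ⟪gradient (lagr f₀ F u) x, d⟫_ℝ
        - ⟪fderiv ℝ (gradient (lagr f₀ F u₀)) x₀ (x' - x), d⟫_ℝ =
      ⟪gradient (lagr f₀ F u₀) x' - gradient (lagr f₀ F u₀) x
        - fderiv ℝ (gradient (lagr f₀ F u₀)) x₀ (x' - x), d⟫_ℝ
      + ⟪(fderiv ℝ F x' - fderiv ℝ F x) d, u - u₀⟫_ℝ := by
    rw [inner_gradient_lagr_sub hf hF u u₀ x', inner_gradient_lagr_sub hf hF u u₀ x]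
    simp only [inner_sub_left, _root_.sub_apply]
    ring
  rw [e3]
  refine (abs_add_le _ _).trans ?_
  have e4 := abs_real_inner_le_norm (gradient (lagr f₀ F u₀) x' - gradient (lagr f₀ F u₀) x
        - fderiv ℝ (gradient (lagr f₀ F u₀)) x₀ (x' - x)) d
  have e5 := abs_real_inner_le_norm ((fderiv ℝ F x' - fderiv ℝ F x) d) (u - u₀)
  have e6 : ‖(fderiv ℝ F x' - fderiv ℝ F x) d‖ ≤ K * ‖x' - x‖ * ‖d‖ :=
    (ContinuousLinearMap.le_opNorm _ _).trans (by gcongr)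
  have e7 : (K : ℝ) * ‖u - u₀‖ ≤ ε / 2 := by
    have := hu.2.le
    rw [le_div_iff₀ (by positivity)] at this
    nlinarith [norm_nonneg (u - u₀)]
  calc _ ≤ ε / 2 * ‖x' - x‖ * ‖d‖ + K * ‖x' - x‖ * ‖d‖ * ‖u - u₀‖ := by
        gcongr
        · exact e4.trans (by gcongr)
        · exact e5.trans (by gcongr)
    _ = ε / 2 * ‖x' - x‖ * ‖d‖ + K * ‖u - u₀‖ * (‖x' - x‖ * ‖d‖) := by ring
    _ ≤ ε / 2 * ‖x' - x‖ * ‖d‖ + ε / 2 * (‖x' - x‖ * ‖d‖) := by gcongr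
    _ = _ := by ring

/-- The second-order Taylor lower bound for the Lagrangian, uniform in the multiplier. -/
lemma lagr_taylor_lower (hf : ContDiff ℝ 2 f₀) (hF : ContDiff ℝ 2 F) (x₀ : E) (u₀ : H)
    {ε : ℝ} (hε : 0 < ε) : ∃ δ > 0, ∀ x x' u, ‖x - x₀‖ < δ → ‖x' - x₀‖ < δ → ‖u - u₀‖ < δ →
      1 / 2 * hessLagr f₀ F x₀ u₀ (x' - x) - ε * ‖x' - x‖ ^ 2 ≤
      lagr f₀ F u x' - lagr f₀ F u x - ⟪gradient (lagr f₀ F u) x, x' - x⟫_ℝ := by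
  -- Integration along the segment halves the constant 2ε.
  obtain ⟨δ, hδ, h⟩ := gradient_lagr_increment hf hF x₀ u₀ (ε := 2 * ε) (by positivity)
  refine ⟨δ, hδ, fun x x' u hx hx' hu => ?_⟩
  set d := x' - x with hd
  set c := hessLagr f₀ F x₀ u₀ d with hc
  have hseg : ∀ t ∈ Icc (0 : ℝ) 1, ‖x + t • d - x₀‖ < δ := by
    intro t ht
    have h1 := (convex_ball x₀ δ) (x := x) (by rwa [Metric.mem_ball, dist_eq_norm]) (y := x')
      (by rwa [Metric.mem_ball, dist_eq_norm]) (a := 1 - t) (b := t) (by linarith [ht.2]) ht.1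
      (by ring)
    have h2 : (1 - t) • x + t • x' = x + t • d := by rw [hd]; module
    rwa [h2, Metric.mem_ball, dist_eq_norm] at h1
  have hder : ∀ t : ℝ, HasDerivAt (fun t : ℝ => lagr f₀ F u (x + t • d)
      - t * ⟪gradient (lagr f₀ F u) x, d⟫_ℝ - t ^ 2 * (1 / 2 * c - ε * ‖d‖ ^ 2))
      (⟪gradient (lagr f₀ F u) (x + t • d), d⟫_ℝ - ⟪gradient (lagr f₀ F u) x, d⟫_ℝ
        - t * (c - 2 * ε * ‖d‖ ^ 2)) t := by
    intro t
    have h1 : HasDerivAt (fun t : ℝ => x + t • d) d t := by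
      simpa using ((hasDerivAt_id t).smul_const d).const_add x
    have h2 := ((contDiff_lagr hf hF u).differentiable two_ne_zero
      (x + t • d)).hasFDerivAt.comp_hasDerivAt t h1
    rw [← inner_gradient] at h2
    have h3 := (h2.sub ((hasDerivAt_id t).mul_const ⟪gradient (lagr f₀ F u) x, d⟫_ℝ)).sub
      ((hasDerivAt_pow 2 t).mul_const (1 / 2 * c - ε * ‖d‖ ^ 2))
    refine h3.congr_deriv ?_
    norm_num
    ring
  have hmono : MonotoneOn (fun t : ℝ => lagr f₀ F u (x + t • d)
      - t * ⟪gradient (lagr f₀ F u) x, d⟫_ℝ - t ^ 2 * (1 / 2 * c - ε * ‖d‖ ^ 2)) (Icc 0 1) := by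
    refine monotoneOn_of_deriv_nonneg (convex_Icc 0 1)
      (fun t _ => (hder t).continuousAt.continuousWithinAt)
      (fun t _ => (hder t).differentiableAt.differentiableWithinAt) fun t ht => ?_
    rw [interior_Icc] at ht
    rw [(hder t).deriv]
    have h1 := h x (x + t • d) u hx (hseg t (Ioo_subset_Icc_self ht)) hu d
    rw [add_sub_cancel_left, map_smul, real_inner_smul_left, norm_smul,
      Real.norm_of_nonneg ht.1.le] at h1
    have h2 := (abs_le.1 h1).1
    have h3 : c = ⟪fderiv ℝ (gradient (lagr f₀ F u₀)) x₀ d, d⟫_ℝ := rfl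
    rw [← h3] at h2
    nlinarith
  have := hmono (left_mem_Icc.2 zero_le_one) (right_mem_Icc.2 zero_le_one) zero_le_one
  have hx1 : x + d = x' := by rw [hd]; abel
  simp only [zero_smul, add_zero, one_smul, hx1] at this
  linarith

lemma increment_bound (hF : ContDiff ℝ 2 F) (x₀ : E) {ε : ℝ} (hε : 0 < ε) :
    ∃ δ > 0, ∀ x x', ‖x - x₀‖ < δ → ‖x' - x₀‖ < δ →
      ‖F x' - F x - fderiv ℝ F x₀ (x' - x)‖ ≤ ε * ‖x' - x‖ := by
  have hs : HasStrictFDerivAt F (fderiv ℝ F x₀) x₀ :=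
    hF.contDiffAt.hasStrictFDerivAt two_ne_zero
  have h1 := hs.isLittleO.def hε
  rw [Metric.eventually_nhds_iff] at h1
  obtain ⟨δ, hδ, h1⟩ := h1
  refine ⟨δ, hδ, fun x x' hx hx' => ?_⟩
  exact @h1 (x', x) (by
    rw [Prod.dist_eq, max_lt_iff, dist_eq_norm, dist_eq_norm]
    exact ⟨hx', hx⟩)

end Lagrangian

/-! ### The subdifferential of the perturbed objective. -/

section PerturbedSubdifferential

variable {E H : Type*} [NormedAddCommGroup E] [InnerProductSpace ℝ E] [CompleteSpace E]
  [NormedAddCommGroup H] [InnerProductSpace ℝ H] {f₀ : E → ℝ} {F : E → H} {g : H → ℝ} {σ : ℝ}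

/-- The perturbed objective of a composite problem with a real-valued outer function. -/
def perturbedReal (f₀ : E → ℝ) (F : E → H) (g : H → ℝ) (σ : ℝ) (z : WithLp 2 (E × H)) : ℝ :=
  g (F z.fst + z.snd) + (f₀ z.fst + σ / 2 * ‖z.snd‖ ^ 2)

lemma perturbed_eq_coe :
    perturbed f₀ F (fun X => (g X : EReal)) σ = fun z => (perturbedReal f₀ F g σ z : EReal) := by
  ext z
  simp only [perturbed, perturbedReal, EReal.coe_add]

lemma continuous_perturbedReal (hf : Continuous f₀) (hF : Continuous F) (hg : Continuous g) :
    Continuous (perturbedReal f₀ F g σ) := by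
  have h1 : Continuous fun z : WithLp 2 (E × H) => z.fst := WithLp.continuous_fst 2 E H
  have h2 : Continuous fun z : WithLp 2 (E × H) => z.snd := WithLp.continuous_snd 2 E H
  unfold perturbedReal
  fun_prop

/-- The description of the graph of the subdifferential of the perturbed objective. -/
def PerturbedPair (f₀ : E → ℝ) (F : E → H) (g : H → ℝ) (σ : ℝ) (z w : WithLp 2 (E × H)) : Prop :=
  SubG g (F z.fst + z.snd) (w.snd - σ • z.snd) ∧
    w.fst = gradient (lagr f₀ F (w.snd - σ • z.snd)) z.fst

/-- With V = w₂ - σs, where w₂ is the second component of w and s that of z, the slope of the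
penalty is absorbed into V. The excess then splits exactly into that of g, that of the Lagrangian
and a pure square. -/
lemma perturbedReal_excess (z z' w : WithLp 2 (E × H)) :
    perturbedReal f₀ F g σ z' - perturbedReal f₀ F g σ z - ⟪w, z' - z⟫_ℝ =
      (g (F z'.fst + z'.snd) - g (F z.fst + z.snd)
        - ⟪w.snd - σ • z.snd, F z'.fst + z'.snd - (F z.fst + z.snd)⟫_ℝ)
      + (lagr f₀ F (w.snd - σ • z.snd) z'.fst - lagr f₀ F (w.snd - σ • z.snd) z.fst
        - ⟪w.fst, z'.fst - z.fst⟫_ℝ)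
      + σ / 2 * ‖z'.snd - z.snd‖ ^ 2 := by
  rw [WithLp.prod_inner_apply]
  simp only [perturbedReal, lagr, WithLp.ofLp_fst, WithLp.ofLp_snd, WithLp.sub_fst, WithLp.sub_snd]
  rw [norm_sub_sq_real, ← real_inner_self_eq_norm_sq, ← real_inner_self_eq_norm_sq]
  simp only [inner_sub_left, inner_sub_right, inner_add_right, real_inner_smul_left,
    real_inner_smul_right]
  rw [real_inner_comm z.snd z'.snd, real_inner_comm w.snd (F z'.fst),
    real_inner_comm w.snd (F z.fst), real_inner_comm z.snd (F z'.fst),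
    real_inner_comm z.snd (F z.fst)]
  ring

lemma PerturbedPair.mem_regSubdiff (hσ : 0 ≤ σ) (hf : ContDiff ℝ 2 f₀) (hF : ContDiff ℝ 2 F)
    {z w : WithLp 2 (E × H)} (h : PerturbedPair f₀ F g σ z w) :
    w ∈ regSubdiff (fun z => (perturbedReal f₀ F g σ z : EReal)) z := by
  rw [mem_regSubdiff_real]
  intro ε hε
  obtain ⟨h1, h2⟩ := h
  set V := w.snd - σ • z.snd with hV
  have hd := ((contDiff_lagr hf hF V).differentiable two_ne_zero z.fst).hasFDerivAt
  have h3 := hd.isLittleO.def hε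
  have hc : Continuous fun z : WithLp 2 (E × H) => z.fst := WithLp.continuous_fst 2 E H
  filter_upwards [(hc.tendsto z).eventually h3] with z' hz'
  have h4 := perturbedReal_excess (f₀ := f₀) (F := F) (g := g) (σ := σ) z z' w
  have h5 := h1 (F z'.fst + z'.snd)
  rw [← hV] at h4
  rw [← inner_gradient, ← h2] at hz'
  have h6 := (abs_le.1 hz').1
  have h7 : ε * ‖z'.fst - z.fst‖ ≤ ε * ‖z' - z‖ := by
    have : ‖z'.fst - z.fst‖ ≤ ‖z' - z‖ := WithLp.norm_fst_le (p := 2) _ (z' - z)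
    gcongr
  have h8 : 0 ≤ σ / 2 * ‖z'.snd - z.snd‖ ^ 2 := by positivity
  linarith

/-- Two kinds of curves suffice: moving s alone isolates g, and moving x with F(x) + s held fixed
isolates the Lagrangian. -/
lemma PerturbedPair.of_regSubdiff (hσ : 0 ≤ σ) (hf : ContDiff ℝ 2 f₀) (hF : ContDiff ℝ 2 F)
    (hg : ConvexOn ℝ univ g) {z w : WithLp 2 (E × H)}
    (h : w ∈ regSubdiff (fun z => (perturbedReal f₀ F g σ z : EReal)) z) :
    PerturbedPair f₀ F g σ z w := by
  rw [mem_regSubdiff_real] at h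
  have hex := perturbedReal_excess (f₀ := f₀) (F := F) (g := g) (σ := σ) z
  set P := F z.fst + z.snd with hP
  set V := w.snd - σ • z.snd with hV
  constructor
  · intro Q
    set A := Q - P with hA
    have key : ∀ ε : ℝ, 0 < ε → 0 ≤ g Q - g P - ⟪V, A⟫_ℝ + ε * (σ / 2 * ‖A‖ ^ 2 + ‖A‖) := by
      intro ε hε
      set c : ℝ → WithLp 2 (E × H) := fun t => WithLp.toLp 2 (z.fst, z.snd + t • A) with hc
      have hct : Tendsto c (𝓝[>] 0) (𝓝 z) := by
        have : Continuous c := (WithLp.prod_continuous_toLp 2 E H).comp (by fun_prop)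
        have h1 := (this.tendsto 0).mono_left (nhdsWithin_le_nhds (s := Ioi 0))
        have h2 : c 0 = z := by simp only [hc, zero_smul, add_zero]; rfl
        rwa [h2] at h1
      -- With t < ε the quadratic penalty, after division by t, is also of order ε.
      have h5 : ∀ᶠ t : ℝ in 𝓝[>] 0, t ∈ Ioo (0 : ℝ) (min 1 ε) := Ioo_mem_nhdsGT (by positivity)
      obtain ⟨t, h4, ht0, ht1⟩ := ((hct.eventually (h ε hε)).and h5).exists
      rw [lt_min_iff] at ht1
      have h6 := hex (c t) w
      have e1 : (c t).fst = z.fst := rfl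
      have e2 : (c t).snd = z.snd + t • A := rfl
      have e3 : F z.fst + (z.snd + t • A) = P + t • A := by rw [hP]; abel
      have e4 : ‖c t - z‖ = t * ‖A‖ := by
        have : c t - z = WithLp.toLp 2 (0, t • A) := by
          apply (WithLp.ofLp_injective 2)
          ext
          · change z.fst - z.fst = 0; rw [sub_self]
          · change z.snd + t • A - z.snd = t • A; rw [add_sub_cancel_left]
        rw [this, WithLp.norm_toLp_snd, norm_smul, Real.norm_of_nonneg ht0.le]
      rw [e4] at h4
      rw [e1, e2, e3, add_sub_cancel_left, add_sub_cancel_left, sub_self, sub_self, inner_zero_right,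
        real_inner_smul_right, norm_smul, Real.norm_of_nonneg ht0.le] at h6
      have h7 := hg.2 (mem_univ P) (mem_univ Q) (by linarith : 0 ≤ 1 - t) ht0.le (by ring)
      have e5 : (1 - t) • P + t • Q = P + t • A := by rw [hA]; module
      rw [e5, smul_eq_mul, smul_eq_mul] at h7
      have h8 : 0 ≤ t * (g Q - g P - ⟪V, A⟫_ℝ + (t * (σ / 2 * ‖A‖ ^ 2) + ε * ‖A‖)) := by
        nlinarith
      have h9 := nonneg_of_mul_nonneg_right h8 ht0
      have h10 : t * (σ / 2 * ‖A‖ ^ 2) ≤ ε * (σ / 2 * ‖A‖ ^ 2) := by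
        have := ht1.2.le
        gcongr
      linarith
    have hc : Continuous fun ε : ℝ => g Q - g P - ⟪V, A⟫_ℝ + ε * (σ / 2 * ‖A‖ ^ 2 + ‖A‖) := by
      fun_prop
    have h1 := ge_of_tendsto ((hc.tendsto 0).mono_left (nhdsWithin_le_nhds (s := Ioi 0)))
      (by filter_upwards [self_mem_nhdsWithin] with ε hε using key ε hε)
    linarith
  -- The direction is the residual d of the gradient equation; the limiting inequality then reads
  -- ‖d‖² ≤ 0.
  · set d := w.fst - gradient (lagr f₀ F V) z.fst with hd
    set c : ℝ → WithLp 2 (E × H) :=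
      fun t => WithLp.toLp 2 (z.fst + t • d, P - F (z.fst + t • d)) with hc
    have hct : Tendsto c (𝓝[>] 0) (𝓝 z) := by
      have hFc := hF.continuous
      have : Continuous c := (WithLp.prod_continuous_toLp 2 E H).comp (by fun_prop)
      have h1 := (this.tendsto 0).mono_left (nhdsWithin_le_nhds (s := Ioi 0))
      have h2 : c 0 = z := by
        simp only [hc, zero_smul, add_zero, hP, add_sub_cancel_left]; rfl
      rwa [h2] at h1
    have hq1 : Tendsto (fun t : ℝ => t⁻¹ • (lagr f₀ F V (z.fst + t • d) - lagr f₀ F V z.fst))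
        (𝓝[>] 0) (𝓝 ⟪gradient (lagr f₀ F V) z.fst, d⟫_ℝ) := by
      have := (((contDiff_lagr hf hF V).differentiable two_ne_zero
        z.fst).hasFDerivAt.hasLineDerivAt d).tendsto_slope_zero_right
      rw [inner_gradient]
      simpa using this
    have hq2 : Tendsto (fun t : ℝ => t⁻¹ • (F (z.fst + t • d) - F z.fst))
        (𝓝[>] 0) (𝓝 (fderiv ℝ F z.fst d)) := by
      have := ((hF.differentiable two_ne_zero
        z.fst).hasFDerivAt.hasLineDerivAt d).tendsto_slope_zero_right
      simpa using this
    have hid : Tendsto (fun t : ℝ => t) (𝓝[>] 0) (𝓝 0) := nhdsWithin_le_nhds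
    have key : ∀ ε : ℝ, 0 < ε → 0 ≤ ⟪gradient (lagr f₀ F V) z.fst, d⟫_ℝ - ⟪w.fst, d⟫_ℝ
        + σ / 2 * (0 * ‖fderiv ℝ F z.fst d‖ ^ 2) + ε * (‖d‖ + ‖fderiv ℝ F z.fst d‖) := by
      intro ε hε
      refine ge_of_tendsto (((hq1.sub_const ⟪w.fst, d⟫_ℝ).add
        ((hid.mul (hq2.norm.pow 2)).const_mul (σ / 2))).add
        ((hq2.norm.const_add ‖d‖).const_mul ε)) ?_
      filter_upwards [hct.eventually (h ε hε), self_mem_nhdsWithin] with t h4 ht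
      have ht0 : (0 : ℝ) < t := ht
      set q₁ := t⁻¹ • (lagr f₀ F V (z.fst + t • d) - lagr f₀ F V z.fst) with hq₁
      set q₂ := t⁻¹ • (F (z.fst + t • d) - F z.fst) with hq₂
      have h6 := hex (c t) w
      have e1 : (c t).fst = z.fst + t • d := rfl
      have e2 : (c t).snd = P - F (z.fst + t • d) := rfl
      have e3 : P - F (z.fst + t • d) - z.snd = -(t • q₂) := by
        rw [hq₂, smul_inv_smul₀ ht0.ne', hP]; abel
      have e5 : lagr f₀ F V (z.fst + t • d) - lagr f₀ F V z.fst = t * q₁ := by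
        rw [← smul_eq_mul t q₁, hq₁, smul_inv_smul₀ ht0.ne']
      have e4 : ‖c t - z‖ ≤ t * (‖d‖ + ‖q₂‖) := by
        have h1 : ‖c t - z‖ ^ 2 = t ^ 2 * ‖d‖ ^ 2 + t ^ 2 * ‖q₂‖ ^ 2 := by
          rw [WithLp.prod_norm_sq_eq_of_L2, WithLp.sub_fst, WithLp.sub_snd, e1, e2, e3,
            add_sub_cancel_left, norm_neg, norm_smul, norm_smul, Real.norm_of_nonneg ht0.le]
          ring
        refine abs_le_of_sq_le_sq' ?_ (by positivity) |>.2
        rw [h1]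
        have : 0 ≤ t ^ 2 * (‖d‖ * ‖q₂‖) := by positivity
        nlinarith
      rw [e1, e2, e3, add_sub_cancel, sub_self, sub_self, inner_zero_right, add_sub_cancel_left, e5,
        real_inner_smul_right, norm_neg, norm_smul, Real.norm_of_nonneg ht0.le] at h6
      have h7 : ε * ‖c t - z‖ ≤ ε * (t * (‖d‖ + ‖q₂‖)) := by gcongr
      have h8 : 0 ≤ t * (q₁ - ⟪w.fst, d⟫_ℝ + σ / 2 * (t * ‖q₂‖ ^ 2) + ε * (‖d‖ + ‖q₂‖)) := by
        nlinarith
      exact nonneg_of_mul_nonneg_right h8 ht0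
    have hcont : Continuous fun ε : ℝ => ⟪gradient (lagr f₀ F V) z.fst, d⟫_ℝ - ⟪w.fst, d⟫_ℝ
        + σ / 2 * (0 * ‖fderiv ℝ F z.fst d‖ ^ 2) + ε * (‖d‖ + ‖fderiv ℝ F z.fst d‖) := by
      fun_prop
    have h1 := ge_of_tendsto ((hcont.tendsto 0).mono_left (nhdsWithin_le_nhds (s := Ioi 0)))
      (by filter_upwards [self_mem_nhdsWithin] with ε hε using key ε hε)
    have h2 : ⟪d, d⟫_ℝ = ⟪w.fst, d⟫_ℝ - ⟪gradient (lagr f₀ F V) z.fst, d⟫_ℝ := by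
      conv_lhs => rw [hd, inner_sub_left]
    have h3 : ⟪d, d⟫_ℝ ≤ 0 := by rw [h2]; linarith
    exact sub_eq_zero.1 (real_inner_self_nonpos.1 h3)

/-- Both conditions in `PerturbedPair` are closed under limits, so limiting and regular subgradients
coincide. -/
theorem mem_limSubdiff_perturbed_iff (hσ : 0 ≤ σ) (hf : ContDiff ℝ 2 f₀) (hF : ContDiff ℝ 2 F)
    (hg : ConvexOn ℝ univ g) (hgc : Continuous g) {z w : WithLp 2 (E × H)} :
    w ∈ limSubdiff (fun z => (perturbedReal f₀ F g σ z : EReal)) z ↔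
      PerturbedPair f₀ F g σ z w := by
  refine ⟨fun h => ?_, fun h => mem_limSubdiff_of_reg (h.mem_regSubdiff hσ hf hF)⟩
  obtain ⟨-, -, xs, ys, hxs, -, hys, hyl⟩ := h
  have hp := fun k => PerturbedPair.of_regSubdiff hσ hf hF hg (hys k)
  have hx1 : Tendsto (fun k => (xs k).fst) atTop (𝓝 z.fst) :=
    ((WithLp.continuous_fst 2 E H).tendsto z).comp hxs
  have hx2 : Tendsto (fun k => (xs k).snd) atTop (𝓝 z.snd) :=
    ((WithLp.continuous_snd 2 E H).tendsto z).comp hxs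
  have hy1 : Tendsto (fun k => (ys k).fst) atTop (𝓝 w.fst) :=
    ((WithLp.continuous_fst 2 E H).tendsto w).comp hyl
  have hy2 : Tendsto (fun k => (ys k).snd) atTop (𝓝 w.snd) :=
    ((WithLp.continuous_snd 2 E H).tendsto w).comp hyl
  have hVl : Tendsto (fun k => (ys k).snd - σ • (xs k).snd) atTop (𝓝 (w.snd - σ • z.snd)) :=
    hy2.sub (hx2.const_smul σ)
  have hPl : Tendsto (fun k => F (xs k).fst + (xs k).snd) atTop (𝓝 (F z.fst + z.snd)) :=
    ((hF.continuous.tendsto _).comp hx1).add hx2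
  constructor
  · intro Q
    exact le_of_tendsto' (((hgc.tendsto _).comp hPl).add (hVl.inner (tendsto_const_nhds.sub hPl)))
      fun k => (hp k).1 Q
  · refine ext_inner_right ℝ fun d => ?_
    rw [inner_gradient_lagr hf hF]
    have h1 : Tendsto (fun k => ⟪(ys k).fst, d⟫_ℝ) atTop (𝓝 ⟪w.fst, d⟫_ℝ) :=
      hy1.inner tendsto_const_nhds
    have hf1 : Continuous fun x => fderiv ℝ f₀ x d :=
      (hf.continuous_fderiv two_ne_zero).clm_apply continuous_const
    have hF1 : Continuous fun x => fderiv ℝ F x d :=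
      (hF.continuous_fderiv two_ne_zero).clm_apply continuous_const
    have h2 := ((hf1.tendsto _).comp hx1).add (((hF1.tendsto _).comp hx1).inner hVl)
    refine tendsto_nhds_unique h1 (h2.congr fun k => ?_)
    rw [(hp k).2, inner_gradient_lagr hf hF]
    rfl

end PerturbedSubdifferential

/-! ### Necessity of the second-order condition. -/

section NecessaryCondition

variable {E H : Type*} [NormedAddCommGroup E] [InnerProductSpace ℝ E] [CompleteSpace E]
  [NormedAddCommGroup H] [InnerProductSpace ℝ H] {f₀ : E → ℝ} {F : E → H} {g : H → ℝ} {σ : ℝ}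

lemma continuous_gradient_lagr (hf : ContDiff ℝ 2 f₀) (hF : ContDiff ℝ 2 F) :
    Continuous fun p : E × H => gradient (lagr f₀ F p.2) p.1 := by
  have h1 : ∀ p : E × H, gradient (lagr f₀ F p.2) p.1 = (InnerProductSpace.toDual ℝ E).symm
      (fderiv ℝ f₀ p.1 + (innerSL ℝ p.2).comp (fderiv ℝ F p.1)) := by
    intro p
    refine ext_inner_right ℝ fun d => ?_
    rw [inner_gradient_lagr hf hF, InnerProductSpace.toDual_symm_apply]
    simp [real_inner_comm]
  simp only [h1]
  refine (InnerProductSpace.toDual ℝ E).symm.continuous.comp ?_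
  have h2 : Continuous fun p : E × H => fderiv ℝ f₀ p.1 :=
    (hf.continuous_fderiv two_ne_zero).comp continuous_fst
  have h3 : Continuous fun p : E × H => fderiv ℝ F p.1 :=
    (hF.continuous_fderiv two_ne_zero).comp continuous_fst
  exact h2.add (((innerSL ℝ).continuous.comp continuous_snd).clm_comp h3)

/-- Strong monotonicity of the localized subdifferential along the graph parametrized by the
proximal mapping. -/
lemma VarStronglyConvex.eventually_monotone (hσ : 0 ≤ σ) (hf : ContDiff ℝ 2 f₀)
    (hF : ContDiff ℝ 2 F) (hg : ConvexOn ℝ univ g) (hgc : Continuous g) (hps : ProxSolvable g)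
    {x : E} {u : H} (hu : SubG g (F x) u) (hgrad : gradient (lagr f₀ F u) x = 0) {κ : ℝ}
    (h : VarStronglyConvex (perturbed f₀ F (fun X => (g X : EReal)) σ) (WithLp.toLp 2 (x, 0))
      (WithLp.toLp 2 (0, u)) κ) {f : H → H} (hfp : f = prox fun X => (g X : EReal))
    {z w : E × H → WithLp 2 (E × H)} (hz : z = fun p => WithLp.toLp 2 (p.1, f p.2 - F p.1))
    (hw : w = fun p => WithLp.toLp 2 (gradient (lagr f₀ F (p.2 - f p.2)) p.1,
      p.2 - f p.2 + σ • (f p.2 - F p.1))) :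
    ∃ N ∈ 𝓝 (x, F x + u), ∀ p ∈ N, ∀ p' ∈ N,
      κ * ‖z p' - z p‖ ^ 2 ≤ ⟪w p' - w p, z p' - z p⟫_ℝ := by
  have hfc : Continuous f := by rw [hfp]; exact hps.lipschitz.continuous
  have hFc := hF.continuous
  have hzc : Continuous z := by
    rw [hz]; exact (WithLp.prod_continuous_toLp 2 E H).comp (by fun_prop)
  have hwc : Continuous w := by
    rw [hw]
    refine (WithLp.prod_continuous_toLp 2 E H).comp (Continuous.prodMk ?_ (by fun_prop))
    exact (continuous_gradient_lagr hf hF).comp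
      (g := fun p : E × H => gradient (lagr f₀ F p.2) p.1)
      (f := fun p : E × H => (p.1, p.2 - f p.2)) (by fun_prop)
  have hf0 : f (F x + u) = F x := by
    rw [hfp]; exact SubG.prox_eq (by rwa [add_sub_cancel_left])
  have hz0 : z (x, F x + u) = WithLp.toLp 2 (x, 0) := by
    rw [hz]; simp only [hf0, sub_self]
  have hw0 : w (x, F x + u) = WithLp.toLp 2 (0, u) := by
    rw [hw]; simp only [hf0, sub_self, add_sub_cancel_left, hgrad, smul_zero, add_zero]
  -- Every (x, B) gives a graph point: the subgradient of g at f(B) is B - f(B), and s = f(B) - F(x)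
  -- adds σs to the second slope.
  have hpair : ∀ p, PerturbedPair f₀ F g σ (z p) (w p) := by
    intro p
    have e : p.2 - f p.2 + σ • (f p.2 - F p.1) - σ • (f p.2 - F p.1) = p.2 - f p.2 :=
      add_sub_cancel_right _ _
    rw [hz, hw]
    constructor
    · simp only [WithLp.toLp_fst, WithLp.toLp_snd, e, add_sub_cancel]
      rw [hfp]
      exact hps.subG_prox _
    · simp only [WithLp.toLp_fst, WithLp.toLp_snd, e]
  obtain ⟨-, -, -, X, hX, Y, hY, -, -, rhat, hb, -, hconv, -, hstr, ε, hε, hgr, -⟩ := h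
  rw [← hz0] at hX hgr
  rw [← hw0] at hY
  have hGc : Continuous fun p => perturbedReal f₀ F g σ (z p) :=
    (continuous_perturbedReal hf.continuous hFc hgc).comp hzc
  -- Continuity makes the level condition automatic near the base point.
  have h1 : ∀ᶠ p in 𝓝 (x, F x + u), perturbedReal f₀ F g σ (z p) <
      perturbedReal f₀ F g σ (z (x, F x + u)) + ε :=
    (hGc.tendsto _).eventually_lt_const (by linarith)
  refine ⟨_, ((hzc.tendsto _).eventually hX).and (((hwc.tendsto _).eventually hY).and h1), ?_⟩
  have hmem : ∀ p, z p ∈ X → w p ∈ Y → perturbedReal f₀ F g σ (z p) <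
      perturbedReal f₀ F g σ (z (x, F x + u)) + ε → w p ∈ limSubdiff rhat (z p) := by
    intro p hpX hpY hpG
    refine (hgr _ hpX _ hpY).1 ⟨?_, ?_⟩
    · rw [perturbed_eq_coe, ← EReal.coe_add, EReal.coe_lt_coe_iff]
      exact hpG
    · rw [perturbed_eq_coe, mem_limSubdiff_perturbed_iff hσ hf hF hg hgc]
      exact hpair p
  rintro p ⟨hp1, hp2, hp3⟩ p' ⟨hp1', hp2', hp3'⟩
  exact limSubdiff_strong_monotone hconv hb hstr hp1 hp1' (hmem p hp1 hp2 hp3)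
    (hmem p' hp1' hp2' hp3')

/-- Variational strong convexity forces the second-order condition. -/
theorem VarStronglyConvex.hessLagr_bound (hσ : 0 ≤ σ) (hf : ContDiff ℝ 2 f₀)
    (hF : ContDiff ℝ 2 F) (hg : ConvexOn ℝ univ g) (hgc : Continuous g) (hps : ProxSolvable g)
    {x : E} {u : H} (hu : SubG g (F x) u) (hgrad : gradient (lagr f₀ F u) x = 0) {κ : ℝ}
    (hκ : 0 ≤ κ) (h : VarStronglyConvex (perturbed f₀ F (fun X => (g X : EReal)) σ)
      (WithLp.toLp 2 (x, 0)) (WithLp.toLp 2 (0, u)) κ) {W : H →L[ℝ] H}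
    (hW : W ∈ limJacobian (prox fun X => (g X : EReal)) (F x + u)) {d : E} {a : H}
    (ha : W a = fderiv ℝ F x d) :
    κ * ‖d‖ ^ 2 ≤ hessLagr f₀ F x u d + ⟪fderiv ℝ F x d, a - fderiv ℝ F x d⟫_ℝ := by
  set f := prox fun X => (g X : EReal) with hfp
  have hfc : Continuous f := hps.lipschitz.continuous
  obtain ⟨N, hN, hmono⟩ := h.eventually_monotone hσ hf hF hg hgc hps hu hgrad hfp rfl rfl
  have hf0 : f (F x + u) = F x := SubG.prox_eq (by rwa [add_sub_cancel_left])
  obtain ⟨A, hA, hAl, hAW⟩ := hW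
  set y := fderiv ℝ F x d with hy
  -- Monotonicity between (x, B) and (x + td, B + ta), with B = A k a point of differentiability, is
  -- divided by t²; first t → 0, then k → ∞.
  have key : ∀ ε : ℝ, 0 < ε → κ * ‖d‖ ^ 2 ≤ hessLagr f₀ F x u d + ε * ‖d‖ ^ 2 + ⟪y, a - W a⟫_ℝ
      + ⟪a - W a + σ • (W a - y), W a - y⟫_ℝ := by
    intro ε hε
    obtain ⟨δ, hδ, hinc⟩ := gradient_lagr_increment hf hF x u hε
    have hN2 : ∀ᶠ p : E × H in 𝓝 (x, F x + u), ‖p.2 - f p.2 - u‖ < δ := by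
      have : Continuous fun p : E × H => ‖p.2 - f p.2 - u‖ := by fun_prop
      exact (this.tendsto _).eventually_lt_const (by
        simp only [hf0, add_sub_cancel_left, sub_self, norm_zero]; exact hδ)
    have hN3 : ∀ᶠ p : E × H in 𝓝 (x, F x + u), ‖p.1 - x‖ < δ := by
      have : Continuous fun p : E × H => ‖p.1 - x‖ := by fun_prop
      exact (this.tendsto _).eventually_lt_const (by simpa using hδ)
    have hgood := (Filter.Eventually.and hN (hN2.and hN3)).eventually_nhds
    have hAl' : Tendsto (fun k => (x, A k)) atTop (𝓝 (x, F x + u)) :=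
      tendsto_const_nhds.prodMk_nhds hAl
    have hcY : Continuous fun Y : H => hessLagr f₀ F x u d + ε * ‖d‖ ^ 2 + ⟪y, a - Y⟫_ℝ
        + ⟪a - Y + σ • (Y - y), Y - y⟫_ℝ := by fun_prop
    have hWa : Tendsto (fun k => fderiv ℝ f (A k) a) atTop (𝓝 (W a)) :=
      ((ContinuousLinearMap.apply ℝ H a).continuous.tendsto W).comp hAW
    refine ge_of_tendsto ((hcY.tendsto _).comp hWa) ?_
    filter_upwards [hAl'.eventually hgood] with k hk
    set B := A k with hB
    obtain ⟨hBN, hB2, hB3⟩ := hk.self_of_nhds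
    have hline : Tendsto (fun t : ℝ => (x + t • d, B + t • a)) (𝓝[>] 0) (𝓝 (x, B)) := by
      have : Continuous (fun t : ℝ => (x + t • d, B + t • a)) := by fun_prop
      simpa using (this.tendsto 0).mono_left nhdsWithin_le_nhds
    have hq1 : Tendsto (fun t : ℝ => t⁻¹ • (f (B + t • a) - f B)) (𝓝[>] 0)
        (𝓝 (fderiv ℝ f B a)) := by
      have := ((hA k).hasFDerivAt.hasLineDerivAt a).tendsto_slope_zero_right
      simpa using this
    have hq2 : Tendsto (fun t : ℝ => t⁻¹ • (F (x + t • d) - F x)) (𝓝[>] 0) (𝓝 y) := by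
      have := ((hF.differentiable two_ne_zero x).hasFDerivAt.hasLineDerivAt
        d).tendsto_slope_zero_right
      simpa using this
    have hq3 : Tendsto (fun t : ℝ => fderiv ℝ F (x + t • d) d) (𝓝[>] 0) (𝓝 y) := by
      have hF1 : Continuous fun x => fderiv ℝ F x d :=
        (hF.continuous_fderiv two_ne_zero).clm_apply continuous_const
      have : Continuous fun t : ℝ => fderiv ℝ F (x + t • d) d :=
        hF1.comp (by fun_prop : Continuous fun t : ℝ => x + t • d)
      simpa using (this.tendsto 0).mono_left (nhdsWithin_le_nhds (s := Ioi 0))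
    have hlim := ((hq3.inner (hq1.const_sub a)).const_add
      (hessLagr f₀ F x u d + ε * ‖d‖ ^ 2)).add
      (((hq1.const_sub a).add ((hq1.sub hq2).const_smul σ)).inner (hq1.sub hq2))
    refine ge_of_tendsto hlim ?_
    filter_upwards [hline.eventually hk, self_mem_nhdsWithin] with t ht htpos
    have ht0 : (0 : ℝ) < t := htpos
    set Y := t⁻¹ • (f (B + t • a) - f B) with hY
    set q₂ := t⁻¹ • (F (x + t • d) - F x) with hq₂
    have e1 : f (B + t • a) - f B = t • Y := by rw [hY, smul_inv_smul₀ ht0.ne']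
    have e2 : F (x + t • d) - F x = t • q₂ := by rw [hq₂, smul_inv_smul₀ ht0.ne']
    have hm := hmono _ hBN _ ht.1
    have hi := (abs_le.1 (hinc x (x + t • d) (B - f B) (by simpa using hδ) ht.2.2 hB2 d)).2
    have e3 : f (B + t • a) - F (x + t • d) - (f B - F x) = t • (Y - q₂) := by
      rw [smul_sub, ← e1, ← e2]; abel
    have e4 : B + t • a - f (B + t • a) - (B - f B) = t • (a - Y) := by
      rw [smul_sub, ← e1]; abel
    have e5 : B + t • a - f (B + t • a) + σ • (f (B + t • a) - F (x + t • d))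
        - (B - f B + σ • (f B - F x)) = t • (a - Y + σ • (Y - q₂)) := by
      rw [smul_add, ← e4, smul_comm t σ, ← e3]; module
    have e6 := inner_gradient_lagr_sub hf hF (B + t • a - f (B + t • a)) (B - f B) (x + t • d) d
    rw [e4, inner_smul_right] at e6
    rw [add_sub_cancel_left, map_smul, real_inner_smul_left, norm_smul,
      Real.norm_of_nonneg ht0.le] at hi
    rw [WithLp.prod_norm_sq_eq_of_L2, WithLp.prod_inner_apply] at hm
    simp only [WithLp.ofLp_fst, WithLp.ofLp_snd, WithLp.sub_fst, WithLp.sub_snd, WithLp.toLp_fst,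
      WithLp.toLp_snd, add_sub_cancel_left, e3, e5, real_inner_smul_left, real_inner_smul_right,
      norm_smul, Real.norm_of_nonneg ht0.le, inner_sub_left] at hm
    rw [e6] at hm
    have hh : hessLagr f₀ F x u d = ⟪fderiv ℝ (gradient (lagr f₀ F u)) x d, d⟫_ℝ := rfl
    rw [← hh] at hi
    have h1 : 0 ≤ κ * (t * ‖Y - q₂‖) ^ 2 := by positivity
    have h2 : t ^ 2 * (κ * ‖d‖ ^ 2) ≤ t ^ 2 * (hessLagr f₀ F x u d + ε * ‖d‖ ^ 2
        + ⟪fderiv ℝ F (x + t • d) d, a - Y⟫_ℝ + ⟪a - Y + σ • (Y - q₂), Y - q₂⟫_ℝ) := by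
      nlinarith [mul_le_mul_of_nonneg_left hi ht0.le]
    exact le_of_mul_le_mul_left h2 (by positivity)
  -- Since Wa = F'(x)d, the increment of s vanishes to first order, and the term with σ disappears.
  rw [ha] at key
  simp only [sub_self, smul_zero, inner_zero_right, add_zero] at key
  refine le_of_forall_pos_le_add fun ε hε => ?_
  have h1 := key (ε / (‖d‖ ^ 2 + 1)) (by positivity)
  have h2 : ε / (‖d‖ ^ 2 + 1) * ‖d‖ ^ 2 ≤ ε := by
    rw [div_mul_eq_mul_div, div_le_iff₀ (by positivity)]
    nlinarith [sq_nonneg ‖d‖]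
  linarith

end NecessaryCondition

/-! ### Uniform quadratic growth under the second-order condition. -/

section QuadraticGrowth

/-- A quadratic form that is positive on the zero set of a nonnegative one becomes positive definite
after adding a large multiple of the latter. -/
lemma exists_penalty {V : Type*} [NormedAddCommGroup V] [NormedSpace ℝ V] [ProperSpace V]
    {Q N : V → ℝ} (hQ : Continuous Q) (hN : Continuous N) (hQ2 : ∀ (t : ℝ) v, Q (t • v) = t ^ 2 * Q v)
    (hN2 : ∀ (t : ℝ) v, N (t • v) = t ^ 2 * N v) (hN0 : ∀ v, 0 ≤ N v)
    (hpos : ∀ v, v ≠ 0 → N v = 0 → 0 < Q v) :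
    ∃ k > 0, ∃ c > 0, ∀ v, c * ‖v‖ ^ 2 ≤ Q v + k * N v := by
  -- On the compact part of the sphere where Q ≤ 0, N is at least some m > 0; k = (|b| + 1)/m lets
  -- kN outweigh the lower bound b of Q.
  have hK : IsCompact (Metric.sphere (0 : V) 1 ∩ {v | Q v ≤ 0}) :=
    (isCompact_sphere 0 1).inter_right (isClosed_le hQ continuous_const)
  have hne : ∀ v ∈ Metric.sphere (0 : V) 1, v ≠ 0 := by
    rintro v hv rfl
    simp at hv
  obtain ⟨m, hm, hmK⟩ := hK.exists_forall_le' (a := (0 : ℝ)) hN.continuousOn fun v hv =>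
    (hN0 v).lt_of_ne fun h => absurd (hpos v (hne v hv.1) h.symm) (not_lt.2 hv.2)
  obtain ⟨b, hb⟩ := (isCompact_sphere (0 : V) 1).bddBelow_image hQ.continuousOn
  set k := (|b| + 1) / m with hk
  have hk0 : 0 < k := by positivity
  obtain ⟨c, hc, hcS⟩ := (isCompact_sphere (0 : V) 1).exists_forall_le' (a := (0 : ℝ))
    (f := fun v => Q v + k * N v) (by fun_prop) fun v hv => by
      rcases le_or_gt (Q v) 0 with h | h
      · have h1 := hmK v ⟨hv, h⟩
        have h2 : b ≤ Q v := hb (mem_image_of_mem Q hv)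
        have h3 : k * m = |b| + 1 := by rw [hk]; field_simp
        have h4 : k * m ≤ k * N v := by gcongr
        linarith [neg_abs_le b]
      · have := mul_nonneg hk0.le (hN0 v)
        linarith
  refine ⟨k, hk0, c, hc, fun v => ?_⟩
  rcases eq_or_ne v 0 with rfl | hv
  · have h1 := hQ2 0 0
    have h2 := hN2 0 0
    simp only [smul_zero] at h1 h2
    rw [h1, h2]
    simp
  · have h1 := hcS (‖v‖⁻¹ • v) (by
      rw [mem_sphere_zero_iff_norm, norm_smul, norm_inv, norm_norm,
        inv_mul_cancel₀ (norm_ne_zero_iff.2 hv)])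
    simp only [hQ2, hN2] at h1
    have h2 : ‖v‖ ^ 2 * (‖v‖⁻¹ ^ 2) = 1 := by
      rw [← mul_pow, mul_inv_cancel₀ (norm_ne_zero_iff.2 hv), one_pow]
    have h3 := mul_le_mul_of_nonneg_left h1 (sq_nonneg ‖v‖)
    have h4 : ‖v‖ ^ 2 * (‖v‖⁻¹ ^ 2 * Q v + k * (‖v‖⁻¹ ^ 2 * N v)) =
      ‖v‖ ^ 2 * ‖v‖⁻¹ ^ 2 * (Q v + k * N v) := by ring
    rw [h4, h2] at h3
    linarith

/-- A linear splitting into an element of the range with a preimage and an element of the kernel. -/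
lemma exists_range_ker_splitting {H : Type*} [NormedAddCommGroup H] [InnerProductSpace ℝ H]
    [FiniteDimensional ℝ H] {W : H →L[ℝ] H} (hsymm : ∀ y z, ⟪W y, z⟫_ℝ = ⟪y, W z⟫_ℝ) :
    ∃ Z N : H →L[ℝ] H, (∀ ω, W (Z ω) + N ω = ω) ∧ ∀ ω, W (N ω) = 0 := by
  set Wl : H →ₗ[ℝ] H := (W : H →ₗ[ℝ] H)
  have hs : Wl.IsSymmetric := fun y z => hsymm y z
  set Φ : H × LinearMap.ker Wl →ₗ[ℝ] H := Wl.coprod (LinearMap.ker Wl).subtype with hΦ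
  have hsurj : LinearMap.range Φ = ⊤ := by
    rw [hΦ, LinearMap.range_coprod, Submodule.range_subtype, ← hs.orthogonal_range]
    exact Submodule.sup_orthogonal_of_hasOrthogonalProjection
  obtain ⟨ψ, hψ⟩ := Φ.exists_rightInverse_of_surjective hsurj
  refine ⟨LinearMap.toContinuousLinearMap (LinearMap.fst ℝ _ _ ∘ₗ ψ),
    LinearMap.toContinuousLinearMap
      ((LinearMap.ker Wl).subtype ∘ₗ LinearMap.snd ℝ _ _ ∘ₗ ψ), fun ω => ?_, fun ω => ?_⟩
  · exact LinearMap.congr_fun hψ ω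
  · exact (ψ ω).2.2

variable {E H : Type*} [NormedAddCommGroup E] [InnerProductSpace ℝ E] [FiniteDimensional ℝ E]
  [NormedAddCommGroup H] [InnerProductSpace ℝ H] [FiniteDimensional ℝ H]
  {f₀ : E → ℝ} {F : E → H} {g : H → ℝ}

/-- The lower second-order expansion along the splitting of an increment. -/
lemma SecondOrderLower.penalized {x u : H} {W : H →L[ℝ] H} (hW : SecondOrderLower g x u W)
    (hsymm : ∀ y z, ⟪W y, z⟫_ℝ = ⟪y, W z⟫_ℝ) {Z N : H →L[ℝ] H} (hZN : ∀ ω, W (Z ω) + N ω = ω)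
    (hWN : ∀ ω, W (N ω) = 0) (k : ℝ) {η : ℝ} (hη : 0 < η) :
    ∃ δ > 0, ∀ P V P', SubG g P V → ‖P - x‖ < δ → ‖V - u‖ < δ → ‖P' - x‖ < δ →
      ⟪P' - P, Z (P' - P) - W (Z (P' - P))⟫_ℝ
        - 1 / 2 * ⟪W (Z (P' - P)), Z (P' - P) - W (Z (P' - P))⟫_ℝ + k * ‖N (P' - P)‖ ^ 2
        - η * ‖P' - P‖ ^ 2 ≤ g P' - g P - ⟪V, P' - P⟫_ℝ := by
  set M := ‖Z + k • N‖ + 1 with hM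
  have hM0 : 0 < M := by positivity
  have hMb : ∀ ω, ‖Z ω + k • N ω‖ ≤ M * ‖ω‖ := by
    intro ω
    have := (Z + k • N).le_opNorm ω
    have h2 : (Z + k • N) ω = Z ω + k • N ω := rfl
    rw [h2] at this
    exact this.trans (by rw [hM]; gcongr; linarith)
  -- With ‖v‖ ≤ M‖ω‖ the error is at most (M² + M)‖ω‖² times this constant.
  obtain ⟨δ, hδ, hHL⟩ := hW (η / (M ^ 2 + M)) (by positivity)
  refine ⟨min δ (δ / (2 * M)), by positivity, fun P V P' h a1 a2 a3 => ?_⟩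
  rw [lt_min_iff] at a1 a2 a3
  set ω := P' - P with hω
  have hωδ : M * ‖ω‖ ≤ δ := by
    have h1 : ‖ω‖ ≤ ‖P' - x‖ + ‖P - x‖ := by
      have : ω = (P' - x) - (P - x) := by rw [hω]; abel
      rw [this]; exact norm_sub_le _ _
    have h2 : ‖ω‖ ≤ δ / (2 * M) + δ / (2 * M) := by linarith [a1.2, a3.2]
    calc M * ‖ω‖ ≤ M * (δ / (2 * M) + δ / (2 * M)) := by gcongr
      _ = δ := by field_simp; norm_num
  -- The direction is free in the expansion. Since WN = 0, the component kNω adds k‖Nω‖² to the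
  -- linear term at no quadratic cost.
  have h1 := hHL P V P' h a1.1 a2.1 a3.1 (Z ω + k • N ω) ((hMb ω).trans hωδ)
  rw [← hω] at h1
  have hWv : W (Z ω + k • N ω) = W (Z ω) := by rw [map_add, map_smul, hWN, smul_zero, add_zero]
  have e1 : ⟪W (Z ω), N ω⟫_ℝ = 0 := by rw [hsymm, hWN, inner_zero_right]
  have e2 : ⟪ω, N ω⟫_ℝ = ‖N ω‖ ^ 2 := by
    conv_lhs => rw [← hZN ω, inner_add_left]
    rw [hZN, e1, zero_add, real_inner_self_eq_norm_sq]
  have e3 : Z ω + k • N ω - W (Z ω) = (Z ω - W (Z ω)) + k • N ω := by abel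
  rw [hWv, e3, inner_add_right, inner_add_right, real_inner_smul_right, real_inner_smul_right, e1,
    e2] at h1
  have h5 : η / (M ^ 2 + M) * (‖Z ω + k • N ω‖ ^ 2 + ‖ω‖ * ‖Z ω + k • N ω‖) ≤ η * ‖ω‖ ^ 2 := by
    have := hMb ω
    calc _ ≤ η / (M ^ 2 + M) * ((M * ‖ω‖) ^ 2 + ‖ω‖ * (M * ‖ω‖)) := by gcongr
      _ = η * ‖ω‖ ^ 2 := by field_simp
  linarith

lemma hessLagr_smul (x : E) (u : H) (t : ℝ) (d : E) :
    hessLagr f₀ F x u (t • d) = t ^ 2 * hessLagr f₀ F x u d := by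
  simp only [hessLagr, map_smul, real_inner_smul_left, real_inner_smul_right]
  ring

/-- Where both penalties vanish, ω = F'd = W(Zω), and the form is half the second-order expression
with a = Zω. `exists_penalty` extends positivity to all (d, ω). -/
lemma exists_penalized_bound {x : E} {u : H} {W Z N : H →L[ℝ] H} {F' : E →L[ℝ] H}
    (hZN : ∀ ω, W (Z ω) + N ω = ω) (hpos : ∀ d, d ≠ 0 → ∀ a, W a = F' d →
      0 < hessLagr f₀ F x u d + ⟪F' d, a - F' d⟫_ℝ) :
    ∃ k > 0, ∃ c > 0, ∀ (d : E) (ω : H), c * ‖(d, ω)‖ ^ 2 ≤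
      ⟪ω, Z ω - W (Z ω)⟫_ℝ - 1 / 2 * ⟪W (Z ω), Z ω - W (Z ω)⟫_ℝ
      + 1 / 2 * hessLagr f₀ F x u d + k * (‖N ω‖ ^ 2 + ‖ω - F' d‖ ^ 2) := by
  have hhess : Continuous fun d => hessLagr f₀ F x u d := by unfold hessLagr; fun_prop
  obtain ⟨k, hk, c, hc, hkc⟩ := exists_penalty (V := E × H)
    (Q := fun v => ⟪v.2, Z v.2 - W (Z v.2)⟫_ℝ - 1 / 2 * ⟪W (Z v.2), Z v.2 - W (Z v.2)⟫_ℝ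
      + 1 / 2 * hessLagr f₀ F x u v.1)
    (N := fun v => ‖N v.2‖ ^ 2 + ‖v.2 - F' v.1‖ ^ 2) (by fun_prop) (by fun_prop)
    (by
      intro t v
      simp only [Prod.smul_snd, Prod.smul_fst, hessLagr_smul, map_smul, ← smul_sub,
        real_inner_smul_left, real_inner_smul_right]
      ring)
    (by
      intro t v
      simp only [Prod.smul_snd, Prod.smul_fst, map_smul, ← smul_sub, norm_smul, mul_pow,
        Real.norm_eq_abs, sq_abs]
      ring)
    (fun v => by positivity)
    (by
      rintro ⟨d, ω⟩ hv hN0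
      dsimp only at hN0 ⊢
      have h1 : N ω = 0 := by
        have : ‖N ω‖ ^ 2 = 0 := by nlinarith [sq_nonneg ‖N ω‖, sq_nonneg ‖ω - F' d‖]
        simpa using this
      have h2 : ω = F' d := by
        have : ‖ω - F' d‖ ^ 2 = 0 := by nlinarith [sq_nonneg ‖N ω‖, sq_nonneg ‖ω - F' d‖]
        exact sub_eq_zero.1 (by simpa using this)
      have h3 : W (Z ω) = ω := by have := hZN ω; rwa [h1, add_zero] at this
      have hd : d ≠ 0 := by
        rintro rfl
        exact hv (by rw [h2, map_zero]; rfl)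
      have h4 := hpos d hd (Z ω) (by rw [h3, h2])
      rw [← h2] at h4
      rw [h3]
      linarith)
  exact ⟨k, hk, c, hc, fun d ω => hkc (d, ω)⟩

/-- Here ω = b + e + s, with b the linearized increment of F, e its error and s the increment of the
perturbation. So k‖ω - b‖² is paid for by 2k‖s‖², up to a share c/4 of the coercivity. -/
lemma penalty_absorb {k c ε₁ L : ℝ} (hk : 0 < k) (hε₁ : 0 ≤ ε₁) (hL : 0 ≤ L)
    (hε₁2 : 2 * k * ε₁ ^ 2 = c / 4) {ω b e s : H} {d : E} (hs : s = ω - b - e)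
    (he : ‖e‖ ≤ ε₁ * ‖d‖) (hb : ‖b‖ ≤ L * ‖d‖) :
    k * ‖ω - b‖ ^ 2 - c / 4 * ‖(d, ω)‖ ^ 2 ≤ 2 * k * ‖s‖ ^ 2 ∧
      ‖d‖ ^ 2 + ‖s‖ ^ 2 ≤ (1 + (1 + L + ε₁) ^ 2) * ‖(d, ω)‖ ^ 2 := by
  have hωv : ‖ω‖ ≤ ‖(d, ω)‖ := norm_snd_le (d, ω)
  have hdv : ‖d‖ ≤ ‖(d, ω)‖ := norm_fst_le (d, ω)
  set v := ‖(d, ω)‖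
  have h3 : ‖e‖ ≤ ε₁ * v := he.trans (by gcongr)
  have h8 : ‖s‖ ≤ (1 + L + ε₁) * v := by
    have h1 : ‖s‖ ≤ ‖ω‖ + ‖b‖ + ‖e‖ := by
      rw [hs]
      exact (norm_sub_le _ _).trans (by gcongr; exact norm_sub_le _ _)
    have h2 : ‖b‖ ≤ L * v := hb.trans (by gcongr)
    linarith
  constructor
  · have h7 : ω - b = s + e := by rw [hs]; abel
    have h8 : ‖ω - b‖ ≤ ‖s‖ + ‖e‖ := by rw [h7]; exact norm_add_le _ _
    have h9 : ‖ω - b‖ ^ 2 ≤ (‖s‖ + ‖e‖) ^ 2 := by gcongr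
    have h10 : 1 / 2 * ‖ω - b‖ ^ 2 - ‖e‖ ^ 2 ≤ ‖s‖ ^ 2 := by nlinarith [sq_nonneg (‖s‖ - ‖e‖)]
    have h11 : 2 * k * ‖e‖ ^ 2 ≤ 2 * k * (ε₁ * v) ^ 2 := by gcongr
    have h12 : 2 * k * (1 / 2 * ‖ω - b‖ ^ 2 - ‖e‖ ^ 2) ≤ 2 * k * ‖s‖ ^ 2 := by gcongr
    have h13 : 2 * k * (ε₁ * v) ^ 2 = c / 4 * v ^ 2 := by rw [← hε₁2]; ring
    linarith
  · have h11 : ‖d‖ ^ 2 ≤ v ^ 2 := by gcongr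
    have h12 : ‖s‖ ^ 2 ≤ ((1 + L + ε₁) * v) ^ 2 := by gcongr
    rw [mul_pow] at h12
    linarith

/-- Under the second-order condition, the subgradients of the perturbed objective near the
reference pair satisfy a uniform quadratic growth inequality. -/
theorem exists_quadratic_growth_perturbed (hf : ContDiff ℝ 2 f₀) (hF : ContDiff ℝ 2 F) {x : E}
    {u : H} {W : H →L[ℝ] H} (hW : SecondOrderLower g (F x) u W)
    (hsymm : ∀ y z, ⟪W y, z⟫_ℝ = ⟪y, W z⟫_ℝ)
    (hpos : ∀ d, d ≠ 0 → ∀ a, W a = fderiv ℝ F x d →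
      0 < hessLagr f₀ F x u d + ⟪fderiv ℝ F x d, a - fderiv ℝ F x d⟫_ℝ) :
    ∃ σ > 0, ∃ κ > 0, ∃ r > 0, ∀ z z' w : WithLp 2 (E × H), dist z (WithLp.toLp 2 (x, 0)) < r →
      dist z' (WithLp.toLp 2 (x, 0)) < r → dist w (WithLp.toLp 2 (0, u)) < r →
      PerturbedPair f₀ F g σ z w →
      perturbedReal f₀ F g σ z + ⟪w, z' - z⟫_ℝ + κ / 2 * ‖z' - z‖ ^ 2
        ≤ perturbedReal f₀ F g σ z' := by
  obtain ⟨Z, N, hZN, hWN⟩ := exists_range_ker_splitting hsymm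
  obtain ⟨k, hk, c, hc, hkc⟩ := exists_penalized_bound hZN hpos
  set ε₁ := Real.sqrt (c / (8 * k)) with hε₁
  have hε₁0 : 0 < ε₁ := Real.sqrt_pos.2 (by positivity)
  have hε₁2 : 2 * k * ε₁ ^ 2 = c / 4 := by
    rw [hε₁, Real.sq_sqrt (by positivity)]; field_simp; norm_num
  set C := 1 + ‖fderiv ℝ F x‖ + ε₁ with hC
  obtain ⟨δ₁, hδ₁, hHL⟩ := hW.penalized hsymm hZN hWN k (η := c / 4) (by positivity)
  obtain ⟨δ₂, hδ₂, hT⟩ := lagr_taylor_lower hf hF x u (ε := c / 4) (by positivity)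
  obtain ⟨δ₃, hδ₃, hI⟩ := increment_bound hF x hε₁0
  have hc1 : Continuous fun z : WithLp 2 (E × H) => z.fst := WithLp.continuous_fst 2 E H
  have hc2 : Continuous fun z : WithLp 2 (E × H) => z.snd := WithLp.continuous_snd 2 E H
  have hFc := hF.continuous
  have n1 : ∀ᶠ z : WithLp 2 (E × H) in 𝓝 (WithLp.toLp 2 (x, 0)), ‖z.fst - x‖ < min δ₂ δ₃ := by
    have : Continuous fun z : WithLp 2 (E × H) => ‖z.fst - x‖ := by fun_prop
    exact (this.tendsto _).eventually_lt_const (by simpa using ⟨hδ₂, hδ₃⟩)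
  have n2 : ∀ᶠ z : WithLp 2 (E × H) in 𝓝 (WithLp.toLp 2 (x, 0)),
      ‖F z.fst + z.snd - F x‖ < δ₁ := by
    have : Continuous fun z : WithLp 2 (E × H) => ‖F z.fst + z.snd - F x‖ := by fun_prop
    exact (this.tendsto _).eventually_lt_const (by simpa using hδ₁)
  have n3 : ∀ᶠ p : WithLp 2 (E × H) × WithLp 2 (E × H) in
      𝓝 (WithLp.toLp 2 (x, 0), WithLp.toLp 2 (0, u)),
      ‖p.2.snd - (4 * k) • p.1.snd - u‖ < min δ₁ δ₂ := by
    have : Continuous fun p : WithLp 2 (E × H) × WithLp 2 (E × H) =>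
        ‖p.2.snd - (4 * k) • p.1.snd - u‖ := by fun_prop
    exact (this.tendsto _).eventually_lt_const (by simpa using ⟨hδ₁, hδ₂⟩)
  obtain ⟨r₁, hr₁, n1⟩ := Metric.eventually_nhds_iff.1 (n1.and n2)
  obtain ⟨r₂, hr₂, n3⟩ := Metric.eventually_nhds_iff.1 n3
  -- With σ = 4k, the square σ/2‖s' - s‖² is the 2k‖s' - s‖² of `penalty_absorb`. One quarter of c
  -- each goes to the expansion of g, the Taylor error and the linearization error; the last quarter
  -- leaves κ.
  refine ⟨4 * k, by positivity, c / (2 * (1 + C ^ 2)), by positivity, min r₁ r₂, by positivity, ?_⟩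
  intro z z' w hz hz' hw hp
  rw [lt_min_iff] at hz hz' hw
  obtain ⟨a1, a2⟩ := n1 hz.1
  obtain ⟨b1, b2⟩ := n1 hz'.1
  have a3 := @n3 (z, w) (by rw [Prod.dist_eq, max_lt_iff]; exact ⟨hz.2, hw.2⟩)
  rw [lt_min_iff] at a1 a3 b1
  have hex := perturbedReal_excess (f₀ := f₀) (F := F) (g := g) (σ := 4 * k) z z' w
  rw [hp.2] at hex
  have h1 := hHL _ _ _ hp.1 a2 a3.1 b2
  have h2 := hT z.fst z'.fst _ a1.1 b1.1 a3.2
  have h3 := hI z.fst z'.fst a1.2 b1.2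
  have h4 := hkc (z'.fst - z.fst) (F z'.fst + z'.snd - (F z.fst + z.snd))
  obtain ⟨h5, h6⟩ := penalty_absorb hk hε₁0.le (norm_nonneg (fderiv ℝ F x)) hε₁2
    (ω := F z'.fst + z'.snd - (F z.fst + z.snd)) (s := z'.snd - z.snd) (by abel) h3
    ((fderiv ℝ F x).le_opNorm (z'.fst - z.fst))
  have h7 : ‖z' - z‖ ^ 2 = ‖z'.fst - z.fst‖ ^ 2 + ‖z'.snd - z.snd‖ ^ 2 :=
    WithLp.prod_norm_sq_eq_of_L2 (z' - z)
  generalize hω : F z'.fst + z'.snd - (F z.fst + z.snd) = ω at *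
  generalize hd : z'.fst - z.fst = d at *
  have h8 : ‖ω‖ ^ 2 ≤ ‖(d, ω)‖ ^ 2 := by gcongr; exact norm_snd_le (d, ω)
  have h9 : ‖d‖ ^ 2 ≤ ‖(d, ω)‖ ^ 2 := by gcongr; exact norm_fst_le (d, ω)
  have h10 : c / (2 * (1 + C ^ 2)) / 2 * ‖z' - z‖ ^ 2 ≤ c / 4 * ‖(d, ω)‖ ^ 2 := by
    calc _ ≤ c / (2 * (1 + C ^ 2)) / 2 * ((1 + C ^ 2) * ‖(d, ω)‖ ^ 2) := by
          gcongr; rw [h7]; exact h6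
      _ = c / 4 * ‖(d, ω)‖ ^ 2 := by field_simp; ring
  have h11 : c / 4 * ‖ω‖ ^ 2 ≤ c / 4 * ‖(d, ω)‖ ^ 2 := by gcongr
  have h12 : c / 4 * ‖d‖ ^ 2 ≤ c / 4 * ‖(d, ω)‖ ^ 2 := by gcongr
  linarith

end QuadraticGrowth

/-! ### From quadratic growth to variational strong convexity, by an envelope of quadratic
minorants. -/

section GrowthEnvelope

variable {E : Type*} [NormedAddCommGroup E] [InnerProductSpace ℝ E]

/-- The quadratic minorant of `G` at `a` with slope `b` and modulus `κ`. -/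
def quadMinorant (G : E → ℝ) (κ : ℝ) (a b z : E) : ℝ :=
  G a + ⟪b, z - a⟫_ℝ + κ / 2 * ‖z - a‖ ^ 2

/-- The pointwise supremum of the quadratic minorants attached to a set of pairs. -/
def quadEnvelope (G : E → ℝ) (κ : ℝ) (T : Set (E × E)) (z : E) : EReal :=
  ⨆ p : T, ((quadMinorant G κ p.1.1 p.1.2 z : ℝ) : EReal)

variable {G : E → ℝ} {κ : ℝ} {T : Set (E × E)}

/-- A quadratic with Hessian κ satisfies the strong convexity inequality with equality, so a
supremum of such functions is κ-strongly convex. -/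
lemma quadMinorant_convex_comb (a b x y : E) {s t : ℝ} (hst : s + t = 1) :
    quadMinorant G κ a b (s • x + t • y) + κ / 2 * (s * t) * ‖x - y‖ ^ 2 =
      s * quadMinorant G κ a b x + t * quadMinorant G κ a b y := by
  have e1 : s • x + t • y - a = s • (x - a) + t • (y - a) := by
    have : a = (s + t) • a := by rw [hst, one_smul]
    conv_lhs => rw [this]
    module
  have e2 : x - y = (x - a) - (y - a) := by abel
  rw [quadMinorant, quadMinorant, quadMinorant, e1, e2, norm_sub_sq_real, norm_add_sq_real,
    norm_smul, norm_smul, inner_add_right]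
  simp only [real_inner_smul_left, real_inner_smul_right, mul_pow, Real.norm_eq_abs, sq_abs]
  have ht : t = 1 - s := by linarith
  rw [ht]
  ring

lemma le_quadEnvelope {p : E × E} (hp : p ∈ T) (z : E) :
    ((quadMinorant G κ p.1 p.2 z : ℝ) : EReal) ≤ quadEnvelope G κ T z :=
  le_iSup (fun p : T => ((quadMinorant G κ p.1.1 p.1.2 z : ℝ) : EReal)) ⟨p, hp⟩

lemma strongConvexE_quadEnvelope : StrongConvexE univ κ (quadEnvelope G κ T) := by
  refine ⟨convex_univ, fun x _ y _ s t hs ht hst => ?_⟩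
  rw [← EReal.le_sub_iff_add_le (Or.inl (EReal.coe_ne_bot _)) (Or.inl (EReal.coe_ne_top _))]
  refine iSup_le fun p => ?_
  rw [EReal.le_sub_iff_add_le (Or.inl (EReal.coe_ne_bot _)) (Or.inl (EReal.coe_ne_top _)),
    ← EReal.coe_add, quadMinorant_convex_comb _ _ _ _ hst, EReal.coe_add, EReal.coe_mul,
    EReal.coe_mul]
  exact add_le_add
    (mul_le_mul_of_nonneg_left (le_quadEnvelope p.2 x) (EReal.coe_nonneg.2 hs.le))
    (mul_le_mul_of_nonneg_left (le_quadEnvelope p.2 y) (EReal.coe_nonneg.2 ht.le))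

lemma lowerSemicontinuous_quadEnvelope : LowerSemicontinuous (quadEnvelope G κ T) := by
  refine lowerSemicontinuous_iSup fun p => ?_
  have : Continuous fun z => quadMinorant G κ p.1.1 p.1.2 z := by unfold quadMinorant; fun_prop
  exact (continuous_coe_real_ereal.comp this).lowerSemicontinuous

lemma convexE_quadEnvelope (hκ : 0 ≤ κ) : ConvexE (quadEnvelope G κ T) := by
  refine ⟨convex_univ, fun x hx y hy s t hs ht hst => le_trans (add_le_add_right ?_ _)
    (strongConvexE_quadEnvelope.2 x hx y hy s t hs ht hst)⟩
  rw [EReal.coe_le_coe_iff, zero_div, zero_mul, zero_mul]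
  positivity

lemma quadEnvelope_ne_bot {p : E × E} (hp : p ∈ T) (z : E) : quadEnvelope G κ T z ≠ ⊥ :=
  ne_bot_of_le_ne_bot (EReal.coe_ne_bot _) (le_quadEnvelope hp z)

/-- The minorant with slope u at x belongs to the supremum and touches it at x. -/
lemma mem_limSubdiff_quadEnvelope (hκ : 0 ≤ κ) {x u : E} (hp : (x, u) ∈ T)
    (h : quadEnvelope G κ T x = (G x : EReal)) : u ∈ limSubdiff (quadEnvelope G κ T) x := by
  refine mem_limSubdiff_of_reg (mem_regSubdiff_of_global ?_ ?_ (Eventually.of_forall fun z => ?_))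
  · rw [h]; exact EReal.coe_ne_top _
  · rw [h]; exact EReal.coe_ne_bot _
  · rw [h, ← EReal.coe_add]
    refine le_trans (EReal.coe_le_coe_iff.2 ?_) (le_quadEnvelope hp z)
    have : 0 ≤ κ / 2 * ‖z - x‖ ^ 2 := by positivity
    rw [quadMinorant]
    linarith

/-- A point near the centre at which the tilted function has a local minimizer. -/
lemma exists_limSubdiff_of_growth [FiniteDimensional ℝ E] (hG : Continuous G) {z₀ w₀ u : E}
    (hκ : 0 < κ) {r : ℝ} (hr : 0 < r)
    (hgrow : ∀ z, dist z z₀ < r → quadMinorant G κ z₀ w₀ z ≤ G z)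
    (hu : ‖u - w₀‖ < κ * r / 4) :
    ∃ z, dist z z₀ < r ∧ u ∈ limSubdiff (fun z => (G z : EReal)) z := by
  -- The tilted function is minimized on the ball of radius r/2; growth and ‖u - w₀‖ < κr/4 exclude
  -- a minimizer on the boundary.
  obtain ⟨z₁, hz₁, hmin⟩ := (isCompact_closedBall z₀ (r / 2)).exists_isMinOn
    ⟨z₀, Metric.mem_closedBall_self (by positivity)⟩
    (f := fun z => G z - ⟪u, z⟫_ℝ)
    (hG.sub (continuous_const.inner continuous_id)).continuousOn
  have hz₁r : dist z₁ z₀ < r := (Metric.mem_closedBall.1 hz₁).trans_lt (by linarith)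
  have h1 : G z₁ - ⟪u, z₁⟫_ℝ ≤ G z₀ - ⟪u, z₀⟫_ℝ :=
    hmin (Metric.mem_closedBall_self (by positivity))
  have h2 := hgrow z₁ hz₁r
  rw [quadMinorant] at h2
  have h3 : κ / 2 * ‖z₁ - z₀‖ ^ 2 ≤ ‖u - w₀‖ * ‖z₁ - z₀‖ := by
    have := real_inner_le_norm (u - w₀) (z₁ - z₀)
    simp only [inner_sub_left, inner_sub_right] at this h2
    linarith
  have h4 : dist z₁ z₀ < r / 2 := by
    rw [dist_eq_norm]
    by_contra hcon
    push Not at hcon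
    have h5 : 0 < ‖z₁ - z₀‖ := by linarith
    have h6 : κ / 2 * ‖z₁ - z₀‖ ≤ ‖u - w₀‖ := by
      refine le_of_mul_le_mul_right ?_ h5
      linarith
    have h7 : κ / 2 * (r / 2) ≤ κ / 2 * ‖z₁ - z₀‖ := by gcongr
    linarith
  refine ⟨z₁, hz₁r, mem_limSubdiff_of_reg (mem_regSubdiff_of_global (EReal.coe_ne_top _)
    (EReal.coe_ne_bot _) ?_)⟩
  filter_upwards [Metric.isOpen_ball.mem_nhds (Metric.mem_ball.2 h4)] with z hz
  have h5 : G z₁ - ⟪u, z₁⟫_ℝ ≤ G z - ⟪u, z⟫_ℝ := hmin (Metric.ball_subset_closedBall hz)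
  rw [← EReal.coe_add, EReal.coe_le_coe_iff, inner_sub_right]
  linarith

lemma eq_of_limSubdiff_strongConvexE {r : E → EReal} (hr : ConvexE r) (hb : ∀ x, r x ≠ ⊥)
    (hκ : 0 < κ) (hs : StrongConvexE univ κ r) {x x' y : E} (h : y ∈ limSubdiff r x)
    (h' : y ∈ limSubdiff r x') : x' = x := by
  have h5 := limSubdiff_strong_monotone hr hb hs (mem_univ x) (mem_univ x') h h'
  rw [sub_self, inner_zero_left] at h5
  have h6 : ‖x' - x‖ ^ 2 ≤ 0 := nonpos_of_mul_nonpos_right h5 hκ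
  have h7 := le_antisymm h6 (sq_nonneg _)
  exact sub_eq_zero.1 (by simpa using h7)

/-- Local quadratic growth of the subgradient inequality implies variational strong convexity. -/
theorem varStronglyConvex_of_growth [FiniteDimensional ℝ E] (hG : Continuous G) {z₀ w₀ : E}
    (hκ : 0 < κ) {r : ℝ} (hr : 0 < r) (h0 : w₀ ∈ limSubdiff (fun z => (G z : EReal)) z₀)
    (hgrow : ∀ z z' w, dist z z₀ < r → dist z' z₀ < r → dist w w₀ < r →
      w ∈ limSubdiff (fun z => (G z : EReal)) z → quadMinorant G κ z w z' ≤ G z') :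
    VarStronglyConvex (fun z => (G z : EReal)) z₀ w₀ κ := by
  obtain ⟨T, hT⟩ : ∃ T : Set (E × E), ∀ p, p ∈ T ↔ dist p.1 z₀ < r ∧ dist p.2 w₀ < r ∧
    p.2 ∈ limSubdiff (fun z => (G z : EReal)) p.1 := ⟨{p | _}, fun p => Iff.rfl⟩
  have hle : ∀ z, dist z z₀ < r → quadEnvelope G κ T z ≤ (G z : EReal) := by
    refine fun z hz => iSup_le fun p => EReal.coe_le_coe_iff.2 ?_
    obtain ⟨h1, h2, h3⟩ := (hT p.1).1 p.2
    exact hgrow _ _ _ h1 hz h2 h3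
  have hself : ∀ p ∈ T, quadEnvelope G κ T p.1 = (G p.1 : EReal) := by
    refine fun p hp => le_antisymm (hle _ ((hT p).1 hp).1)
      ((le_of_eq ?_).trans (le_quadEnvelope hp p.1))
    simp [quadMinorant]
  have h0T : (z₀, w₀) ∈ T := (hT _).2 ⟨by rwa [dist_self], by rwa [dist_self], h0⟩
  -- Any level works: the ball is shrunk until the level condition holds throughout.
  obtain ⟨ε, hε⟩ : ∃ ε : ℝ, 0 < ε := ⟨1, one_pos⟩
  have hnear : ∀ᶠ z in 𝓝 z₀, G z < G z₀ + ε := (hG.tendsto _).eventually_lt_const (by linarith)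
  obtain ⟨ρ, hρ, hρG⟩ := Metric.eventually_nhds_iff.1 hnear
  -- A slope u near w₀ already occurs in T at some z₁, and strong convexity lets the envelope have
  -- slope u at one point only, so x = z₁.
  have hback : ∀ x u, dist u w₀ < r → dist u w₀ < κ * r / 4 →
      u ∈ limSubdiff (quadEnvelope G κ T) x → (x, u) ∈ T := by
    intro x u hu hu' hxu
    rw [dist_eq_norm] at hu'
    obtain ⟨z₁, hz₁, hz₁u⟩ := exists_limSubdiff_of_growth hG hκ hr
      (fun z hz => hgrow z₀ z w₀ (by rwa [dist_self]) hz (by rwa [dist_self]) h0) hu'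
    have hz₁T : (z₁, u) ∈ T := (hT _).2 ⟨hz₁, hu, hz₁u⟩
    have h7 := eq_of_limSubdiff_strongConvexE (convexE_quadEnvelope hκ.le)
      (quadEnvelope_ne_bot h0T) hκ strongConvexE_quadEnvelope hxu
      (mem_limSubdiff_quadEnvelope hκ.le hz₁T (hself (z₁, u) hz₁T))
    rwa [← h7]
  refine ⟨(continuous_coe_real_ereal.comp hG).lowerSemicontinuous, EReal.coe_ne_top _, h0,
    Metric.ball z₀ (min r ρ), Metric.ball_mem_nhds _ (by positivity),
    Metric.ball w₀ (min r (κ * r / 4)), Metric.ball_mem_nhds _ (by positivity),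
    convex_ball _ _, convex_ball _ _, quadEnvelope G κ T, quadEnvelope_ne_bot h0T,
    lowerSemicontinuous_quadEnvelope, convexE_quadEnvelope hκ.le,
    fun z hz => hle z ((Metric.mem_ball.1 hz).trans_le (min_le_left _ _)),
    ⟨convex_ball _ _, fun x _ y _ => strongConvexE_quadEnvelope.2 x (mem_univ _) y (mem_univ _)⟩,
    ε, hε, fun x hx u hu => ?_, fun x hx u hu h => ?_⟩
  · rw [Metric.mem_ball, lt_min_iff] at hx hu
    refine ⟨fun h => ?_, fun h => ?_⟩
    · have hxT : (x, u) ∈ T := (hT _).2 ⟨hx.1, hu.1, h.2⟩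
      exact mem_limSubdiff_quadEnvelope hκ.le hxT (hself (x, u) hxT)
    · refine ⟨?_, ((hT _).1 (hback x u hu.1 hu.2 h)).2.2⟩
      rw [← EReal.coe_add, EReal.coe_lt_coe_iff]
      exact hρG hx.2
  · rw [Metric.mem_ball, lt_min_iff] at hu
    exact (hself (x, u) (hback x u hu.1 hu.2 h)).symm

end GrowthEnvelope

/-! ### The abstract characterization of strong variational sufficiency. -/

section StrongVariationalSufficiency

variable {E H : Type*} [NormedAddCommGroup E] [InnerProductSpace ℝ E] [FiniteDimensional ℝ E]
  [NormedAddCommGroup H] [InnerProductSpace ℝ H] [FiniteDimensional ℝ H]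
  {f₀ : E → ℝ} {F : E → H} {g : H → ℝ}

/-- Strong variational sufficiency is characterized by a second-order condition whenever a limiting
Jacobian of the proximal mapping governs the lower second-order expansion. -/
theorem strongVarSufficiency_iff (hf : ContDiff ℝ 2 f₀) (hF : ContDiff ℝ 2 F)
    (hg : ConvexOn ℝ univ g) (hps : ProxSolvable g) {x : E} {u : H} (hu : SubG g (F x) u)
    (hgrad : gradient (lagr f₀ F u) x = 0) {W : H →L[ℝ] H}
    (hWs : SecondOrderLower g (F x) u W) (hsymm : ∀ y z, ⟪W y, z⟫_ℝ = ⟪y, W z⟫_ℝ)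
    (hWm : W ∈ limJacobian (prox fun X => (g X : EReal)) (F x + u)) :
    StrongVarSufficiency f₀ F (fun X => (g X : EReal)) x u ↔
      ∀ d, d ≠ 0 → ∀ a, W a = fderiv ℝ F x d →
        0 < hessLagr f₀ F x u d + ⟪fderiv ℝ F x d, a - fderiv ℝ F x d⟫_ℝ := by
  have hgc : Continuous g := continuousOn_univ.1 (hg.continuousOn isOpen_univ)
  constructor
  · rintro ⟨σ, hσ, κ, hκ, h⟩ d hd a ha
    have h1 := h.hessLagr_bound hσ.le hf hF hg hgc hps hu hgrad hκ.le hWm ha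
    have h2 : 0 < κ * ‖d‖ ^ 2 := by positivity
    linarith
  · intro hpos
    obtain ⟨σ, hσ, κ, hκ, r, hr, hgrow⟩ := exists_quadratic_growth_perturbed hf hF hWs hsymm hpos
    refine ⟨σ, hσ, κ, hκ, ?_⟩
    rw [perturbed_eq_coe]
    refine varStronglyConvex_of_growth (continuous_perturbedReal hf.continuous hF.continuous hgc)
      hκ hr ?_ fun z z' w hz hz' hw h => ?_
    · rw [mem_limSubdiff_perturbed_iff hσ.le hf hF hg hgc]
      constructor
      · simpa using hu
      · simpa using hgrad.symm
    · rw [mem_limSubdiff_perturbed_iff hσ.le hf hF hg hgc] at h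
      exact hgrow z z' w hz hz' hw h

end StrongVariationalSufficiency

/-! ### Claim 2 for the nuclear norm. -/

section NuclearNormConditions

variable {p q n : ℕ} {R : Matrix (Fin p) (Fin p) ℝ} {σ : Fin p → ℝ} {S : Matrix (Fin q) (Fin q) ℝ}
  {f₀ : EuclideanSpace ℝ (Fin n) → ℝ} {F : EuclideanSpace ℝ (Fin n) → MatSpace p q}
  {x : EuclideanSpace ℝ (Fin n)} {u : MatSpace p q}

/-- Outside the explicit range Γ is infinite, so the inequality is automatic there. -/
theorem ssosc_nuc_iff (hpq : p ≤ q) (hu : SubG nuclearNorm (F x) u)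
    (h : IsSVD (mat (F x + u)) R σ S) :
    SSOSC f₀ F (nuc p q) x u ↔ ExplicitSSOSC hpq f₀ F x u R σ S := by
  obtain ⟨-, h1, h2⟩ := sovf_nuclear hpq hu h
  refine forall_congr' fun d => imp_congr_right fun _ => ?_
  by_cases hd : fderiv ℝ F x d ∈ explicitRange hpq R σ S
  · rw [(h1 _ hd).2, ← EReal.coe_add, EReal.coe_pos]
    simp only [hd, true_imp_iff]
  · rw [h2 _ hd, EReal.coe_add_top]
    simp only [hd, false_imp_iff, iff_true]
    exact EReal.zero_lt_top

theorem strongVarSufficiency_nuc_iff (hpq : p ≤ q) (hf : ContDiff ℝ 2 f₀) (hF : ContDiff ℝ 2 F)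
    (hkkt : IsKKT f₀ F (nuc p q) x u) (h : IsSVD (mat (F x + u)) R σ S) :
    StrongVarSufficiency f₀ F (nuc p q) x u ↔ ExplicitSSOSC hpq f₀ F x u R σ S := by
  have hu := (mem_limSubdiff_nuc_iff hpq).1 hkkt.2
  refine (strongVarSufficiency_iff hf hF (convexOn_nuclearNorm hpq) (proxSolvable_nuclearNorm hpq)
    hu hkkt.1 (secondOrderLower_svd hpq hu h) (svdJac_symm hpq h.1 h.2.1)
    (svdJac_mem hpq hu h)).trans (forall_congr' fun d => imp_congr_right fun _ => ?_)
  rw [explicitRange_eq hpq h.1 h.2.1]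
  constructor
  · rintro hpos ⟨a, ha⟩
    rw [← ha, explicitGamma_svdJac hpq h.1 h.2.1 h.2.2.1 h.2.2.2.1, ha]
    exact hpos a ha
  · intro hpos a ha
    have h1 := hpos ⟨a, ha⟩
    rwa [← ha, explicitGamma_svdJac hpq h.1 h.2.1 h.2.2.1 h.2.2.2.1, ha] at h1

end NuclearNormConditions

end VarSuff

end

theorem mainTheorem6 (p q : ℕ) (hp : 0 < p) (hpq : p ≤ q) :
    (∀ X U : MatSpace p q, U ∈ limSubdiff (nuc p q) X →
      SecondOrderAssumption (nuc p q) X U ∧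
      ∀ (R : Matrix (Fin p) (Fin p) ℝ) (σ : Fin p → ℝ) (S : Matrix (Fin q) (Fin q) ℝ),
        IsSVD (mat (X + U)) R σ S →
        (∃ Wbar : MatSpace p q →L[ℝ] MatSpace p q,
          (∀ D : MatSpace p q, mat (Wbar D) = explicitJacobian hpq R σ S (mat D)) ∧
          IsDominatingJacobian (nuc p q) X U Wbar) ∧
        rangeUnion (nuc p q) X U = explicitRange hpq R σ S ∧
        (∀ Y ∈ explicitRange hpq R σ S,
          IsLeast (sovfValues (nuc p q) X U Y) (explicitGamma hpq R σ S Y) ∧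
          sovf (nuc p q) X U Y = ((explicitGamma hpq R σ S Y : ℝ) : EReal)) ∧
        (∀ Y : MatSpace p q, Y ∉ explicitRange hpq R σ S → sovf (nuc p q) X U Y = ⊤)) ∧
    (∀ (n : ℕ) (f₀ : EuclideanSpace ℝ (Fin n) → ℝ) (F : EuclideanSpace ℝ (Fin n) → MatSpace p q),
      ContDiff ℝ 2 f₀ → ContDiff ℝ 2 F →
      ∀ (x : EuclideanSpace ℝ (Fin n)) (u : MatSpace p q), IsKKT f₀ F (nuc p q) x u →
      ∀ (R : Matrix (Fin p) (Fin p) ℝ) (σ : Fin p → ℝ) (S : Matrix (Fin q) (Fin q) ℝ),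
        IsSVD (mat (F x + u)) R σ S →
        (SSOSC f₀ F (nuc p q) x u ↔ ExplicitSSOSC hpq f₀ F x u R σ S) ∧
        (StrongVarSufficiency f₀ F (nuc p q) x u ↔ ExplicitSSOSC hpq f₀ F x u R σ S)) := by
  refine ⟨fun X U hU => ⟨secondOrderAssumption_nuc hpq hU, fun R σ S h => ?_⟩,
    fun n f₀ F hf hF x u hkkt R σ S h => ?_⟩
  · have hs := (mem_limSubdiff_nuc_iff hpq).1 hU
    exact ⟨⟨_, mat_svdJac_eq hpq h.1 h.2.1, (svdJac_dominating hpq hs h).1⟩, sovf_nuclear hpq hs h⟩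
  · exact ⟨ssosc_nuc_iff hpq ((mem_limSubdiff_nuc_iff hpq).1 hkkt.2) h,
      strongVarSufficiency_nuc_iff hpq hf hF hkkt h⟩
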